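/- Let $n\ge 2$, let $\Gamma\subset O^+(n,1)=\mathrm{Isom}(\mathbb H^n)$ be a discrete torsion-free group, and let $M=\Gamma\backslash\mathbb H^n$ be the resulting complete hyperbolic $n$-manifold. Let $\Delta\subset M$ be a branched totally geodesic hypersurface, that is, a subset whose preimage $\tilde\Delta\subset\mathbb H^n$ is, near every point of $\mathbb H^n$, a finite union of $(n-1)$-dimensional convex polyhedral pieces of hyperplanes. The branching locus $\mathscr B$ of $\Delta$ is the set of points of $\Delta$ near which $\Delta$ is not a totally geodesic hypersurface. The walls are the connected components of $\Delta\setminus\mathscr B$, and $c_{n-1}$ is their number. Let $\mathscr B^{(n-2)}\subset\mathscr B$ be the set of points near which $\Delta$ is a union of finitely many totally geodesic half-hyperplanes with a common $(n-2)$-dimensional boundary; its connected components are the bindings, and $c_{n-2}$ is their number. (If $\mathscr B$ has no corners, then $\mathscr B^{(n-2)}=\mathscr B$ and $c_{n-2}$ is the number of components of $\mathscr B$.) Assume that 1. the walls are transversely orientable (two-sided) in $M$; 2. for every connected component $\delta$ of $\mathbb H^n\setminus\tilde\Delta$, the setwise stabilizer $\mathrm{Fix}_\Gamma(\delta)=\{\gamma\in\Gamma:\gamma\delta=\delta\}$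 is Zariski-dense in $SO^+(n,1)$ (if it contains orientation-reversing elements: its Zariski closure contains $SO^+(n,1)$). Let $\nu_{n+1}$ be the $\mathrm{Ad}$-invariant complement of $\mathfrak{so}(n,1)$ in $\mathfrak{sl}_{n+1}(\mathbb R)$, i.e. the space of trace-free matrices that are self-adjoint for the Lorentzian form, with $\Gamma$ acting by conjugation. Then $$\dim_{\mathbb R}H^1(\Gamma,\nu_{n+1})\ \ge\ c_{n-1}-3\,c_{n-2},$$ in the form $c_{n-1}\le \dim_{\mathbb R} H^1(\Gamma,\nu_{n+1})+3\,c_{n-2}$, an inequality of cardinal numbers which also makes sense if some of these numbers are infinite. -/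

import Mathlib

open Filter Topology

noncomputable section

namespace BranchedBending

/-! ### Minkowski space, hyperbolic space and its isometry group -/

/-- Real square matrices of size `n + 1`. -/
abbrev Mat (n : ℕ) : Type := Matrix (Fin (n + 1)) (Fin (n + 1)) ℝ

/-- The Gram matrix `diag(-1, 1, …, 1)` of Minkowski space `ℝ^{n,1}`; the coordinate of index `0`
is the time coordinate. -/
def J (n : ℕ) : Mat n := Matrix.diagonal (fun i => if i = 0 then -1 else 1)

/-- The Lorentzian bilinear form `-x₀y₀ + x₁y₁ + ⋯ + xₙyₙ`. -/
def mink {n : ℕ} (x y : Fin (n + 1) → ℝ) : ℝ := x ⬝ᵥ (J n).mulVec y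

/-- The upper sheet of the hyperboloid. -/
def hyperboloid (n : ℕ) : Set (Fin (n + 1) → ℝ) := {x | mink x x = -1 ∧ 0 < x 0}

/-- Hyperbolic `n`-space, in the hyperboloid model (with the subspace topology). -/
abbrev Hyp (n : ℕ) : Type := hyperboloid n

lemma mink_mulVec {n : ℕ} {g : Mat n} (h : g.transpose * J n * g = J n)
    (x y : Fin (n + 1) → ℝ) : mink (g.mulVec x) (g.mulVec y) = mink x y := by
  unfold mink
  conv_rhs => rw [← h]
  rw [← Matrix.mulVec_mulVec, ← Matrix.mulVec_mulVec, Matrix.dotProduct_mulVec x,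
    Matrix.vecMul_transpose]

/-- The group `O⁺(n,1) = Isom(ℍⁿ)`: the linear isometries of Minkowski space that preserve the upper
sheet of the hyperboloid. -/
def OPlus (n : ℕ) : Subgroup (GL (Fin (n + 1)) ℝ) where
  carrier := {g | g.val.transpose * J n * g.val = J n ∧
    ∀ x ∈ hyperboloid n, g.val.mulVec x ∈ hyperboloid n}
  one_mem' := by simp
  mul_mem' := by
    rintro a b ⟨ha, ha'⟩ ⟨hb, hb'⟩
    refine ⟨?_, fun x hx => ?_⟩
    · calc (a * b).val.transpose * J n * (a * b).val
          = b.val.transpose * (a.val.transpose * J n * a.val) * b.val := by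
            simp [Matrix.transpose_mul, Matrix.mul_assoc]
        _ = J n := by rw [ha, hb]
    · have := ha' _ (hb' x hx)
      rwa [Matrix.mulVec_mulVec] at this
  inv_mem' := by
    rintro a ⟨ha, ha'⟩
    have h1 : a.val * (a⁻¹).val = 1 := by rw [← Units.val_mul]; simp
    have hi : (a⁻¹).val.transpose * J n * (a⁻¹).val = J n := by
      calc (a⁻¹).val.transpose * J n * (a⁻¹).val
          = (a.val * (a⁻¹).val).transpose * J n * (a.val * (a⁻¹).val) := by
            conv_lhs => rw [← ha]
            simp only [Matrix.transpose_mul, Matrix.mul_assoc]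
        _ = J n := by rw [h1]; simp
    refine ⟨hi, fun x hx => ?_⟩
    have hm : mink ((a⁻¹).val.mulVec x) ((a⁻¹).val.mulVec x) = -1 := by
      rw [mink_mulVec hi]; exact hx.1
    refine ⟨hm, ?_⟩
    by_contra hneg
    set y := (a⁻¹).val.mulVec x with hy
    have hay : a.val.mulVec y = x := by rw [hy, Matrix.mulVec_mulVec, h1, Matrix.one_mulVec]
    have hy0 : y 0 ≠ 0 := by
      intro h0
      have : 0 ≤ mink y y := by
        unfold mink J
        simp only [dotProduct, Matrix.mulVec_diagonal]
        refine Finset.sum_nonneg fun i _ => ?_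
        by_cases hi : i = 0
        · subst hi; simp [h0]
        · simp [hi, mul_self_nonneg]
      linarith
    have hlt : y 0 < 0 := lt_of_le_of_ne (not_lt.mp hneg) hy0
    have hny : -y ∈ hyperboloid n := by
      refine ⟨?_, by simpa using hlt⟩
      have : mink (-y) (-y) = mink y y := by simp [mink, Matrix.mulVec_neg]
      rw [this]; exact hm
    have h2 := (ha' _ hny).2
    rw [Matrix.mulVec_neg, hay] at h2
    have h3 := hx.2
    simp only [Pi.neg_apply] at h2
    linarith

/-- The action of `O⁺(n,1)` on hyperbolic space. -/
instance (n : ℕ) : MulAction (OPlus n) (Hyp n) where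
  smul g x := ⟨g.val.val.mulVec x.val, g.prop.2 x.val x.prop⟩
  one_smul x := Subtype.ext (Matrix.one_mulVec x.val)
  mul_smul g h x := Subtype.ext (Matrix.mulVec_mulVec x.val g.val.val h.val.val).symm

/-- `SO⁺(n,1)`, the identity component of `O⁺(n,1)`. -/
def SOPlus (n : ℕ) : Set (OPlus n) := {g | g.val.val.det = 1}

/-- Zariski density in `SO⁺(n,1)`: every real polynomial in the matrix entries that vanishes on `S`
vanishes on `SO⁺(n,1)`. (If `S` contains orientation reversing isometries, this says that the
Zariski closure of `S` contains `SO⁺(n,1)`.) -/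
def ZariskiDense {n : ℕ} (S : Set (OPlus n)) : Prop :=
  ∀ p : MvPolynomial (Fin (n + 1) × Fin (n + 1)) ℝ,
    (∀ g ∈ S, MvPolynomial.eval (fun ij => g.val.val ij.1 ij.2) p = 0) →
    ∀ g ∈ SOPlus n, MvPolynomial.eval (fun ij => g.val.val ij.1 ij.2) p = 0

/-- `Γ` is a discrete torsion-free group of isometries, so that `Γ \ ℍⁿ` is a complete hyperbolic
`n`-manifold with fundamental group `Γ`. -/
structure IsManifoldGroup {n : ℕ} (Γ : Subgroup (OPlus n)) : Prop where
  discrete : DiscreteTopology Γ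
  torsionFree : ∀ γ ∈ Γ, IsOfFinOrder γ → γ = 1

/-- The hyperbolic manifold `M = Γ \ ℍⁿ`, with the quotient topology. -/
abbrev Mfd {n : ℕ} (Γ : Subgroup (OPlus n)) : Type :=
  Quotient (MulAction.orbitRel Γ (Hyp n))

/-- The covering projection `ℍⁿ → M`. -/
def proj {n : ℕ} (Γ : Subgroup (OPlus n)) : Hyp n → Mfd Γ := fun x => Quotient.mk _ x

/-- The preimage in `ℍⁿ` of a subset of `M`. -/
def lift {n : ℕ} {Γ : Subgroup (OPlus n)} (D : Set (Mfd Γ)) : Set (Hyp n) := proj Γ ⁻¹' D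

/-! ### The coefficient module and its cohomology -/

/-- The Lie algebra `𝔰𝔩ₙ₊₁(ℝ)` as a space of matrices. -/
def sl (n : ℕ) : Submodule ℝ (Mat n) where
  carrier := {X | X.trace = 0}
  add_mem' := by
    intro X Y hX hY
    simp_all [Matrix.trace_add]
  zero_mem' := by simp
  smul_mem' := by
    intro c X hX
    simp_all [Matrix.trace_smul]

/-- The Lie algebra `𝔰𝔬(n,1)` of infinitesimal isometries of Minkowski space. -/
def so (n : ℕ) : Submodule ℝ (Mat n) where
  carrier := {X | X.transpose * J n = -(J n * X)}
  add_mem' := by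
    intro X Y hX hY
    simp only [Set.mem_ofPred_eq] at *
    rw [Matrix.transpose_add, Matrix.add_mul, hX, hY, Matrix.mul_add]; abel
  zero_mem' := by simp
  smul_mem' := by
    intro c X hX
    simp only [Set.mem_ofPred_eq] at *
    rw [Matrix.transpose_smul, Matrix.smul_mul, hX, Matrix.mul_smul, smul_neg]

/-- The module `ν_{n+1}`: the trace-free matrices that are self-adjoint for the Lorentzian form. It
is the complement of `𝔰𝔬(n,1)` in `𝔰𝔩ₙ₊₁(ℝ)` that is invariant under the adjoint action, and
orthogonal to `𝔰𝔬(n,1)` for the trace form, hence for the Killing form; see the facts below. -/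
def nu (n : ℕ) : Submodule ℝ (Mat n) where
  carrier := {X | X.trace = 0 ∧ X.transpose * J n = J n * X}
  add_mem' := by
    rintro X Y ⟨hX, hX'⟩ ⟨hY, hY'⟩
    refine ⟨by simp [Matrix.trace_add, hX, hY], ?_⟩
    rw [Matrix.transpose_add, Matrix.add_mul, hX', hY', Matrix.mul_add]
  zero_mem' := by simp
  smul_mem' := by
    rintro c X ⟨hX, hX'⟩
    refine ⟨by simp [Matrix.trace_smul, hX], ?_⟩
    rw [Matrix.transpose_smul, Matrix.smul_mul, hX', Matrix.mul_smul]

lemma J_mul_J (n : ℕ) : J n * J n = 1 := by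
  unfold J
  rw [Matrix.diagonal_mul_diagonal, ← Matrix.diagonal_one]
  congr 1
  funext i
  by_cases h : i = 0 <;> simp [h]

lemma J_transpose (n : ℕ) : (J n).transpose = J n := Matrix.diagonal_transpose _

lemma J_cancel {n : ℕ} (X : Mat n) : J n * (J n * X) = X := by
  rw [← Matrix.mul_assoc, J_mul_J, Matrix.one_mul]

/-- `ν_{n+1}` is orthogonal to `𝔰𝔬(n,1)` for the trace form. -/
lemma trace_nu_so {n : ℕ} {X Y : Mat n} (hX : X ∈ nu n) (hY : Y ∈ so n) :
    (X * Y).trace = 0 := by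
  have hX' : X.transpose = J n * X * J n := by
    rw [← hX.2, Matrix.mul_assoc, J_mul_J, Matrix.mul_one]
  have hY' : Y.transpose = -(J n * Y * J n) := by
    have h : Y.transpose * J n = -(J n * Y) := hY
    rw [← Matrix.neg_mul, ← h, Matrix.mul_assoc, J_mul_J, Matrix.mul_one]
  have h : (X * Y).trace = -(X * Y).trace := by
    calc (X * Y).trace = (X * Y).transpose.trace := (Matrix.trace_transpose _).symm
      _ = -(J n * (Y * X) * J n).trace := by
          rw [Matrix.transpose_mul, hX', hY', Matrix.neg_mul, Matrix.trace_neg]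
          simp only [Matrix.mul_assoc, J_cancel]
      _ = -(X * Y).trace := by
          rw [Matrix.trace_mul_comm, J_cancel, Matrix.trace_mul_comm]
  linarith

/-- `𝔰𝔬(n,1) ∩ ν_{n+1} = 0`. -/
lemma so_inf_nu (n : ℕ) : so n ⊓ nu n = ⊥ := by
  rw [eq_bot_iff]
  rintro X ⟨h1, h2⟩
  have h1' : X.transpose * J n = -(J n * X) := h1
  have h3 : J n * X = -(J n * X) := h2.2.symm.trans h1'
  have h4 : J n * X = 0 := by
    ext i j
    have h5 := congrFun (congrFun h3 i) j
    simp only [Matrix.neg_apply] at h5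
    simp only [Matrix.zero_apply]
    linarith
  have : X = 0 := by rw [← J_cancel X, h4, Matrix.mul_zero]
  simpa using this

/-- `𝔰𝔬(n,1) + ν_{n+1} = 𝔰𝔩ₙ₊₁(ℝ)`. -/
lemma so_sup_nu (n : ℕ) : so n ⊔ nu n = sl n := by
  have htr : ∀ X : Mat n, (J n * X.transpose * J n).trace = X.trace := by
    intro X
    rw [Matrix.trace_mul_comm, J_cancel, Matrix.trace_transpose]
  apply le_antisymm
  · refine sup_le (fun X hX => ?_) (fun X hX => hX.1)
    have h : X.transpose * J n = -(J n * X) := hX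
    have h2 := htr X
    rw [Matrix.mul_assoc, h, Matrix.mul_neg, J_cancel, Matrix.trace_neg] at h2
    change X.trace = 0
    linarith
  · intro X hX
    have hX' : X.trace = 0 := hX
    rw [Submodule.mem_sup]
    refine ⟨(1 / 2 : ℝ) • (X - J n * X.transpose * J n), ?_,
      (1 / 2 : ℝ) • (X + J n * X.transpose * J n), ?_, ?_⟩
    · refine Submodule.smul_mem _ _ ?_
      change (X - J n * X.transpose * J n).transpose * J n = -(J n * (X - J n * X.transpose * J n))
      simp only [Matrix.transpose_sub, Matrix.transpose_mul, Matrix.transpose_transpose,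
        J_transpose, Matrix.sub_mul, Matrix.mul_sub, Matrix.mul_assoc, J_cancel, J_mul_J,
        Matrix.mul_one]
      abel
    · refine Submodule.smul_mem _ _ ⟨by rw [Matrix.trace_add, htr, hX', add_zero], ?_⟩
      simp only [Matrix.transpose_add, Matrix.transpose_mul, Matrix.transpose_transpose,
        J_transpose, Matrix.add_mul, Matrix.mul_add, Matrix.mul_assoc, J_cancel, J_mul_J,
        Matrix.mul_one]
      abel
    · rw [← smul_add, sub_add_add_cancel, ← two_smul ℝ X, smul_smul]; norm_num

/-- `ν_{n+1}` is invariant under the adjoint action of `O⁺(n,1)`. -/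
lemma ad_mem_nu {n : ℕ} (g : OPlus n) {X : Mat n} (hX : X ∈ nu n) :
    g.val.val * X * (g⁻¹).val.val ∈ nu n := by
  have h1 : (g⁻¹).val.val * g.val.val = 1 := by
    change (g.val⁻¹).val * g.val.val = 1
    rw [← Units.val_mul]; simp
  have h2 : g.val.val * (g⁻¹).val.val = 1 := mul_eq_one_comm.mp h1
  have h2t : (g⁻¹).val.val.transpose * g.val.val.transpose = 1 := by
    rw [← Matrix.transpose_mul, h2, Matrix.transpose_one]
  have hg : g.val.val.transpose * J n = J n * (g⁻¹).val.val := by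
    rw [← Matrix.mul_one (g.val.val.transpose * J n), ← h2, ← Matrix.mul_assoc, g.prop.1]
  have hgi : (g⁻¹).val.val.transpose * J n = J n * g.val.val := by
    rw [← Matrix.mul_one ((g⁻¹).val.val.transpose * J n), ← h1, ← Matrix.mul_assoc, (g⁻¹).prop.1]
  refine ⟨?_, ?_⟩
  · rw [Matrix.trace_mul_comm, ← Matrix.mul_assoc, h1, Matrix.one_mul]; exact hX.1
  · rw [Matrix.transpose_mul, Matrix.transpose_mul, Matrix.mul_assoc, Matrix.mul_assoc, hg,
      ← Matrix.mul_assoc X.transpose, hX.2, Matrix.mul_assoc, ← Matrix.mul_assoc _ (J n), hgi]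
    simp only [Matrix.mul_assoc]

/-- The adjoint representation `X ↦ g X g⁻¹` of `O⁺(n,1)` on `ν_{n+1}`. -/
def adNu (n : ℕ) : Representation ℝ (OPlus n) (nu n) where
  toFun g :=
    { toFun := fun X => ⟨g.val.val * X.val * (g⁻¹).val.val, ad_mem_nu g X.prop⟩
      map_add' := fun X Y => Subtype.ext (by simp [Matrix.mul_add, Matrix.add_mul])
      map_smul' := fun c X => Subtype.ext (by simp) }
  map_one' := by
    ext X : 2
    simp
  map_mul' g h := by
    ext X : 2
    simp [Matrix.mul_assoc]

/-- The first group cohomology `H¹(Γ, ν_{n+1})`. -/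
abbrev H1nu {n : ℕ} (Γ : Subgroup (OPlus n)) : ModuleCat ℝ :=
  groupCohomology.H1 (Rep.of ((adNu n).comp Γ.subtype))

/-! ### Branched totally geodesic hypersurfaces -/

/-- A polyhedral piece of a totally geodesic hyperplane of `ℍⁿ`: the intersection of the hyperplane
`v^⊥` with finitely many half-spaces, having nonempty interior in `v^⊥`. -/
def IsPiece {n : ℕ} (P : Set (Hyp n)) : Prop :=
  ∃ (v : Fin (n + 1) → ℝ) (A : Finset (Fin (n + 1) → ℝ)), v ≠ 0 ∧
    (∃ x : Hyp n, mink v x.val = 0 ∧ ∀ a ∈ A, 0 < mink a x.val) ∧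
    P = {x : Hyp n | mink v x.val = 0 ∧ ∀ a ∈ A, 0 ≤ mink a x.val}

/-- A piecewise totally geodesic complex in `ℍⁿ`, of pure dimension `n - 1`: near every point it
is a finite union of polyhedral pieces of hyperplanes. -/
def IsPiecewiseGeodesic {n : ℕ} (D : Set (Hyp n)) : Prop :=
  ∀ x : Hyp n, ∃ C : Set (Set (Hyp n)), C.Finite ∧ (∀ P ∈ C, IsPiece P) ∧
    ∀ᶠ y in 𝓝 x, y ∈ D ↔ ∃ P ∈ C, y ∈ P

/-- `D` coincides near `x` with the hyperplane `v^⊥` through `x`. (A nonzero `v` orthogonal to a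
point of `ℍⁿ` is automatically spacelike.) -/
def IsTangentAt {n : ℕ} (D : Set (Hyp n)) (x : Hyp n) (v : Fin (n + 1) → ℝ) : Prop :=
  v ≠ 0 ∧ mink v x.val = 0 ∧ ∀ᶠ y in 𝓝 x, y ∈ D ↔ mink v y.val = 0

/-- The points of `D` near which `D` is a totally geodesic hypersurface. The other points of `D` form
its branching locus. -/
def regularPoints {n : ℕ} (D : Set (Hyp n)) : Set (Hyp n) := {x | ∃ v, IsTangentAt D x v}

/-- The points of the branching locus of `D` near which `D` is a union of finitely many
half-hyperplanes with a common boundary of codimension two. Here `E` is the normal plane at `x` of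
the common boundary `E^⊥`, and a linearly independent pair `(v, a)` in `E` stands for the
half-hyperplane `{y ∈ v^⊥ | 0 ≤ ⟨a, y⟩}`. -/
def bindingPoints {n : ℕ} (D : Set (Hyp n)) : Set (Hyp n) :=
  {x | x ∉ regularPoints D ∧ ∃ E : Submodule ℝ (Fin (n + 1) → ℝ), Module.finrank ℝ E = 2 ∧
    (∀ u ∈ E, mink u x.val = 0) ∧
    ∃ S : Finset ((Fin (n + 1) → ℝ) × (Fin (n + 1) → ℝ)), S.Nonempty ∧
      (∀ s ∈ S, s.1 ∈ E ∧ s.2 ∈ E ∧ LinearIndependent ℝ ![s.1, s.2]) ∧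
      ∀ᶠ y in 𝓝 x, y ∈ D ↔ ∃ s ∈ S, mink s.1 y.val = 0 ∧ 0 ≤ mink s.2 y.val}

/-- A branched totally geodesic hypersurface `Δ` in `M = Γ \ ℍⁿ`. -/
def IsBranchedHypersurface {n : ℕ} {Γ : Subgroup (OPlus n)} (Δ : Set (Mfd Γ)) : Prop :=
  IsPiecewiseGeodesic (lift Δ)

/-- The branching locus of `Δ`: the points of `Δ` near which `Δ` is not a totally geodesic
hypersurface. -/
def branchLocus {n : ℕ} {Γ : Subgroup (OPlus n)} (Δ : Set (Mfd Γ)) : Set (Mfd Γ) :=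
  proj Γ '' (lift Δ \ regularPoints (lift Δ))

/-- The part of dimension `n - 2` of the branching locus of `Δ`. It is the whole branching locus
unless there are corners, that is, points where several pieces of the branching locus meet. -/
def bindingLocus {n : ℕ} {Γ : Subgroup (OPlus n)} (Δ : Set (Mfd Γ)) : Set (Mfd Γ) :=
  proj Γ '' bindingPoints (lift Δ)

/-- The walls: the connected components of `Δ` minus its branching locus. -/
abbrev Walls {n : ℕ} {Γ : Subgroup (OPlus n)} (Δ : Set (Mfd Γ)) : Type :=
  ConnectedComponents ↥(Δ \ branchLocus Δ)

/-- The bindings: the connected components of the `(n - 2)`-dimensional part of the branching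
locus. -/
abbrev Bindings {n : ℕ} {Γ : Subgroup (OPlus n)} (Δ : Set (Mfd Γ)) : Type :=
  ConnectedComponents ↥(bindingLocus Δ)

/-- The walls are two-sided in `M`: there is a transverse orientation, that is, a continuous unit
normal field along the complement of the branching locus, invariant under `Γ`. -/
def TransverselyOrientable {n : ℕ} {Γ : Subgroup (OPlus n)} (Δ : Set (Mfd Γ)) : Prop :=
  ∃ N : Hyp n → (Fin (n + 1) → ℝ), ContinuousOn N (regularPoints (lift Δ)) ∧
    ∀ x ∈ regularPoints (lift Δ), mink (N x) (N x) = 1 ∧ IsTangentAt (lift Δ) x (N x) ∧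
      ∀ γ ∈ Γ, N (γ • x) = γ.val.val.mulVec (N x)

/-- The setwise stabilizer in `Γ` of a subset of `ℍⁿ`. -/
def fix {n : ℕ} (Γ : Subgroup (OPlus n)) (δ : Set (Hyp n)) : Set (OPlus n) :=
  {γ | γ ∈ Γ ∧ (fun x => γ • x) '' δ = δ}

/-- Every cell (connected component of the complement of the preimage of `Δ` in `ℍⁿ`) has
a Zariski-dense stabilizer in `Γ`. -/
def CellsZariskiDense {n : ℕ} {Γ : Subgroup (OPlus n)} (Δ : Set (Mfd Γ)) : Prop :=
  ∀ x ∈ (lift Δ)ᶜ, ZariskiDense (fix Γ (connectedComponentIn (lift Δ)ᶜ x))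

end BranchedBending

end

/-! Bending along `Δ` is a jump problem. Give each wall a real weight `t`, and look for a `ν`-valued
function `Φ` on `ℍⁿ`, locally constant off the preimage of `Δ`, that increases by `t • bend N` when
a lift of the wall is crossed in the direction of its unit conormal `N`, where `bend N` is the
trace-free part of `N ⊗ N`. A solution is unique up to an additive constant. The data are
`Γ`-equivariant, so transporting `Φ` by `γ` gives `Φ + c γ`, and `c` is a cocycle. If `c` is the
coboundary of `v`, then `Φ - v` is invariant. Its value on a cell is fixed by the stabilizer of the
cell, hence zero, because a Zariski-dense set has no nonzero invariants in `ν`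
(`eq_zero_of_zariskiDense`). All jumps then vanish and so do the weights. The solvable weights
therefore contribute their full dimension to `H¹` (`rank_globalWeights_le`).

The only obstruction sits at the bindings: the jumps met on a small loop around a binding must add
up to zero. There the conormals lie in a plane `E`, and `bend` is quadratic, so the sum lies in a
space of dimension at most three (`bend_comb`, `BindingChart.rank_quotient_le`). Solvability is
unchanged by `Γ` and by translation along the binding, so a whole binding costs at most three linear
conditions (`mk_walls_le`). If there are infinitely many bindings, countability of the set of walls
suffices.

Strata of codimension three or more impose nothing, since removing them leaves a convex set simply
connected. In place of loops, `Adapted.exists_isSolAt` uses induction on the hyperplanes of a finite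
arrangement: solve on both sides of one hyperplane and glue along its part of codimension at most
two, which is connected. An exhaustion by convex sets passes to locally finite arrangements.

The analysis takes place on the open future cone, where hyperplanes are linear and convexity is the
usual one. Values on the walls are immaterial, so functions are compared on dense open sets only, by
means of the filter `genNhds`. Solutions are not canonical, so linear relations take the place of
linear maps. -/

noncomputable section

namespace BranchedBending

/-! ### The filter of generic points near a point -/

section Generic

variable {X : Type*} [TopologicalSpace X]

/-- The filter of the sets that contain, near `x`, a dense open set. -/
def genNhds (x : X) : Filter X where
  sets := {s | ∀ᶠ y in 𝓝 x, y ∈ closure (interior s)}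
  univ_sets := by simp
  sets_of_superset := by
    intro s t hs hst
    exact hs.mono fun y hy => closure_mono (interior_mono hst) hy
  inter_sets := by
    intro s t hs ht
    obtain ⟨O, hO, hOo, hxO⟩ := eventually_nhds_iff.mp (hs.and ht)
    refine eventually_nhds_iff.mpr ⟨O, fun y hy => ?_, hOo, hxO⟩
    have h1 : y ∈ closure (O ∩ interior s) := hOo.inter_closure ⟨hy, (hO y hy).1⟩
    have h2 : O ∩ interior s ⊆ closure (interior (s ∩ t)) := by
      rintro w ⟨hwO, hws⟩
      rw [interior_inter]
      exact isOpen_interior.inter_closure ⟨hws, (hO w hwO).2⟩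
    exact closure_minimal h2 isClosed_closure h1

lemma mem_genNhds {x : X} {s : Set X} :
    s ∈ genNhds x ↔ ∀ᶠ y in 𝓝 x, y ∈ closure (interior s) := Iff.rfl

lemma genNhds_le_nhds (x : X) : genNhds x ≤ 𝓝 x := by
  intro s hs
  rw [mem_genNhds]
  filter_upwards [eventually_mem_nhds_iff.mpr hs] with y hy
  exact subset_closure (mem_interior_iff_mem_nhds.mpr hy)

lemma eventually_genNhds_of_nhds {x : X} {p : X → Prop} (h : ∀ᶠ y in 𝓝 x, p y) :
    ∀ᶠ y in genNhds x, p y := genNhds_le_nhds x h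

/-- This openness in the base point is what makes generic identities propagate along connected sets.
-/
lemma eventually_eventually_genNhds {x : X} {p : X → Prop} (h : ∀ᶠ y in genNhds x, p y) :
    ∀ᶠ y in 𝓝 x, ∀ᶠ z in genNhds y, p z :=
  eventually_eventually_nhds.mpr (show ∀ᶠ y in 𝓝 x, y ∈ closure (interior {z | p z}) from h)

/-- A property that holds generically near the points of a dense set holds generically. -/
lemma eventually_genNhds_of_dense {x : X} {p : X → Prop} {s : Set X} (hs : Dense s)
    (h : ∀ᶠ y in 𝓝 x, y ∈ s → ∀ᶠ z in genNhds y, p z) : ∀ᶠ z in genNhds x, p z := by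
  obtain ⟨O, hO, hOo, hxO⟩ := eventually_nhds_iff.mp h
  refine mem_genNhds.mpr (eventually_nhds_iff.mpr ⟨O, fun y hy => ?_, hOo, hxO⟩)
  have h1 : y ∈ closure (O ∩ s) := hs.open_subset_closure_inter hOo hy
  refine closure_minimal ?_ isClosed_closure h1
  rintro w ⟨hwO, hws⟩
  exact (mem_genNhds.mp (hO w hwO hws)).self_of_nhds

/-- Lets a generic identity be evaluated on a prescribed side of a hyperplane through `x`. -/
lemma frequently_genNhds_of_mem_closure {x : X} {O : Set X} (hO : IsOpen O)
    (hx : x ∈ closure O) : ∃ᶠ y in genNhds x, y ∈ O := by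
  intro h
  have h' : {y | y ∉ O} ∈ genNhds x := h
  rw [mem_genNhds] at h'
  obtain ⟨W, hW, hWo, hxW⟩ := eventually_nhds_iff.mp h'
  obtain ⟨y, hyW, hyO⟩ := mem_closure_iff.mp hx W hWo hxW
  obtain ⟨z, hzO, hz⟩ := mem_closure_iff.mp (hW y hyW) O hO hyO
  exact interior_subset hz hzO

instance (x : X) : (genNhds x).NeBot := by
  have := frequently_genNhds_of_mem_closure isOpen_univ (x := x) (by simp)
  exact ⟨fun h => this (by rw [h]; trivial)⟩

/-- Preimages of dense sets under an open map are dense. -/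
lemma tendsto_genNhds {Y : Type*} [TopologicalSpace Y] {f : X → Y} (hf : Continuous f)
    (hf' : IsOpenMap f) (x : X) : Tendsto f (genNhds x) (genNhds (f x)) := by
  intro s hs
  rw [mem_genNhds] at hs
  rw [mem_map, mem_genNhds]
  filter_upwards [hf.continuousAt.eventually hs] with y hy
  have h1 : y ∈ f ⁻¹' closure (interior s) := hy
  have h2 := hf'.preimage_closure_subset_closure_preimage h1
  exact closure_mono (preimage_interior_subset_interior_preimage hf) h2

end Generic

/-- A choice that is unique and open along a preconnected set is constant. -/
lemma exists_const_of_isPreconnected {X : Type*} [TopologicalSpace X] {A : Type*} [Nonempty A]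
    {K : Set X} (hK : IsPreconnected K) (P : X → A → Prop) (hex : ∀ x ∈ K, ∃ d, P x d)
    (hopen : ∀ x ∈ K, ∀ d, P x d → ∀ᶠ y in 𝓝[K] x, P y d)
    (huniq : ∀ x ∈ K, ∀ d e, P x d → P x e → d = e) : ∃ d, ∀ x ∈ K, P x d := by
  classical
  rcases K.eq_empty_or_nonempty with rfl | ⟨x₀, hx₀⟩
  · exact ⟨Classical.arbitrary A, by simp⟩
  choose! d hd using hex
  refine ⟨d x₀, fun x hx => ?_⟩
  have : d x₀ = d x := by
    refine hK.induction₂ (fun x y => d x = d y) (fun x hx => ?_) ?_ ?_ hx₀ hx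
    · filter_upwards [hopen x hx _ (hd x hx), self_mem_nhdsWithin] with y hy hyK
      exact huniq y hyK _ _ hy (hd y hyK)
    · intro x y z _ _ _ h1 h2; exact h1.trans h2
    · intro x y _ _ h; exact h.symm
  rw [this]; exact hd x hx

/-! ### Hyperplane arrangements -/

section Arrangement

open Module Submodule

variable {V : Type*} [NormedAddCommGroup V] [NormedSpace ℝ V]

lemma dense_ne_zero {f : Dual ℝ V} (hf : f ≠ 0) : Dense {x : V | f x ≠ 0} := by
  obtain ⟨v, hv⟩ : ∃ v, f v ≠ 0 := by
    by_contra! h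
    exact hf (LinearMap.ext h)
  intro x
  by_cases hx : f x = 0
  · have hlim : Tendsto (fun s : ℝ => x + s • v) (𝓝[≠] 0) (𝓝 x) := by
      have : Continuous fun s : ℝ => x + s • v := by fun_prop
      have h := this.tendsto 0
      simp only [zero_smul, add_zero] at h
      exact h.mono_left nhdsWithin_le_nhds
    refine mem_closure_of_tendsto hlim ?_
    filter_upwards [self_mem_nhdsWithin] with s hs
    have hs' : s ≠ 0 := hs
    simp [hx, hs', hv]
  · exact subset_closure hx

/-- The codimension at `x` of the stratum of the arrangement `𝓕` through `x`. -/
def codimAt (𝓕 : Set (Dual ℝ V)) (x : V) : ℕ := finrank ℝ (span ℝ {f | f ∈ 𝓕 ∧ f x = 0})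

lemma codimAt_eq_zero {𝓕 : Set (Dual ℝ V)} {x : V} (h : ∀ f ∈ 𝓕, f x ≠ 0) : codimAt 𝓕 x = 0 := by
  have : {f | f ∈ 𝓕 ∧ f x = 0} = ∅ := by
    ext f; simp only [Set.mem_ofPred_eq, Set.mem_empty_iff_false, iff_false]
    exact fun hf => h f hf.1 hf.2
  rw [codimAt, this, span_empty, finrank_bot]

lemma exists_of_two_le_codimAt {𝓕 : Set (Dual ℝ V)} {x : V} (h : 2 ≤ codimAt 𝓕 x) :
    ∃ f ∈ 𝓕, ∃ g ∈ 𝓕, f x = 0 ∧ g x = 0 ∧ LinearIndependent ℝ ![f, g] := by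
  by_contra! hc
  suffices h1 : codimAt 𝓕 x ≤ 1 by omega
  by_cases hz : ∃ f ∈ 𝓕, f x = 0 ∧ f ≠ 0
  · obtain ⟨f, hf, hfx, hf0⟩ := hz
    have : span ℝ {f | f ∈ 𝓕 ∧ f x = 0} ≤ span ℝ {f} := by
      rw [span_le]
      rintro g ⟨hg, hgx⟩
      have h2 := hc f hf g hg hfx hgx
      rw [LinearIndependent.pair_iff' hf0] at h2
      push Not at h2
      obtain ⟨a, ha⟩ := h2
      exact mem_span_singleton.mpr ⟨a, ha⟩
    exact (Submodule.finrank_mono this).trans (finrank_span_singleton hf0).le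
  · push Not at hz
    have : span ℝ {f | f ∈ 𝓕 ∧ f x = 0} ≤ ⊥ := by
      rw [span_le]
      rintro g ⟨hg, hgx⟩
      exact hz g hg hgx
    have := Submodule.finrank_mono this
    rw [finrank_bot] at this
    exact this.trans (by omega)

variable [FiniteDimensional ℝ V]

lemma isOpen_ne_zero (f : Dual ℝ V) : IsOpen {x : V | f x ≠ 0} :=
  isOpen_ne_fun f.continuous_of_finiteDimensional continuous_const

lemma isOpen_pos (f : Dual ℝ V) : IsOpen {x : V | 0 < f x} :=
  isOpen_lt continuous_const f.continuous_of_finiteDimensional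

lemma dense_forall_ne_zero {𝓕 : Set (Dual ℝ V)} (h𝓕 : 𝓕.Finite) (h0 : ∀ f ∈ 𝓕, f ≠ 0) :
    IsOpen {x : V | ∀ f ∈ 𝓕, f x ≠ 0} ∧ Dense {x : V | ∀ f ∈ 𝓕, f x ≠ 0} := by
  induction 𝓕, h𝓕 using Set.Finite.induction_on with
  | empty => simp
  | @insert f 𝓕 hf h𝓕 ih =>
    obtain ⟨h1, h2⟩ := ih fun g hg => h0 g (Set.mem_insert_of_mem _ hg)
    have : {x : V | ∀ g ∈ insert f 𝓕, g x ≠ 0} = {x : V | f x ≠ 0} ∩ {x | ∀ g ∈ 𝓕, g x ≠ 0} := by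
      ext x; simp
    rw [this]
    exact ⟨(isOpen_ne_zero f).inter h1,
      (dense_ne_zero (h0 f (Set.mem_insert _ _))).inter_of_isOpen_left h2 (isOpen_ne_zero f)⟩

lemma codimAt_mono {𝓕 𝓖 : Set (Dual ℝ V)} {x y : V}
    (h : ∀ f ∈ 𝓕, f x = 0 → f ∈ 𝓖 ∧ f y = 0) : codimAt 𝓕 x ≤ codimAt 𝓖 y :=
  Submodule.finrank_mono (span_mono fun f hf => h f hf.1 hf.2)

lemma eventually_vanishing {𝓕 : Set (Dual ℝ V)} (h𝓕 : 𝓕.Finite) (x : V) :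
    ∀ᶠ y in 𝓝 x, ∀ f ∈ 𝓕, f y = 0 → f x = 0 := by
  refine (Filter.eventually_all_finite h𝓕).mpr fun f _ => ?_
  by_cases hx : f x = 0
  · exact Eventually.of_forall fun _ _ => hx
  · filter_upwards [(isOpen_ne_zero f).mem_nhds hx] with y hy h using absurd h hy

/-- Finitely many forms: those nonzero at `x` stay nonzero nearby, so the set of vanishing forms can
only shrink. -/
lemma eventually_codimAt_le {𝓕 : Set (Dual ℝ V)} (h𝓕 : 𝓕.Finite) (x : V) :
    ∀ᶠ y in 𝓝 x, codimAt 𝓕 y ≤ codimAt 𝓕 x := by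
  filter_upwards [eventually_vanishing h𝓕 x] with y hy
  exact codimAt_mono fun f hf hfy => ⟨hf, hy f hf hfy⟩

lemma dense_codimAt_le {𝓕 : Set (Dual ℝ V)} (h𝓕 : 𝓕.Finite) (h0 : ∀ f ∈ 𝓕, f ≠ 0) (k : ℕ) :
    Dense {x : V | codimAt 𝓕 x ≤ k} :=
  (dense_forall_ne_zero h𝓕 h0).2.mono fun x hx => by
    change codimAt 𝓕 x ≤ k
    rw [codimAt_eq_zero hx]; exact Nat.zero_le _

lemma two_le_codimAt {𝓕 : Set (Dual ℝ V)} {x : V} {f g : Dual ℝ V} (hf : f ∈ 𝓕) (hg : g ∈ 𝓕)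
    (hfx : f x = 0) (hgx : g x = 0) (h : LinearIndependent ℝ ![f, g]) : 2 ≤ codimAt 𝓕 x := by
  have h1 := finrank_span_eq_card h
  refine h1.ge.trans ?_
  refine Submodule.finrank_mono (span_mono ?_)
  rintro _ ⟨i, rfl⟩
  fin_cases i
  · exact ⟨hf, hfx⟩
  · exact ⟨hg, hgx⟩

/-- A convex open set remains connected when the strata of codimension two are removed. -/
lemma isPreconnected_codimAt_le_one {𝓕 : Set (Dual ℝ V)} (h𝓕 : 𝓕.Finite) {U : Set V}
    (hU : IsOpen U) (hUc : Convex ℝ U) : IsPreconnected {x | x ∈ U ∧ codimAt 𝓕 x ≤ 1} := by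
  refine isPreconnected_of_forall_pair fun p hp q hq => ?_
  obtain ⟨ε, hε, hball⟩ := Metric.eventually_nhds_iff_ball.mp
    ((hU.eventually_mem hq.1).and (eventually_codimAt_le h𝓕 q))
  -- If `f` and `g` vanish at a common point of the segment from `p` to `z`, other than `p`, then `f
  -- p • g - g p • f`, which kills `p`, also kills `z`. A generic `z` near `q` avoids all these
  -- forms, so the segment from `p` to `z` misses the strata of codimension two.
  set 𝓚 : Set (Dual ℝ V) :=
    ((fun fg : Dual ℝ V × Dual ℝ V => fg.1 p • fg.2 - fg.2 p • fg.1) '' (𝓕 ×ˢ 𝓕)) \ {0} with h𝓚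
  have h𝓚f : 𝓚.Finite := ((h𝓕.prod h𝓕).image _).subset Set.sdiff_subset
  obtain ⟨z, hzK, hz⟩ := (dense_forall_ne_zero h𝓚f fun f hf => hf.2).2.exists_dist_lt q hε
  have hzb : z ∈ Metric.ball q ε := by rwa [Metric.mem_ball, dist_comm]
  have hqb : q ∈ Metric.ball q ε := Metric.mem_ball_self hε
  refine ⟨segment ℝ p z ∪ segment ℝ z q, ?_, Or.inl (left_mem_segment ℝ p z),
    Or.inr (right_mem_segment ℝ z q), ?_⟩
  · rintro w (hw | hw)
    · refine ⟨hUc.segment_subset hp.1 (hball z hzb).1 hw, ?_⟩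
      by_contra hlt
      obtain ⟨f, hf, g, hg, hfw, hgw, hfg⟩ := exists_of_two_le_codimAt (by omega : 2 ≤ codimAt 𝓕 w)
      obtain ⟨a, b, ha, hb, hab, rfl⟩ := hw
      have hp' : ¬ (f p = 0 ∧ g p = 0) := fun h => by
        have := two_le_codimAt hf hg h.1 h.2 hfg
        have := hp.2
        omega
      have hk0 : f p • g - g p • f ≠ 0 := by
        intro h
        have h2 := LinearIndependent.pair_iff.mp hfg (-(g p)) (f p) (by rw [← h]; module)
        exact hp' ⟨h2.2, by simpa using h2.1⟩
      have hkz := hzK _ ⟨⟨(f, g), ⟨hf, hg⟩, rfl⟩, hk0⟩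
      simp only [map_add, map_smul, smul_eq_mul, LinearMap.sub_apply, LinearMap.smul_apply]
        at hfw hgw hkz
      have hb0 : b * (f p * g z - g p * f z) = 0 := by linear_combination f p * hgw - g p * hfw
      rcases mul_eq_zero.mp hb0 with h | h
      · have ha1 : a = 1 := by linarith
        subst h ha1
        exact hp' ⟨by linarith, by linarith⟩
      · exact hkz h
    -- The segment from `z` to `q` stays in the ball, where the codimension is at most that of `q`.
    · have hwb := (convex_ball q ε).segment_subset hzb hqb hw
      exact ⟨(hball w hwb).1, (hball w hwb).2.trans hq.2⟩
  · exact IsPreconnected.union z (right_mem_segment ℝ p z) (left_mem_segment ℝ z q)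
      (convex_segment p z).isPreconnected (convex_segment z q).isPreconnected

/-- The part of codimension one of a hyperplane section of a convex open set is connected. -/
lemma exists_isPreconnected_hyperplane {𝓕 : Set (Dual ℝ V)} (h𝓕 : 𝓕.Finite) {f : Dual ℝ V}
    (hf0 : f ≠ 0) (hf : f ∈ 𝓕) {U : Set V} (hU : IsOpen U) (hUc : Convex ℝ U) :
    IsPreconnected {x | x ∈ U ∧ f x = 0 ∧ codimAt 𝓕 x ≤ 2} := by
  set H := LinearMap.ker f
  set ρ : Dual ℝ V →ₗ[ℝ] Dual ℝ H := H.subtype.dualMap with hρ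
  -- A form that vanishes on the hyperplane is a multiple of `f`.
  have hker : ∀ g, ρ g = 0 → g ∈ span ℝ {f} := by
    intro g hg
    have h1 : (⨅ i : Fin 1, LinearMap.ker ((fun _ => f : Fin 1 → Dual ℝ V) i)) ≤ LinearMap.ker g := by
      intro x hx
      have hx' : f x = 0 := by simpa using hx
      exact LinearMap.congr_fun hg ⟨x, hx'⟩
    have := mem_span_of_iInf_ker_le_ker h1
    simpa [Set.range_const] using this
  have key : {x | x ∈ U ∧ f x = 0 ∧ codimAt 𝓕 x ≤ 2} =
      Subtype.val '' {x : H | x ∈ (H.subtype ⁻¹' U) ∧ codimAt (ρ '' 𝓕) x ≤ 1} := by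
    -- Restriction to `H` loses exactly the line of `f`, which belongs to the span since `f ∈ 𝓕`
    -- vanishes on `H`. This reduces the claim to codimension one inside `H`.
    have hcod : ∀ x : H, codimAt 𝓕 (x : V) = codimAt (ρ '' 𝓕) x + 1 := by
      intro x
      have hS : (span ℝ {g | g ∈ 𝓕 ∧ g (x : V) = 0}).map ρ =
          span ℝ {g | g ∈ ρ '' 𝓕 ∧ g x = 0} := by
        rw [map_span]
        congr 1
        ext g
        constructor
        · rintro ⟨g, ⟨hg, hgx⟩, rfl⟩
          exact ⟨⟨g, hg, rfl⟩, hgx⟩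
        · rintro ⟨⟨g, hg, rfl⟩, hgx⟩
          exact ⟨g, ⟨hg, hgx⟩, rfl⟩
      set S := span ℝ {g | g ∈ 𝓕 ∧ g (x : V) = 0} with hSdef
      have hfS : f ∈ S := subset_span ⟨hf, x.2⟩
      have h1 := LinearMap.finrank_range_add_finrank_ker (K := ℝ) (V := S) (V₂ := Dual ℝ H)
        (ρ.domRestrict S)
      rw [LinearMap.range_domRestrict, hS] at h1
      have h2 : LinearMap.ker (ρ.domRestrict S) = span ℝ {(⟨f, hfS⟩ : S)} := by
        ext ⟨g, hg⟩
        rw [LinearMap.mem_ker, mem_span_singleton]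
        constructor
        · intro h
          obtain ⟨a, ha⟩ := mem_span_singleton.mp (hker g h)
          exact ⟨a, Subtype.ext ha⟩
        · rintro ⟨a, ha⟩
          have ha' : a • f = g := congrArg Subtype.val ha
          change ρ g = 0
          rw [← ha', map_smul]
          have : ρ f = 0 := LinearMap.ext fun y => y.2
          rw [this, smul_zero]
      have h3 : finrank ℝ (span ℝ {(⟨f, hfS⟩ : S)}) = 1 :=
        finrank_span_singleton (K := ℝ) (V := S) fun h => hf0 (congrArg Subtype.val h)
      rw [h2] at h1
      exact (h1.symm.trans (congrArg _ h3))
    ext x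
    constructor
    · rintro ⟨hxU, hfx, hc⟩
      refine ⟨⟨x, hfx⟩, ⟨hxU, ?_⟩, rfl⟩
      have := hcod ⟨x, hfx⟩
      change codimAt 𝓕 x = _ at this
      omega
    · rintro ⟨y, ⟨hyU, hc⟩, rfl⟩
      refine ⟨hyU, y.2, ?_⟩
      rw [hcod y]; omega
  rw [key]
  refine IsPreconnected.image ?_ _ continuous_subtype_val.continuousOn
  exact isPreconnected_codimAt_le_one (h𝓕.image _) (hU.preimage continuous_subtype_val)
    (hUc.linear_preimage H.subtype)

end Arrangement

/-! ### Functions with prescribed jumps -/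

section LocalSolutions

variable {V : Type*} [TopologicalSpace V] {A : Type*} [AddCommGroup A]

/-- Near `y`, the function `Φ` agrees generically with the model `Ψ y`, up to a constant. -/
def IsSolAt (Ψ : V → V → A) (Φ : V → A) (y : V) : Prop :=
  ∃ c, ∀ᶠ z in genNhds y, Φ z = Ψ y z + c

/-- Near `x` there is a function that follows the models at all the points of `Q`. -/
def LocSolvable (Ψ : V → V → A) (Q : Set V) (x : V) : Prop :=
  ∃ Φ : V → A, ∀ᶠ y in 𝓝 x, y ∈ Q → IsSolAt Ψ Φ y

lemma IsSolAt.congr {Ψ : V → V → A} {Φ Φ' : V → A} {y : V} (h : IsSolAt Ψ Φ y) {c : A}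
    (hc : ∀ᶠ z in genNhds y, Φ' z = Φ z + c) : IsSolAt Ψ Φ' y := by
  obtain ⟨e, he⟩ := h
  refine ⟨e + c, ?_⟩
  filter_upwards [he, hc] with z h1 h2
  rw [h2, h1, add_assoc]

lemma IsSolAt.congr_nhds {Ψ : V → V → A} {Φ Φ' : V → A} {y : V} (h : IsSolAt Ψ Φ y) {c : A}
    (hc : ∀ᶠ z in 𝓝 y, Φ' z = Φ z + c) : IsSolAt Ψ Φ' y :=
  h.congr (eventually_genNhds_of_nhds hc)

/-- If zero is a solution at `y`, the model at `y` has no jump there. -/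
lemma IsSolAt.const_of_zero {Ψ : V → V → A} {Φ : V → A} {y : V} (h : IsSolAt Ψ Φ y)
    (h0 : IsSolAt Ψ 0 y) : ∃ c, ∀ᶠ z in genNhds y, Φ z = c := by
  obtain ⟨e, he⟩ := h
  obtain ⟨e', he'⟩ := h0
  refine ⟨e - e', ?_⟩
  filter_upwards [he, he'] with z h1 h2
  have h2' : Ψ y z = -e' := eq_neg_of_add_eq_zero_left h2.symm
  rw [h1, h2', neg_add_eq_sub]

end LocalSolutions

/-! ### Jump problems on a convex set with a finite hyperplane arrangement -/

section Solutions

open Module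

variable {V : Type*} [NormedAddCommGroup V] [NormedSpace ℝ V] {A : Type*} [AddCommGroup A]

/-- The arrangement `𝓕` controls in `U` where models are given and where they fit together. -/
structure Adapted (Ψ : V → V → A) (Q : Set V) (𝓕 : Set (Dual ℝ V)) (U : Set V) : Prop where
  finite : 𝓕.Finite
  ne_zero : ∀ f ∈ 𝓕, f ≠ 0
  mem : ∀ x ∈ U, codimAt 𝓕 x ≤ 1 → x ∈ Q
  locSolvable : ∀ x ∈ U, codimAt 𝓕 x ≤ 2 → LocSolvable Ψ Q x
  sol_zero : ∀ x ∈ U, (∀ f ∈ 𝓕, f x ≠ 0) → IsSolAt Ψ 0 x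

lemma Adapted.mono {Ψ : V → V → A} {Q : Set V} {𝓕 : Set (Dual ℝ V)} {U W : Set V}
    (h : Adapted Ψ Q 𝓕 U) (hW : W ⊆ U) : Adapted Ψ Q 𝓕 W :=
  ⟨h.finite, h.ne_zero, fun x hx => h.mem x (hW hx), fun x hx => h.locSolvable x (hW hx),
    fun x hx => h.sol_zero x (hW hx)⟩

lemma convex_pos (f : Dual ℝ V) : Convex ℝ {x | 0 < f x} := convex_halfSpace_gt f.isLinear 0

lemma mem_closure_pos {f : Dual ℝ V} (hf : f ≠ 0) {x : V} (hx : f x = 0) :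
    x ∈ closure {x | 0 < f x} := by
  obtain ⟨v, hv⟩ : ∃ v, 0 < f v := by
    obtain ⟨v, hv⟩ : ∃ v, f v ≠ 0 := by
      by_contra! h
      exact hf (LinearMap.ext h)
    rcases lt_or_gt_of_ne hv with h | h
    exacts [⟨-v, by simpa using h⟩, ⟨v, h⟩]
  have hlim : Tendsto (fun s : ℝ => x + s • v) (𝓝[>] 0) (𝓝 x) := by
    have : Continuous fun s : ℝ => x + s • v := by fun_prop
    have h := this.tendsto 0
    simp only [zero_smul, add_zero] at h
    exact h.mono_left nhdsWithin_le_nhds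
  refine mem_closure_of_tendsto hlim ?_
  filter_upwards [self_mem_nhdsWithin] with s hs
  have hs' : 0 < s := hs
  simp only [map_add, hx, map_smul, smul_eq_mul, zero_add]
  positivity

lemma mem_closure_neg {f : Dual ℝ V} (hf : f ≠ 0) {x : V} (hx : f x = 0) :
    x ∈ closure {x | f x < 0} := by
  have := mem_closure_pos (f := -f) (neg_ne_zero.mpr hf) (x := x) (by simp [hx])
  simpa using this

variable [FiniteDimensional ℝ V]

/-- Enlarging the arrangement raises codimensions, so it only weakens what `Adapted` asks for. -/
lemma Adapted.union {Ψ : V → V → A} {Q : Set V} {𝓕 𝓖 : Set (Dual ℝ V)} {U W : Set V}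
    (hU : Adapted Ψ Q 𝓕 U) (hW : Adapted Ψ Q 𝓖 W) : Adapted Ψ Q (𝓕 ∪ 𝓖) (U ∪ W) := by
  have h1 : ∀ x, codimAt 𝓕 x ≤ codimAt (𝓕 ∪ 𝓖) x := fun x =>
    codimAt_mono fun f hf hx => ⟨Or.inl hf, hx⟩
  have h2 : ∀ x, codimAt 𝓖 x ≤ codimAt (𝓕 ∪ 𝓖) x := fun x =>
    codimAt_mono fun f hf hx => ⟨Or.inr hf, hx⟩
  refine ⟨hU.finite.union hW.finite, ?_, ?_, ?_, ?_⟩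
  · rintro f (hf | hf)
    exacts [hU.ne_zero f hf, hW.ne_zero f hf]
  · rintro x (hx | hx) h
    exacts [hU.mem x hx ((h1 x).trans h), hW.mem x hx ((h2 x).trans h)]
  · rintro x (hx | hx) h
    exacts [hU.locSolvable x hx ((h1 x).trans h), hW.locSolvable x hx ((h2 x).trans h)]
  · rintro x (hx | hx) h
    exacts [hU.sol_zero x hx fun f hf => h f (Or.inl hf),
      hW.sol_zero x hx fun f hf => h f (Or.inr hf)]

/-- Two solutions on a convex open set differ by a constant. -/
lemma exists_const_of_isSolAt {Ψ : V → V → A} {𝓕 : Set (Dual ℝ V)} (h𝓕 : 𝓕.Finite)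
    (h0 : ∀ f ∈ 𝓕, f ≠ 0) {U : Set V} (hU : IsOpen U) (hUc : Convex ℝ U) {Φ Φ' : V → A}
    (hΦ : ∀ y ∈ U, codimAt 𝓕 y ≤ 1 → IsSolAt Ψ Φ y)
    (hΦ' : ∀ y ∈ U, codimAt 𝓕 y ≤ 1 → IsSolAt Ψ Φ' y) :
    ∃ c, ∀ y ∈ U, ∀ᶠ z in genNhds y, Φ z = Φ' z + c := by
  obtain ⟨c, hc⟩ := exists_const_of_isPreconnected (isPreconnected_codimAt_le_one h𝓕 hU hUc)
    (fun y c => ∀ᶠ z in genNhds y, Φ z = Φ' z + c) (by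
      rintro y ⟨hy, hy1⟩
      obtain ⟨a, ha⟩ := hΦ y hy hy1
      obtain ⟨b, hb⟩ := hΦ' y hy hy1
      refine ⟨a - b, ?_⟩
      filter_upwards [ha, hb] with z h1 h2
      rw [h1, h2]; abel)
    (fun y _ d hd => (eventually_eventually_genNhds hd).filter_mono nhdsWithin_le_nhds)
    (fun y _ d e hd he => by
      obtain ⟨z, h1, h2⟩ := (hd.and he).exists
      exact add_left_cancel (h1.symm.trans h2))
  refine ⟨c, fun y hy => eventually_genNhds_of_dense (dense_codimAt_le h𝓕 h0 1) ?_⟩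
  filter_upwards [hU.mem_nhds hy] with z hz hz1 using hc z ⟨hz, hz1⟩

/-- A solution at the points of codimension one is a solution wherever a model is given. -/
lemma isSolAt_of_codimAt_le_one {Ψ : V → V → A} {Q : Set V}
    (hcons : ∀ y ∈ Q, ∀ᶠ y' in 𝓝 y, y' ∈ Q → IsSolAt Ψ (Ψ y) y') {𝓕 : Set (Dual ℝ V)}
    (h𝓕 : 𝓕.Finite) (h0 : ∀ f ∈ 𝓕, f ≠ 0) {U : Set V} (hQ : ∀ x ∈ U, codimAt 𝓕 x ≤ 1 → x ∈ Q)
    (hU : IsOpen U) {Φ : V → A}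
    (hΦ : ∀ y ∈ U, codimAt 𝓕 y ≤ 1 → IsSolAt Ψ Φ y) {y : V} (hy : y ∈ U) (hyQ : y ∈ Q) :
    IsSolAt Ψ Φ y := by
  obtain ⟨ε, hε, hball⟩ := Metric.eventually_nhds_iff_ball.mp
    ((hU.eventually_mem hy).and (hcons y hyQ))
  obtain ⟨c, hc⟩ := exists_const_of_isSolAt (Ψ := Ψ) (Φ := Φ) (Φ' := Ψ y) h𝓕 h0
    Metric.isOpen_ball (convex_ball y ε) (fun z hz => hΦ z (hball z hz).1)
    -- Near `y` the model `Ψ y` is itself a solution, so uniqueness compares `Φ` with it.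
    (fun z hz h1 => (hball z hz).2 (hQ z (hball z hz).1 h1))
  exact ⟨c, hc y (Metric.mem_ball_self hε)⟩

open Classical in
/-- The function `d` on the half space `f > 0`. -/
def halfIndicator (f : Dual ℝ V) (d : A) (z : V) : A := if 0 < f z then d else 0

/-- Solutions on the two sides of a hyperplane are made to fit along a connected part of it, by a
constant. -/
lemma exists_glue {Ψ : V → V → A} {Q : Set V} {𝓕 : Set (Dual ℝ V)} (h𝓕 : 𝓕.Finite)
    (h0 : ∀ f ∈ 𝓕, f ≠ 0) {U : Set V} (hQ : ∀ x ∈ U, codimAt 𝓕 x ≤ 1 → x ∈ Q) (hU : IsOpen U) {f : Dual ℝ V} (hf0 : f ≠ 0)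
    {Φ : V → A} (hΦ : ∀ y ∈ U, codimAt 𝓕 y ≤ 1 → f y ≠ 0 → IsSolAt Ψ Φ y)
    {K : Set V} (hK : IsPreconnected K) (hKU : ∀ x ∈ K, x ∈ U ∧ f x = 0)
    (hloc : ∀ x ∈ K, LocSolvable Ψ Q x) :
    ∃ d, ∀ x ∈ K, ∀ᶠ y in 𝓝 x, codimAt 𝓕 y ≤ 1 → IsSolAt Ψ (Φ + halfIndicator f d) y := by
  have hneg : IsOpen {x | f x < 0} := by simpa using isOpen_pos (-f)
  have hnegc : Convex ℝ {x | f x < 0} := by simpa using convex_pos (-f)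
  refine exists_const_of_isPreconnected hK
    (fun x d => ∀ᶠ y in 𝓝 x, codimAt 𝓕 y ≤ 1 → IsSolAt Ψ (Φ + halfIndicator f d) y) ?_ ?_ ?_
  · intro x hx
    obtain ⟨Φx, hΦx⟩ := hloc x hx
    obtain ⟨ε, hε, hball⟩ := Metric.eventually_nhds_iff_ball.mp
      ((hU.eventually_mem (hKU x hx).1).and hΦx)
    have hsol : ∀ y ∈ Metric.ball x ε, codimAt 𝓕 y ≤ 1 → IsSolAt Ψ Φx y := fun y hy h1 =>
      (hball y hy).2 (hQ y (hball y hy).1 h1)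
    obtain ⟨c₁, hc₁⟩ := exists_const_of_isSolAt (Ψ := Ψ) (Φ := Φ) (Φ' := Φx) h𝓕 h0
      (Metric.isOpen_ball.inter (isOpen_pos f)) ((convex_ball x ε).inter (convex_pos f))
      (fun y hy h1 => hΦ y (hball y hy.1).1 h1 (ne_of_gt hy.2)) (fun y hy h1 => hsol y hy.1 h1)
    obtain ⟨c₂, hc₂⟩ := exists_const_of_isSolAt (Ψ := Ψ) (Φ := Φ) (Φ' := Φx) h𝓕 h0
      (Metric.isOpen_ball.inter hneg) ((convex_ball x ε).inter hnegc)
      (fun y hy h1 => hΦ y (hball y hy.1).1 h1 (ne_of_lt hy.2)) (fun y hy h1 => hsol y hy.1 h1)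
    -- `Φ` is `Φx + c₁` where `f > 0` and `Φx + c₂` where `f < 0`; raising the positive side by `c₂
    -- - c₁` makes it `Φx + c₂` on both.
    refine ⟨c₂ - c₁, ?_⟩
    filter_upwards [Metric.ball_mem_nhds x hε] with y hy hy1
    refine (hsol y hy hy1).congr (c := c₂) ?_
    refine eventually_genNhds_of_dense (dense_ne_zero hf0) ?_
    filter_upwards [Metric.isOpen_ball.mem_nhds hy] with w hw hwf
    rcases lt_or_gt_of_ne (show f w ≠ 0 from hwf) with h | h
    · filter_upwards [hc₂ w ⟨hw, h⟩, eventually_genNhds_of_nhds (hneg.mem_nhds h)] with z hz hzf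
      replace hzf : f z < 0 := hzf
      simp [halfIndicator, hzf.not_gt, hz]
    · filter_upwards [hc₁ w ⟨hw, h⟩,
        eventually_genNhds_of_nhds ((isOpen_pos f).mem_nhds h)] with z hz hzf
      replace hzf : 0 < f z := hzf
      simp only [Pi.add_apply, halfIndicator, hzf, if_true, hz]
      abel
  · intro x _ d hd
    exact (eventually_eventually_nhds.mpr hd).filter_mono nhdsWithin_le_nhds
  -- Two admissible corrections differ by a constant near `x`. The negative side, where neither
  -- acts, shows that this constant is zero; the positive side then gives `d = e`.
  · intro x hx d e hd he
    obtain ⟨ε, hε, hball⟩ := Metric.eventually_nhds_iff_ball.mp (hd.and he)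
    obtain ⟨c, hc⟩ := exists_const_of_isSolAt (Ψ := Ψ) h𝓕 h0
      Metric.isOpen_ball (convex_ball x ε) (fun y hy => (hball y hy).1)
      (fun y hy => (hball y hy).2)
    have hcx := hc x (Metric.mem_ball_self hε)
    obtain ⟨z, hz, hzc⟩ := ((frequently_genNhds_of_mem_closure (isOpen_pos f)
      (mem_closure_pos hf0 (hKU x hx).2)).and_eventually hcx).exists
    obtain ⟨w, hw, hwc⟩ := ((frequently_genNhds_of_mem_closure hneg
      (mem_closure_neg hf0 (hKU x hx).2)).and_eventually hcx).exists
    replace hz : 0 < f z := hz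
    replace hw : f w < 0 := hw
    simp only [Pi.add_apply, halfIndicator, hz, if_true] at hzc
    simp only [Pi.add_apply, halfIndicator, hw.not_gt, if_false, add_zero, left_eq_add] at hwc
    rw [hwc, add_zero] at hzc
    exact add_left_cancel hzc

lemma halfIndicator_congr_of_ne {Ψ : V → V → A} {Φ : V → A} {f : Dual ℝ V} {d : A} {y : V}
    (hy : f y ≠ 0) (h : IsSolAt Ψ Φ y) : IsSolAt Ψ (Φ + halfIndicator f d) y := by
  rcases lt_or_gt_of_ne hy with h1 | h1
  · refine h.congr_nhds (c := 0) ?_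
    have : {x | 0 < (-f) x} ∈ 𝓝 y := (isOpen_pos (-f)).mem_nhds (by simpa using h1)
    filter_upwards [this] with z hz
    have hz' : f z < 0 := by simpa using hz
    simp [halfIndicator, hz'.not_gt]
  · refine h.congr_nhds (c := d) ?_
    filter_upwards [(isOpen_pos f).mem_nhds h1] with z hz
    have hz' : 0 < f z := hz
    simp [halfIndicator, hz']

/-- On one side of the hyperplane `f = 0` the form `f` never vanishes and does not contribute to the
codimension; this drives the induction on the arrangement. -/
lemma Adapted.erase {Ψ : V → V → A} {Q : Set V} {f : Dual ℝ V} {𝓕 : Set (Dual ℝ V)} {U W : Set V}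
    (hA : Adapted Ψ Q (insert f 𝓕) U) (hW : W ⊆ U) (hf : ∀ x ∈ W, f x ≠ 0) :
    Adapted Ψ Q 𝓕 W := by
  have h1 : ∀ x ∈ W, codimAt (insert f 𝓕) x ≤ codimAt 𝓕 x := fun x hx =>
    codimAt_mono fun g hg hgx => by
      rcases hg with rfl | hg
      exacts [absurd hgx (hf x hx), ⟨hg, hgx⟩]
  refine ⟨hA.finite.subset (Set.subset_insert _ _),
    fun g hg => hA.ne_zero g (Set.mem_insert_of_mem _ hg),
    fun x hx h => hA.mem x (hW hx) ((h1 x hx).trans h),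
    fun x hx h => hA.locSolvable x (hW hx) ((h1 x hx).trans h), fun x hx h => ?_⟩
  refine hA.sol_zero x (hW hx) fun g hg => ?_
  rcases hg with rfl | hg
  exacts [hf x hx, h g hg]

open Classical in
/-- Solutions on the two sides of a hyperplane, put together. -/
lemma exists_isSolAt_off_hyperplane {Ψ : V → V → A} (f : Dual ℝ V) {U : Set V} {P : V → Prop}
    (h₁ : ∃ Φ : V → A, ∀ y ∈ U ∩ {x | 0 < f x}, P y → IsSolAt Ψ Φ y)
    (h₂ : ∃ Φ : V → A, ∀ y ∈ U ∩ {x | 0 < (-f) x}, P y → IsSolAt Ψ Φ y) :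
    ∃ Φ : V → A, ∀ y ∈ U, P y → f y ≠ 0 → IsSolAt Ψ Φ y := by
  obtain ⟨Φ₁, h₁⟩ := h₁
  obtain ⟨Φ₂, h₂⟩ := h₂
  refine ⟨fun z => if 0 < f z then Φ₁ z else Φ₂ z, fun y hy hyP hyf => ?_⟩
  rcases lt_or_gt_of_ne hyf with h | h
  · have hy' : y ∈ {x | 0 < (-f) x} := by simpa using h
    refine (h₂ y ⟨hy, hy'⟩ hyP).congr_nhds (c := 0) ?_
    filter_upwards [(isOpen_pos (-f)).mem_nhds hy'] with z hz
    have hz' : f z < 0 := by simpa using hz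
    simp [hz'.not_gt]
  · refine (h₁ y ⟨hy, h⟩ hyP).congr_nhds (c := 0) ?_
    filter_upwards [(isOpen_pos f).mem_nhds h] with z hz
    have hz' : 0 < f z := hz
    simp [hz']

/-- Local solvability up to codimension two implies solvability on a convex open set with a finite
arrangement. -/
theorem Adapted.exists_isSolAt {Ψ : V → V → A} {Q : Set V}
    (hcons : ∀ y ∈ Q, ∀ᶠ y' in 𝓝 y, y' ∈ Q → IsSolAt Ψ (Ψ y) y') {𝓕 : Set (Dual ℝ V)} {U : Set V}
    (hA : Adapted Ψ Q 𝓕 U) (hU : IsOpen U) (hUc : Convex ℝ U) :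
    ∃ Φ : V → A, ∀ y ∈ U, y ∈ Q → IsSolAt Ψ Φ y := by
  have h𝓕 := hA.finite
  induction 𝓕, h𝓕 using Set.Finite.induction_on generalizing U with
  | empty => exact ⟨0, fun y hy _ => hA.sol_zero y hy (by simp)⟩
  | @insert f 𝓕 hf h𝓕 ih =>
    have hf0 : f ≠ 0 := hA.ne_zero f (Set.mem_insert _ _)
    obtain ⟨Φ, hΦ⟩ := exists_isSolAt_off_hyperplane (Ψ := Ψ) (U := U) (P := (· ∈ Q)) f
      (ih (hA.erase Set.inter_subset_left fun x hx => ne_of_gt hx.2) (hU.inter (isOpen_pos f))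
        (hUc.inter (convex_pos f)))
      (ih (hA.erase Set.inter_subset_left fun x hx => by
          have : 0 < (-f) x := hx.2
          exact fun h => by simp [h] at this) (hU.inter (isOpen_pos (-f)))
        (hUc.inter (convex_pos (-f))))
    -- One constant suffices, because the part of `f = 0` of codimension at most two is connected.
    -- Local solvability at codimension two is used here.
    obtain ⟨d, hd⟩ := exists_glue hA.finite hA.ne_zero hA.mem hU hf0
      (fun y hy h1 hyf => hΦ y hy (hA.mem y hy h1) hyf)
      (exists_isPreconnected_hyperplane hA.finite hf0 (Set.mem_insert _ _) hU hUc)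
      (fun x hx => ⟨hx.1, hx.2.1⟩) (fun x hx => hA.locSolvable x hx.1 hx.2.2)
    refine ⟨Φ + halfIndicator f d,
      fun y hy hyQ => isSolAt_of_codimAt_le_one hcons hA.finite hA.ne_zero hA.mem hU
        (fun y hy h1 => ?_) hy hyQ⟩
    by_cases hyf : f y = 0
    · exact (hd y ⟨hy, hyf, h1.trans (by norm_num)⟩).self_of_nhds h1
    · exact halfIndicator_congr_of_ne hyf (hΦ y hy (hA.mem y hy h1) hyf)

end Solutions

/-! ### Generic values and pull-backs of solutions -/

section LocalSolutions

variable {V : Type*} [TopologicalSpace V] {A : Type*} [AddCommGroup A]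

open Classical in
/-- The generic value of a function near a point. -/
def genValue (Φ : V → A) (z : V) : A := if h : ∃ c, ∀ᶠ w in genNhds z, Φ w = c then h.choose else 0

lemma genValue_eq {Φ : V → A} {z : V} {c : A} (h : ∀ᶠ w in genNhds z, Φ w = c) :
    genValue Φ z = c := by
  have h' : ∃ c, ∀ᶠ w in genNhds z, Φ w = c := ⟨c, h⟩
  rw [genValue, dif_pos h']
  obtain ⟨w, h1, h2⟩ := (h'.choose_spec.and h).exists
  exact h1.symm.trans h2

lemma genValue_congr {Φ Φ' : V → A} {z : V} (h : ∀ᶠ w in genNhds z, Φ w = Φ' w) :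
    genValue Φ z = genValue Φ' z := by
  by_cases h' : ∃ c, ∀ᶠ w in genNhds z, Φ' w = c
  · obtain ⟨c, hc⟩ := h'
    rw [genValue_eq hc, genValue_eq ((h.and hc).mono fun w hw => hw.1.trans hw.2)]
  · have h'' : ¬ ∃ c, ∀ᶠ w in genNhds z, Φ w = c := fun ⟨c, hc⟩ =>
      h' ⟨c, (h.and hc).mono fun w hw => hw.1.symm.trans hw.2⟩
    rw [genValue, genValue, dif_neg h', dif_neg h'']

/-- Solutions are pulled back under open maps that respect the models. -/
lemma IsSolAt.comp {V' : Type*} [TopologicalSpace V'] {A' : Type*} [AddCommGroup A']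
    {Ψ : V → V → A} {Ψ' : V' → V' → A'} {Φ : V → A} {h : V' → V} (hc : Continuous h)
    (ho : IsOpenMap h) (α : A →+ A') {y : V'}
    (hΨ : ∀ᶠ z in 𝓝 y, Ψ' y z = α (Ψ (h y) (h z))) (hsol : IsSolAt Ψ Φ (h y)) :
    IsSolAt Ψ' (fun z => α (Φ (h z))) y := by
  obtain ⟨c, hc'⟩ := hsol
  refine ⟨α c, ?_⟩
  filter_upwards [(tendsto_genNhds hc ho y).eventually hc', eventually_genNhds_of_nhds hΨ]
    with z h1 h2
  rw [h1, map_add, h2]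

end LocalSolutions

/-! ### From finite to locally finite arrangements -/

section GlobalSolutions

open Module

variable {V : Type*} [NormedAddCommGroup V] [NormedSpace ℝ V] [FiniteDimensional ℝ V]
  {A : Type*} [AddCommGroup A]

lemma exists_adapted_of_isCompact {Ψ : V → V → A} {Q K : Set V} (hK : IsCompact K)
    (h : ∀ x ∈ K, ∃ W ∈ 𝓝 x, ∃ 𝓕, Adapted Ψ Q 𝓕 W) : ∃ 𝓕, Adapted Ψ Q 𝓕 K := by
  refine hK.induction_on (p := fun S => ∃ 𝓕, Adapted Ψ Q 𝓕 S) ?_ ?_ ?_ ?_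
  · exact ⟨∅, Set.finite_empty, by simp, by simp, by simp, by simp⟩
  · rintro S T hST ⟨𝓕, h𝓕⟩
    exact ⟨𝓕, h𝓕.mono hST⟩
  · rintro S T ⟨𝓕, h𝓕⟩ ⟨𝓖, h𝓖⟩
    exact ⟨_, h𝓕.union h𝓖⟩
  · intro x hx
    obtain ⟨W, hW, 𝓕, h𝓕⟩ := h x hx
    exact ⟨W, mem_nhdsWithin_of_mem_nhds hW, 𝓕, h𝓕⟩

/-- An open convex set is exhausted by open convex sets that are relatively compact in it. -/
lemma exists_convex_exhaustion {C : Set V} (hC : IsOpen C) (hCc : Convex ℝ C) {p : V}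
    (hp : p ∈ C) : ∃ U K : ℕ → Set V, Monotone U ∧ (∀ k, IsOpen (U k)) ∧ (∀ k, Convex ℝ (U k)) ∧
      (∀ k, U k ⊆ K k) ∧ (∀ k, K k ⊆ C) ∧ (∀ k, IsCompact (K k)) ∧ (∀ k, p ∈ U k) ∧
      ∀ y ∈ C, ∃ k, y ∈ U k := by
  -- Hulls of finite sets are compact, and a finite union of finite sets again has a compact hull
  -- inside `C`.
  have hex : ∀ y ∈ C, ∃ u : Set V, u.Finite ∧ u ⊆ C ∧ y ∈ interior (convexHull ℝ u) := by
    intro y hy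
    obtain ⟨u, hu, huC⟩ := (convex_singleton (𝕜 := ℝ) y).exists_subset_interior_convexHull_finset_of_isCompact
      isCompact_singleton (by rw [nhdsSet_singleton]; exact hC.mem_nhds hy)
    exact ⟨u, u.finite_toSet, (subset_convexHull ℝ _).trans huC, hu rfl⟩
  choose! u huf huC hu using hex
  obtain ⟨t, htC, htc, hcov⟩ := TopologicalSpace.countable_cover_nhdsWithin
    (f := fun y => interior (convexHull ℝ (u y))) (s := C)
    fun y hy => mem_nhdsWithin_of_mem_nhds (isOpen_interior.mem_nhds (hu y hy))
  obtain ⟨e, he⟩ := (htc.insert p).exists_eq_range (Set.insert_nonempty p t)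
  have heC : ∀ i, e i ∈ C := fun i => by
    have : e i ∈ insert p t := he ▸ Set.mem_range_self i
    rcases this with h | h
    exacts [h ▸ hp, htC h]
  obtain ⟨i₀, hi₀⟩ : p ∈ Set.range e := he ▸ Set.mem_insert p t
  -- The shift by `i₀`, the index of `p`, puts `p` into `U 0` already.
  set S : ℕ → Set V := fun k => ⋃ i ∈ Set.Iic (k + i₀), u (e i) with hS
  have hSi : ∀ i k, i ≤ k + i₀ → u (e i) ⊆ S k := fun i k hik =>
    Set.subset_biUnion_of_mem (u := fun i => u (e i)) (Set.mem_Iic.mpr hik)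
  refine ⟨fun k => interior (convexHull ℝ (S k)), fun k => convexHull ℝ (S k), fun k l hkl => ?_,
    fun k => isOpen_interior, fun k => (convex_convexHull ℝ _).interior, fun k => interior_subset,
    fun k => convexHull_min (Set.iUnion₂_subset fun i _ => huC _ (heC i)) hCc,
    fun k => ((Set.finite_Iic _).biUnion fun i _ => huf _ (heC i)).isCompact_convexHull ℝ,
    fun k => ?_, fun y hy => ?_⟩
  · exact interior_mono (convexHull_mono (Set.iUnion₂_subset fun i hi => hSi i l (by
      have := Set.mem_Iic.mp hi; omega)))
  · have h := hu p hp
    rw [← hi₀] at h ⊢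
    exact interior_mono (convexHull_mono (hSi i₀ k (by omega))) h
  · obtain ⟨x, hxt, hx⟩ := Set.mem_iUnion₂.mp (hcov hy)
    obtain ⟨i, rfl⟩ : x ∈ Set.range e := he ▸ Set.mem_insert_of_mem p hxt
    exact ⟨i, interior_mono (convexHull_mono (hSi i i (by omega))) hx⟩

/-- A locally solvable problem on a convex open set with a locally finite arrangement has
a solution. -/
theorem exists_isSolAt_of_locally_adapted {Ψ : V → V → A} {Q : Set V}
    (hcons : ∀ y ∈ Q, ∀ᶠ y' in 𝓝 y, y' ∈ Q → IsSolAt Ψ (Ψ y) y') {C : Set V} (hC : IsOpen C)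
    (hCc : Convex ℝ C) (hloc : ∀ x ∈ C, ∃ W ∈ 𝓝 x, ∃ 𝓕, Adapted Ψ Q 𝓕 W) :
    ∃ Φ : V → A, ∀ y ∈ C, y ∈ Q → IsSolAt Ψ Φ y := by
  classical
  rcases C.eq_empty_or_nonempty with rfl | ⟨p, hp⟩
  · exact ⟨0, by simp⟩
  obtain ⟨U, K, hmono, hUo, hUc, hUK, hKC, hK, hpU, hcov⟩ := exists_convex_exhaustion hC hCc hp
  have hA : ∀ k, ∃ 𝓕, Adapted Ψ Q 𝓕 (U k) := fun k => by
    obtain ⟨𝓕, h⟩ := exists_adapted_of_isCompact (hK k) fun x hx => hloc x (hKC k hx)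
    exact ⟨𝓕, h.mono (hUK k)⟩
  choose 𝓕 h𝓕 using hA
  choose Φ₀ hΦ₀ using fun k => (h𝓕 k).exists_isSolAt hcons (hUo k) (hUc k)
  have hunique : ∀ k (Φ Φ' : V → A), (∀ y ∈ U k, y ∈ Q → IsSolAt Ψ Φ y) →
      (∀ y ∈ U k, y ∈ Q → IsSolAt Ψ Φ' y) →
      ∃ c, ∀ y ∈ U k, ∀ᶠ z in genNhds y, Φ z = Φ' z + c := fun k Φ Φ' h h' =>
    exists_const_of_isSolAt (h𝓕 k).finite (h𝓕 k).ne_zero (hUo k) (hUc k)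
      (fun y hy h1 => h y hy ((h𝓕 k).mem y hy h1)) (fun y hy h1 => h' y hy ((h𝓕 k).mem y hy h1))
  -- Normalization: after adding `c k`, all solutions agree generically on `U 0`. Hence any two of
  -- them agree on the smaller of their domains, as can be tested near `p`.
  choose c hc using fun k => hunique 0 (Φ₀ 0) (Φ₀ k) (hΦ₀ 0)
    (fun y hy => hΦ₀ k y (hmono (Nat.zero_le k) hy))
  set Φ : ℕ → V → A := fun k z => Φ₀ k z + c k with hΦdef
  have hΦ : ∀ k, ∀ y ∈ U k, y ∈ Q → IsSolAt Ψ (Φ k) y := fun k y hy hyQ =>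
    (hΦ₀ k y hy hyQ).congr (c := c k) (Eventually.of_forall fun _ => rfl)
  have hagree : ∀ k l, k ≤ l → ∀ y ∈ U k, ∀ᶠ z in genNhds y, Φ k z = Φ l z := by
    intro k l hkl y hy
    obtain ⟨e, he⟩ := hunique k (Φ k) (Φ l) (hΦ k) (fun y hy => hΦ l y (hmono hkl hy))
    obtain ⟨z, ⟨hz1, hz2⟩, hz3⟩ :=
      (((he p (hpU k)).and (hc k p (hpU 0))).and (hc l p (hpU 0))).exists
    have he0 : e = 0 := by
      have : Φ k z = Φ l z := hz2.symm.trans hz3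
      rw [this] at hz1
      exact left_eq_add.mp hz1
    filter_upwards [he y hy] with w hw
    rw [hw, he0, add_zero]
  -- The normalized solutions agree only generically, and the least admissible index varies with
  -- `z`; taking generic values makes the choice of index harmless.
  set Φ' : V → A := fun z => if h : ∃ k, z ∈ U k then genValue (Φ (Nat.find h)) z else 0 with hΦ'
  have hΦ'U : ∀ k, ∀ z ∈ U k, Φ' z = genValue (Φ k) z := by
    intro k z hz
    have h : ∃ k, z ∈ U k := ⟨k, hz⟩
    simp only [hΦ', dif_pos h]
    exact genValue_congr (hagree _ _ (Nat.find_min' h hz) z (Nat.find_spec h))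
  refine ⟨Φ', fun y hy hyQ => ?_⟩
  obtain ⟨k, hk⟩ := hcov y hy
  refine (hΦ k y hk hyQ).congr (c := 0) ?_
  refine eventually_genNhds_of_dense (dense_forall_ne_zero (h𝓕 k).finite (h𝓕 k).ne_zero).2 ?_
  filter_upwards [(hUo k).mem_nhds hk] with w hw hw0
  have hw1 : codimAt (𝓕 k) w ≤ 1 := by rw [codimAt_eq_zero hw0]; exact Nat.zero_le _
  obtain ⟨e, he⟩ := (hΦ k w hw ((h𝓕 k).mem w hw hw1)).const_of_zero
    ((h𝓕 k).sol_zero w hw hw0)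
  filter_upwards [he, eventually_genNhds_of_nhds (eventually_eventually_genNhds he),
    eventually_genNhds_of_nhds ((hUo k).mem_nhds hw)] with z h1 h2 h3
  rw [hΦ'U k z h3, genValue_eq h2, h1, add_zero]

/-- Solutions on a convex open set with a locally finite arrangement are unique up to constants. -/
theorem exists_const_of_locally_adapted {Ψ : V → V → A} {Q : Set V} {C : Set V} (hC : IsOpen C)
    (hCc : Convex ℝ C) (hloc : ∀ x ∈ C, ∃ W ∈ 𝓝 x, ∃ 𝓕, Adapted Ψ Q 𝓕 W) {Φ Φ' : V → A}
    (hΦ : ∀ y ∈ C, y ∈ Q → IsSolAt Ψ Φ y) (hΦ' : ∀ y ∈ C, y ∈ Q → IsSolAt Ψ Φ' y) :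
    ∃ c, ∀ y ∈ C, ∀ᶠ z in genNhds y, Φ z = Φ' z + c := by
  refine exists_const_of_isPreconnected hCc.isPreconnected
    (fun y c => ∀ᶠ z in genNhds y, Φ z = Φ' z + c) (fun y hy => ?_)
    (fun y _ d hd => (eventually_eventually_genNhds hd).filter_mono nhdsWithin_le_nhds)
    (fun y _ d e hd he => by
      obtain ⟨z, h1, h2⟩ := (hd.and he).exists
      exact add_left_cancel (h1.symm.trans h2))
  obtain ⟨W, hW, 𝓕, h𝓕⟩ := hloc y hy
  obtain ⟨ε, hε, hball⟩ := Metric.mem_nhds_iff.mp (inter_mem hW (hC.mem_nhds hy))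
  obtain ⟨c, hc⟩ := exists_const_of_isSolAt (Ψ := Ψ) h𝓕.finite h𝓕.ne_zero Metric.isOpen_ball
    (convex_ball y ε) (fun z hz h1 => hΦ z (hball hz).2 (h𝓕.mem z (hball hz).1 h1))
    (fun z hz h1 => hΦ' z (hball hz).2 (h𝓕.mem z (hball hz).1 h1))
  exact ⟨c, hc y (Metric.mem_ball_self hε)⟩

end GlobalSolutions

/-! ### The cone over hyperbolic space -/

section Cone

open Module

variable {n : ℕ}

/-- Minkowski space. -/
abbrev Vec (n : ℕ) : Type := Fin (n + 1) → ℝ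

lemma mink_eq_sum (x y : Vec n) :
    mink x y = -(x 0 * y 0) + ∑ i : Fin n, x i.succ * y i.succ := by
  unfold mink J
  simp only [dotProduct, Matrix.mulVec_diagonal, Fin.sum_univ_succ]
  simp [Fin.succ_ne_zero]

/-- The Lorentzian form as a bilinear map. -/
def minkForm (n : ℕ) : Vec n →ₗ[ℝ] Dual ℝ (Vec n) :=
  LinearMap.mk₂ ℝ mink (fun x y z => by simp [mink]) (fun c x y => by simp [mink])
    (fun x y z => by simp [mink, Matrix.mulVec_add]) (fun c x y => by simp [mink, Matrix.mulVec_smul])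

@[simp] lemma minkForm_apply (x y : Vec n) : minkForm n x y = mink x y := rfl

lemma mink_comm (x y : Vec n) : mink x y = mink y x := by
  simp only [mink_eq_sum, mul_comm]

lemma mink_add_left (x y z : Vec n) : mink (x + y) z = mink x z + mink y z := by
  simp [← minkForm_apply]

lemma mink_smul_left (c : ℝ) (x y : Vec n) : mink (c • x) y = c * mink x y := by
  simp [← minkForm_apply]

lemma mink_neg_left (x y : Vec n) : mink (-x) y = -mink x y := by
  simp [← minkForm_apply]

lemma mink_add_right (x y z : Vec n) : mink x (y + z) = mink x y + mink x z := by
  simp [← minkForm_apply]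

lemma mink_smul_right (c : ℝ) (x y : Vec n) : mink x (c • y) = c * mink x y := by
  simp [← minkForm_apply]

lemma minkForm_injective (n : ℕ) : Function.Injective (minkForm n) := by
  rw [injective_iff_map_eq_zero]
  intro x hx
  have h : ∀ y, x ⬝ᵥ y = 0 := by
    intro y
    have h1 := LinearMap.congr_fun hx ((J n).mulVec y)
    rw [minkForm_apply, mink, Matrix.mulVec_mulVec, J_mul_J, Matrix.one_mulVec] at h1
    exact h1
  exact dotProduct_eq_zero x h

lemma minkForm_ne_zero {v : Vec n} (hv : v ≠ 0) : minkForm n v ≠ 0 := fun h =>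
  hv (minkForm_injective n (h.trans (map_zero _).symm))

lemma continuous_mink : Continuous fun p : Vec n × Vec n => mink p.1 p.2 := by
  simp only [mink_eq_sum]
  fun_prop

lemma continuous_mink_right (v : Vec n) : Continuous fun x : Vec n => mink v x :=
  continuous_mink.comp (continuous_const.prodMk continuous_id)

/-- The open future cone of Minkowski space. -/
def cone (n : ℕ) : Set (Vec n) := {z | mink z z < 0 ∧ 0 < z 0}

lemma isOpen_cone (n : ℕ) : IsOpen (cone n) :=
  (isOpen_lt (continuous_mink.comp (continuous_id.prodMk continuous_id)) continuous_const).inter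
    (isOpen_lt continuous_const (continuous_apply 0))

/-- Reversed Cauchy–Schwarz: the spatial inner product is smaller in absolute value than the product
of the times. Convexity of the cone follows. -/
lemma mink_neg_of_mem_cone {x y : Vec n} (hx : x ∈ cone n) (hy : y ∈ cone n) : mink x y < 0 := by
  obtain ⟨hx, hx0⟩ := hx
  obtain ⟨hy, hy0⟩ := hy
  rw [mink_eq_sum] at hx hy ⊢
  have hcs := Finset.sum_mul_sq_le_sq_mul_sq Finset.univ (fun i : Fin n => x i.succ)
    (fun i => y i.succ)
  have hx' : ∑ i : Fin n, x i.succ ^ 2 < x 0 ^ 2 := by simp only [pow_two]; linarith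
  have hy' : ∑ i : Fin n, y i.succ ^ 2 < y 0 ^ 2 := by simp only [pow_two]; linarith
  have hlt : (∑ i : Fin n, x i.succ * y i.succ) ^ 2 < (x 0 * y 0) ^ 2 := by
    rw [mul_pow]
    exact hcs.trans_lt (mul_lt_mul'' hx' hy' (Finset.sum_nonneg fun i _ => sq_nonneg _)
      (Finset.sum_nonneg fun i _ => sq_nonneg _))
  have := lt_of_pow_lt_pow_left₀ 2 (by positivity) hlt
  linarith

lemma smul_mem_cone {c : ℝ} (hc : 0 < c) {z : Vec n} (hz : z ∈ cone n) : c • z ∈ cone n := by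
  refine ⟨?_, by simpa [hc] using hz.2⟩
  rw [mink_smul_left, mink_smul_right, ← mul_assoc]
  exact mul_neg_of_pos_of_neg (by positivity) hz.1

lemma convex_cone (n : ℕ) : Convex ℝ (cone n) := by
  refine convex_iff_forall_pos.mpr fun x hx y hy a b ha hb _ => ?_
  have hx' := smul_mem_cone ha hx
  have hy' := smul_mem_cone hb hy
  refine ⟨?_, add_pos hx'.2 hy'.2⟩
  rw [mink_add_left, mink_add_right, mink_add_right]
  have := mink_neg_of_mem_cone hx' hy'
  have := mink_neg_of_mem_cone hy' hx'
  linarith [hx'.1, hy'.1]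

lemma hyp_mem_cone (x : Hyp n) : x.val ∈ cone n := ⟨by rw [x.2.1]; norm_num, x.2.2⟩

/-- The origin of hyperbolic space. -/
def origin (n : ℕ) : Hyp n := ⟨Pi.single 0 1, by
  constructor
  · rw [mink_eq_sum]; simp [Fin.succ_ne_zero]
  · simp⟩

lemma inv_sqrt_pos {z : Vec n} (hz : z ∈ cone n) : 0 < (√(-mink z z))⁻¹ :=
  inv_pos.mpr (Real.sqrt_pos.mpr (by linarith [hz.1]))

lemma normalize_mem {z : Vec n} (hz : z ∈ cone n) :
    (√(-mink z z))⁻¹ • z ∈ hyperboloid n := by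
  refine ⟨?_, (smul_mem_cone (inv_sqrt_pos hz) hz).2⟩
  have h : (√(-mink z z)) ^ 2 = -mink z z := Real.sq_sqrt (by linarith [hz.1])
  have h' : mink z z ≠ 0 := hz.1.ne
  rw [mink_smul_left, mink_smul_right, ← mul_assoc, ← pow_two, inv_pow, h, inv_neg, neg_mul,
    inv_mul_cancel₀ h']

open Classical in
/-- The radial projection of the cone to hyperbolic space. -/
def toHyp (z : Vec n) : Hyp n :=
  if hz : z ∈ cone n then ⟨(√(-mink z z))⁻¹ • z, normalize_mem hz⟩ else origin n

lemma toHyp_val {z : Vec n} (hz : z ∈ cone n) : (toHyp z).val = (√(-mink z z))⁻¹ • z := by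
  rw [toHyp, dif_pos hz]

lemma exists_toHyp_eq_smul {z : Vec n} (hz : z ∈ cone n) : ∃ r > (0 : ℝ), (toHyp z).val = r • z :=
  ⟨_, inv_sqrt_pos hz, toHyp_val hz⟩

lemma toHyp_coe (x : Hyp n) : toHyp x.val = x := by
  apply Subtype.ext
  rw [toHyp_val (hyp_mem_cone x), x.2.1]
  simp

lemma toHyp_smul {c : ℝ} (hc : 0 < c) {z : Vec n} (hz : z ∈ cone n) :
    toHyp (c • z) = toHyp z := by
  apply Subtype.ext
  rw [toHyp_val (smul_mem_cone hc hz), toHyp_val hz, smul_smul, mink_smul_left, mink_smul_right]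
  congr 1
  rw [show -(c * (c * mink z z)) = c ^ 2 * (-mink z z) by ring,
    Real.sqrt_mul (by positivity), Real.sqrt_sq hc.le, mul_inv]
  field_simp

lemma toHyp_eq_of_smul {z : Vec n} (hz : z ∈ cone n) {r : ℝ} (hr : 0 < r) {x : Hyp n}
    (h : x.val = r • z) : toHyp z = x := by
  rw [← toHyp_smul hr hz, ← h, toHyp_coe]

lemma continuousOn_toHyp : ContinuousOn (toHyp (n := n)) (cone n) := by
  rw [Topology.IsInducing.subtypeVal.continuousOn_iff]
  have : ContinuousOn (fun z : Vec n => (√(-mink z z))⁻¹ • z) (cone n) := by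
    have h : Continuous fun z : Vec n => √(-mink z z) := Real.continuous_sqrt.comp
      (continuous_mink.comp (continuous_id.prodMk continuous_id)).neg
    exact (h.continuousOn.inv₀ fun z hz =>
      (Real.sqrt_pos.mpr (by linarith [hz.1])).ne').smul continuousOn_id
  exact this.congr fun z hz => toHyp_val hz

lemma tendsto_toHyp {z : Vec n} (hz : z ∈ cone n) : Tendsto toHyp (𝓝 z) (𝓝 (toHyp z)) :=
  continuousOn_toHyp.continuousAt ((isOpen_cone n).mem_nhds hz)

lemma mink_toHyp_eq_zero {z : Vec n} (hz : z ∈ cone n) (v : Vec n) :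
    mink v (toHyp z).val = 0 ↔ mink v z = 0 := by
  obtain ⟨r, hr, h⟩ := exists_toHyp_eq_smul hz
  rw [h, mink_smul_right]
  simp [hr.ne']

lemma mink_toHyp_nonneg {z : Vec n} (hz : z ∈ cone n) (v : Vec n) :
    0 ≤ mink v (toHyp z).val ↔ 0 ≤ mink v z := by
  obtain ⟨r, hr, h⟩ := exists_toHyp_eq_smul hz
  rw [h, mink_smul_right, mul_nonneg_iff_of_pos_left hr]

lemma eventually_mem_cone {z : Vec n} (hz : z ∈ cone n) : ∀ᶠ w in 𝓝 z, w ∈ cone n :=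
  (isOpen_cone n).mem_nhds hz

/-! ### The action of the isometry group -/

lemma smul_val (g : OPlus n) (x : Hyp n) : (g • x).val = g.val.val.mulVec x.val := rfl

instance : ContinuousConstSMul (OPlus n) (Hyp n) where
  continuous_const_smul g := by
    refine Continuous.subtype_mk ?_ _
    exact (Continuous.matrix_mulVec continuous_const continuous_subtype_val)

lemma mink_mulVec_mulVec (g : OPlus n) (x y : Vec n) :
    mink (g.val.val.mulVec x) (g.val.val.mulVec y) = mink x y := mink_mulVec g.prop.1 x y

lemma val_mul (g h : OPlus n) : (g * h).val.val = g.val.val * h.val.val := rfl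

lemma val_inv_mul (g : OPlus n) : (g⁻¹).val.val * g.val.val = 1 := by
  rw [← val_mul, inv_mul_cancel]; rfl

lemma val_mul_inv (g : OPlus n) : g.val.val * (g⁻¹).val.val = 1 := by
  rw [← val_mul, mul_inv_cancel]; rfl

lemma mulVec_inv_mulVec (g : OPlus n) (x : Vec n) :
    (g⁻¹).val.val.mulVec (g.val.val.mulVec x) = x := by
  rw [Matrix.mulVec_mulVec, val_inv_mul, Matrix.one_mulVec]

lemma mulVec_mulVec_inv (g : OPlus n) (x : Vec n) :
    g.val.val.mulVec ((g⁻¹).val.val.mulVec x) = x := by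
  rw [Matrix.mulVec_mulVec, val_mul_inv, Matrix.one_mulVec]

/-- An isometry as a homeomorphism of Minkowski space. -/
def isometryHomeo (g : OPlus n) : Vec n ≃ₜ Vec n where
  toFun := g.val.val.mulVec
  invFun := (g⁻¹).val.val.mulVec
  left_inv := mulVec_inv_mulVec g
  right_inv := mulVec_mulVec_inv g
  continuous_toFun := Continuous.matrix_mulVec continuous_const continuous_id
  continuous_invFun := Continuous.matrix_mulVec continuous_const continuous_id

@[simp] lemma isometryHomeo_apply (g : OPlus n) (x : Vec n) :
    isometryHomeo g x = g.val.val.mulVec x := rfl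

lemma exists_hyp_smul {z : Vec n} (hz : z ∈ cone n) :
    ∃ r > (0 : ℝ), z = r • (toHyp z).val := by
  obtain ⟨r, hr, h⟩ := exists_toHyp_eq_smul hz
  exact ⟨r⁻¹, inv_pos.mpr hr, by rw [h, smul_smul, inv_mul_cancel₀ hr.ne', one_smul]⟩

lemma mulVec_mem_cone (g : OPlus n) {z : Vec n} (hz : z ∈ cone n) :
    g.val.val.mulVec z ∈ cone n := by
  obtain ⟨r, hr, h⟩ := exists_hyp_smul hz
  rw [h, Matrix.mulVec_smul]
  exact smul_mem_cone hr (hyp_mem_cone (g • toHyp z))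

lemma toHyp_mulVec (g : OPlus n) {z : Vec n} (hz : z ∈ cone n) :
    toHyp (g.val.val.mulVec z) = g • toHyp z := by
  obtain ⟨r, hr, h⟩ := exists_toHyp_eq_smul hz
  refine toHyp_eq_of_smul (mulVec_mem_cone g hz) hr ?_
  rw [smul_val, h, Matrix.mulVec_smul]

/-! ### Tangent hyperplanes -/

lemma IsTangentAt.mem {D : Set (Hyp n)} {x : Hyp n} {v : Vec n} (h : IsTangentAt D x v) :
    x ∈ D := h.2.2.self_of_nhds.mpr h.2.1

lemma mem_of_mem_regularPoints {D : Set (Hyp n)} {x : Hyp n} (h : x ∈ regularPoints D) :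
    x ∈ D := h.choose_spec.mem

lemma IsTangentAt.eventually {D : Set (Hyp n)} {x : Hyp n} {v : Vec n} (h : IsTangentAt D x v) :
    ∀ᶠ y in 𝓝 x, y ∈ D → IsTangentAt D y v := by
  filter_upwards [h.2.2, eventually_eventually_nhds.mpr h.2.2] with y h1 h2 hy
  exact ⟨h.1, h1.mp hy, h2⟩

/-- The conormal of the tangent hyperplane is unique up to a factor. -/
lemma IsTangentAt.exists_smul {D : Set (Hyp n)} {x : Hyp n} {v w : Vec n}
    (hv : IsTangentAt D x v) (hw : IsTangentAt D x w) : ∃ c : ℝ, w = c • v := by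
  have h1 : ∀ᶠ z in 𝓝 x.val, mink v z = 0 → mink w z = 0 := by
    have hx := hyp_mem_cone x
    have h2 := (tendsto_toHyp hx).eventually (by
      rw [toHyp_coe]; exact (hv.2.2.and hw.2.2))
    filter_upwards [h2, eventually_mem_cone hx] with z hz hzc
    rw [mink_toHyp_eq_zero hzc, mink_toHyp_eq_zero hzc] at hz
    exact fun h => hz.2.mp (hz.1.mpr h)
  -- Moving from `x` by a small nonzero multiple of `u` stays in the region where both hyperplanes
  -- describe `D`; linearity does the rest.
  have hker : ∀ u, mink v u = 0 → mink w u = 0 := by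
    intro u hu
    have hlim : Tendsto (fun s : ℝ => x.val + s • u) (𝓝[≠] 0) (𝓝 x.val) := by
      have : Continuous fun s : ℝ => x.val + s • u := by fun_prop
      have h := this.tendsto 0
      simp only [zero_smul, add_zero] at h
      exact h.mono_left nhdsWithin_le_nhds
    obtain ⟨s, hs, hs0⟩ := ((hlim.eventually h1).and self_mem_nhdsWithin).exists
    have hs0' : s ≠ 0 := hs0
    simp only [mink_add_right, mink_smul_right, hv.2.1, hu, hw.2.1, mul_zero, zero_add,
      forall_const] at hs
    exact (mul_eq_zero.mp hs).resolve_left hs0'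
  have h3 : (⨅ i : Fin 1, LinearMap.ker ((fun _ => minkForm n v : Fin 1 → Dual ℝ (Vec n)) i)) ≤
      LinearMap.ker (minkForm n w) := by
    intro u hu
    exact hker u (by simpa using hu)
  have h4 := mem_span_of_iInf_ker_le_ker h3
  rw [Set.range_const, Submodule.mem_span_singleton] at h4
  obtain ⟨c, hc⟩ := h4
  exact ⟨c, minkForm_injective n (by rw [map_smul, hc])⟩

end Cone

/-! ### Local models of piecewise geodesic complexes -/

section Models

open Module

variable {n : ℕ}

/-- Membership in a polyhedral piece of the hyperplane `v^⊥`. -/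
def InPiece (s : Vec n × Finset (Vec n)) (y : Vec n) : Prop :=
  mink s.1 y = 0 ∧ ∀ a ∈ s.2, 0 ≤ mink a y

/-- Near `x`, the set `D` is the union of the pieces in `S`. -/
def HasModel (D : Set (Hyp n)) (S : Finset (Vec n × Finset (Vec n))) (x : Hyp n) : Prop :=
  ∀ᶠ y in 𝓝 x, y ∈ D ↔ ∃ s ∈ S, InPiece s y.val

/-- The hyperplanes that carry or bound the pieces in `S`. -/
def arrangement (S : Finset (Vec n × Finset (Vec n))) : Set (Dual ℝ (Vec n)) :=
  minkForm n '' {v | ∃ s ∈ S, v = s.1 ∨ v ∈ s.2}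

/-- The defining vectors of the pieces in `S` are nonzero. -/
def Nondegenerate (S : Finset (Vec n × Finset (Vec n))) : Prop :=
  ∀ s ∈ S, s.1 ≠ 0 ∧ ∀ a ∈ s.2, a ≠ 0

lemma finite_arrangement (S : Finset (Vec n × Finset (Vec n))) : (arrangement S).Finite := by
  refine Set.Finite.image _ ?_
  have : {v | ∃ s ∈ S, v = s.1 ∨ v ∈ s.2} = ⋃ s ∈ S, ({s.1} ∪ (s.2 : Set (Vec n))) := by
    ext v; simp
  rw [this]
  exact S.finite_toSet.biUnion fun s _ => (Set.finite_singleton _).union s.2.finite_toSet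

lemma arrangement_ne_zero {S : Finset (Vec n × Finset (Vec n))} (hS : Nondegenerate S) :
    ∀ f ∈ arrangement S, f ≠ 0 := by
  rintro _ ⟨v, ⟨s, hs, rfl | hv⟩, rfl⟩
  · exact minkForm_ne_zero (hS s hs).1
  · exact minkForm_ne_zero ((hS s hs).2 v hv)

/-- The span of the vectors of the model that are orthogonal to `y`. -/
def conormals (S : Finset (Vec n × Finset (Vec n))) (y : Vec n) : Submodule ℝ (Vec n) :=
  Submodule.span ℝ {v | (∃ s ∈ S, v = s.1 ∨ v ∈ s.2) ∧ mink v y = 0}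

lemma finrank_conormals (S : Finset (Vec n × Finset (Vec n))) (y : Vec n) :
    finrank ℝ (conormals S y) = codimAt (arrangement S) y := by
  have h : (conormals S y).map (minkForm n) =
      Submodule.span ℝ {f | f ∈ arrangement S ∧ f y = 0} := by
    rw [conormals, Submodule.map_span]
    congr 1
    ext f
    constructor
    · rintro ⟨v, ⟨hv, hvy⟩, rfl⟩
      exact ⟨⟨v, hv, rfl⟩, hvy⟩
    · rintro ⟨⟨v, hv, rfl⟩, hvy⟩
      exact ⟨v, ⟨hv, hvy⟩, rfl⟩
  rw [codimAt, ← h]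
  exact (LinearEquiv.finrank_eq (Submodule.equivMapOfInjective _ (minkForm_injective n) _))

lemma mem_conormals_fst {S : Finset (Vec n × Finset (Vec n))} {s : Vec n × Finset (Vec n)}
    (hs : s ∈ S) {y : Vec n} (h : mink s.1 y = 0) : s.1 ∈ conormals S y :=
  Submodule.subset_span ⟨⟨s, hs, Or.inl rfl⟩, h⟩

lemma mem_conormals_snd {S : Finset (Vec n × Finset (Vec n))} {s : Vec n × Finset (Vec n)}
    (hs : s ∈ S) {a y : Vec n} (ha : a ∈ s.2) (h : mink a y = 0) : a ∈ conormals S y :=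
  Submodule.subset_span ⟨⟨s, hs, Or.inr ha⟩, h⟩

lemma mink_eq_zero_of_mem_conormals {S : Finset (Vec n × Finset (Vec n))} {u y : Vec n}
    (hu : u ∈ conormals S y) : mink u y = 0 := by
  have h : conormals S y ≤ LinearMap.ker ((minkForm n).flip y) := by
    rw [conormals, Submodule.span_le]
    rintro v ⟨_, hv⟩
    exact hv
  exact h hu

lemma isClosed_inPiece (s : Vec n × Finset (Vec n)) : IsClosed {y : Vec n | InPiece s y} := by
  have : {y : Vec n | InPiece s y} =
      {y | mink s.1 y = 0} ∩ ⋂ a ∈ s.2, {y | 0 ≤ mink a y} := by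
    ext y; simp [InPiece]
  rw [this]
  exact (isClosed_eq (continuous_mink_right _) continuous_const).inter
    (isClosed_biInter fun a _ => isClosed_le continuous_const (continuous_mink_right _))

lemma HasModel.eventually {D : Set (Hyp n)} {S : Finset (Vec n × Finset (Vec n))} {x : Hyp n}
    (h : HasModel D S x) : ∀ᶠ y in 𝓝 x, HasModel D S y := eventually_eventually_nhds.mpr h

lemma HasModel.mem_iff {D : Set (Hyp n)} {S : Finset (Vec n × Finset (Vec n))} {x : Hyp n}
    (h : HasModel D S x) : x ∈ D ↔ ∃ s ∈ S, InPiece s x.val := h.self_of_nhds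

lemma HasModel.not_mem {D : Set (Hyp n)} {S : Finset (Vec n × Finset (Vec n))} {x : Hyp n}
    (h : HasModel D S x) (hx : ∀ f ∈ arrangement S, f x.val ≠ 0) : x ∉ D := by
  rw [h.mem_iff]
  rintro ⟨s, hs, hx1, _⟩
  exact hx _ ⟨s.1, ⟨s, hs, Or.inl rfl⟩, rfl⟩ hx1

/-- Near `y`, only the pieces through `y`, and of these only the half spaces with `y` in their
boundary, matter. -/
lemma HasModel.reduce {D : Set (Hyp n)} {S : Finset (Vec n × Finset (Vec n))} {y : Hyp n}
    (h : HasModel D S y) : ∀ᶠ z in 𝓝 y, z ∈ D ↔ ∃ s ∈ S, InPiece s y.val ∧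
      mink s.1 z.val = 0 ∧ ∀ a ∈ s.2, mink a y.val = 0 → 0 ≤ mink a z.val := by
  have h1 : ∀ᶠ z : Hyp n in 𝓝 y, ∀ s ∈ S, InPiece s z.val → InPiece s y.val := by
    refine (Filter.eventually_all_finset S).mpr fun s _ => ?_
    by_cases hy : InPiece s y.val
    · exact Eventually.of_forall fun _ _ => hy
    · have : IsOpen {z : Hyp n | ¬ InPiece s z.val} :=
        ((isClosed_inPiece s).preimage continuous_subtype_val).isOpen_compl
      filter_upwards [this.mem_nhds hy] with z hz hz' using absurd hz' hz
  have h2 : ∀ᶠ z : Hyp n in 𝓝 y, ∀ s ∈ S, ∀ a ∈ s.2, 0 < mink a y.val → 0 < mink a z.val := by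
    refine (Filter.eventually_all_finset S).mpr fun s _ =>
      (Filter.eventually_all_finset s.2).mpr fun a _ => ?_
    by_cases hy : 0 < mink a y.val
    · have : IsOpen {z : Hyp n | 0 < mink a z.val} :=
        isOpen_lt continuous_const ((continuous_mink_right a).comp continuous_subtype_val)
      filter_upwards [this.mem_nhds hy] with z hz _ using hz
    · exact Eventually.of_forall fun _ hy' => absurd hy' hy
  filter_upwards [h, h1, h2] with z hz hz1 hz2
  rw [hz]
  constructor
  · rintro ⟨s, hs, hsz⟩
    exact ⟨s, hs, hz1 s hs hsz, hsz.1, fun a ha _ => hsz.2 a ha⟩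
  · rintro ⟨s, hs, hsy, hsz, hsa⟩
    refine ⟨s, hs, hsz, fun a ha => ?_⟩
    rcases (hsy.2 a ha).eq_or_lt with h0 | h0
    exacts [hsa a ha h0.symm, (hz2 s hs a ha h0).le]

lemma HasModel.eventually_not_mem {D : Set (Hyp n)} {S : Finset (Vec n × Finset (Vec n))}
    {y : Hyp n} (h : HasModel D S y) (hy : y ∉ D) : ∀ᶠ z in 𝓝 y, z ∉ D := by
  filter_upwards [h.reduce] with z hz
  rw [hz]
  rintro ⟨s, hs, hsy, _⟩
  exact hy (h.mem_iff.mpr ⟨s, hs, hsy⟩)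

lemma exists_smul_of_finrank_le_one {E : Submodule ℝ (Vec n)} (hE : finrank ℝ E ≤ 1)
    {v w : Vec n} (hv : v ∈ E) (hv0 : v ≠ 0) (hw : w ∈ E) : ∃ c : ℝ, w = c • v := by
  have h1 : Submodule.span ℝ {v} ≤ E := by
    rw [Submodule.span_le]; simpa using hv
  have h2 := Submodule.eq_of_le_of_finrank_le h1 (by rw [finrank_span_singleton hv0]; exact hE)
  rw [← h2, Submodule.mem_span_singleton] at hw
  obtain ⟨c, hc⟩ := hw
  exact ⟨c, hc.symm⟩

/-- Where the model has codimension at most one, `D` is empty or a hyperplane. -/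
lemma HasModel.not_mem_or_tangent {D : Set (Hyp n)} {S : Finset (Vec n × Finset (Vec n))}
    (hS : Nondegenerate S) {y : Hyp n} (h : HasModel D S y)
    (hc : codimAt (arrangement S) y.val ≤ 1) :
    y ∉ D ∨ ∃ v ∈ conormals S y.val, IsTangentAt D y v := by
  by_cases hy : y ∈ D
  swap
  · exact Or.inl hy
  right
  rw [← finrank_conormals] at hc
  obtain ⟨s₀, hs₀, hs₀y⟩ := h.mem_iff.mp hy
  have hv := mem_conormals_fst hs₀ hs₀y.1
  -- All conormals at `y` are proportional, so every piece through `y` lies in the same hyperplane,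
  -- and the half-spaces with `y` on their boundary impose nothing on it.
  have hmul : ∀ u ∈ conormals S y.val, ∃ c : ℝ, u = c • s₀.1 := fun u hu =>
    exists_smul_of_finrank_le_one hc hv (hS s₀ hs₀).1 hu
  refine ⟨s₀.1, hv, (hS s₀ hs₀).1, hs₀y.1, ?_⟩
  filter_upwards [h.reduce] with z hz
  rw [hz]
  constructor
  · rintro ⟨s, hs, hsy, hsz, _⟩
    obtain ⟨c, hc⟩ := hmul s.1 (mem_conormals_fst hs hsy.1)
    have hc0 : c ≠ 0 := by
      rintro rfl
      exact (hS s hs).1 (by rw [hc, zero_smul])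
    rw [hc, mink_smul_left] at hsz
    exact (mul_eq_zero.mp hsz).resolve_left hc0
  · intro hz
    refine ⟨s₀, hs₀, hs₀y, hz, fun a ha hay => ?_⟩
    obtain ⟨c, hc⟩ := hmul a (mem_conormals_snd hs₀ ha hay)
    rw [hc, mink_smul_left, hz, mul_zero]

lemma HasModel.not_mem_or_regular {D : Set (Hyp n)} {S : Finset (Vec n × Finset (Vec n))}
    (hS : Nondegenerate S) {y : Hyp n} (h : HasModel D S y)
    (hc : codimAt (arrangement S) y.val ≤ 1) : y ∉ D ∨ y ∈ regularPoints D :=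
  (h.not_mem_or_tangent hS hc).imp_right fun ⟨v, _, hv⟩ => ⟨v, hv⟩

lemma exists_linearIndependent_of_finrank_eq_two {E : Submodule ℝ (Vec n)} (hE : finrank ℝ E = 2)
    {v : Vec n} (hv0 : v ≠ 0) : ∃ b ∈ E, LinearIndependent ℝ ![v, b] := by
  by_contra! hc
  have h1 : E ≤ Submodule.span ℝ {v} := by
    intro b hb
    have := hc b hb
    rw [LinearIndependent.pair_iff' hv0] at this
    push Not at this
    obtain ⟨a, ha⟩ := this
    exact Submodule.mem_span_singleton.mpr ⟨a, ha⟩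
  have := Submodule.finrank_mono h1
  rw [finrank_span_singleton hv0, hE] at this
  omega

lemma span_pair_eq {E : Submodule ℝ (Vec n)} (hE : finrank ℝ E = 2) {v b : Vec n} (hv : v ∈ E)
    (hb : b ∈ E) (h : LinearIndependent ℝ ![v, b]) : Submodule.span ℝ {v, b} = E := by
  refine Submodule.eq_of_le_of_finrank_le ?_ ?_
  · rw [Submodule.span_le]
    rintro x (rfl | rfl)
    exacts [hv, hb]
  · have := finrank_span_eq_card h
    rw [Matrix.range_cons, Matrix.range_cons, Matrix.range_empty, Set.union_empty,
      Set.singleton_union] at this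
    rw [hE, this]
    simp

lemma exists_coords {E : Submodule ℝ (Vec n)} (hE : finrank ℝ E = 2) {v b u : Vec n} (hv : v ∈ E)
    (hb : b ∈ E) (h : LinearIndependent ℝ ![v, b]) (hu : u ∈ E) :
    ∃ α β : ℝ, u = α • v + β • b := by
  rw [← span_pair_eq hE hv hb h, Submodule.mem_span_pair] at hu
  obtain ⟨α, β, h⟩ := hu
  exact ⟨α, β, h.symm⟩

/-- Near a point of codimension two, a piece is a half-hyperplane or a hyperplane. -/
lemma exists_half_hyperplanes {E : Submodule ℝ (Vec n)} (hE : finrank ℝ E = 2)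
    {s : Vec n × Finset (Vec n)} (hs0 : s.1 ≠ 0) (hs : s.1 ∈ E) {y : Vec n}
    (hsE : ∀ a ∈ s.2, mink a y = 0 → a ∈ E)
    (hint : ∃ x : Vec n, mink s.1 x = 0 ∧ ∀ a ∈ s.2, 0 < mink a x) :
    ∃ T : Finset (Vec n × Vec n), T.Nonempty ∧
      (∀ t ∈ T, t.1 ∈ E ∧ t.2 ∈ E ∧ LinearIndependent ℝ ![t.1, t.2]) ∧
      ∀ z : Vec n, (mink s.1 z = 0 ∧ ∀ a ∈ s.2, mink a y = 0 → 0 ≤ mink a z) ↔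
        ∃ t ∈ T, mink t.1 z = 0 ∧ 0 ≤ mink t.2 z := by
  classical
  obtain ⟨x, hx, hxa⟩ := hint
  -- If some active `a₀` is independent of `s.1`, each other active `a` is a multiple of `a₀` on the
  -- hyperplane, a positive one because of the interior point `x`; so `a₀` alone counts. Otherwise
  -- no condition is left, and the full hyperplane is cut into two halves by an auxiliary `b`.
  by_cases hcase : ∃ a ∈ s.2, mink a y = 0 ∧ LinearIndependent ℝ ![s.1, a]
  · obtain ⟨a₀, ha₀, ha₀y, hli⟩ := hcase
    refine ⟨{(s.1, a₀)}, Finset.singleton_nonempty _, ?_, fun z => ?_⟩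
    · simpa using ⟨hs, hsE a₀ ha₀ ha₀y, hli⟩
    · simp only [Finset.mem_singleton, exists_eq_left]
      refine and_congr_right fun hz => ⟨fun h => h a₀ ha₀ ha₀y, fun h a ha hay => ?_⟩
      obtain ⟨α, β, rfl⟩ := exists_coords hE hs (hsE a₀ ha₀ ha₀y) hli (hsE a ha hay)
      have h1 := hxa _ ha
      have h2 := hxa _ ha₀
      rw [mink_add_left, mink_smul_left, mink_smul_left, hx, mul_zero, zero_add] at h1
      rw [mink_add_left, mink_smul_left, mink_smul_left, hz, mul_zero, zero_add]
      exact mul_nonneg (pos_of_mul_pos_left h1 h2.le).le h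
  · push Not at hcase
    obtain ⟨b, hb, hli⟩ := exists_linearIndependent_of_finrank_eq_two hE hs0
    have hli' : LinearIndependent ℝ ![s.1, -b] := by
      rw [LinearIndependent.pair_iff] at hli ⊢
      intro p q hpq
      have := hli p (-q) (by rw [← hpq]; module)
      simpa using this
    refine ⟨{(s.1, b), (s.1, -b)}, by simp, ?_, fun z => ?_⟩
    · simp only [Finset.mem_insert, Finset.mem_singleton]
      rintro t (rfl | rfl)
      exacts [⟨hs, hb, hli⟩, ⟨hs, E.neg_mem hb, hli'⟩]
    · simp only [Finset.mem_insert, Finset.mem_singleton, exists_eq_or_imp, exists_eq_left,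
        mink_neg_left]
      constructor
      · rintro ⟨hz, _⟩
        rcases le_total 0 (mink b z) with h | h
        exacts [Or.inl ⟨hz, h⟩, Or.inr ⟨hz, by linarith⟩]
      · intro h
        have hz : mink s.1 z = 0 := h.elim And.left And.left
        refine ⟨hz, fun a ha hay => ?_⟩
        have h1 := hcase a ha hay
        rw [LinearIndependent.pair_iff' hs0] at h1
        push Not at h1
        obtain ⟨c, rfl⟩ := h1
        rw [mink_smul_left, hz, mul_zero]

/-- Where the model has codimension at most two, `D` is empty, a hyperplane, or a union of
half-hyperplanes with a common boundary. -/
lemma HasModel.not_mem_or_regular_or_binding {D : Set (Hyp n)}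
    {S : Finset (Vec n × Finset (Vec n))} (hS : Nondegenerate S)
    (hint : ∀ s ∈ S, ∃ x : Vec n, mink s.1 x = 0 ∧ ∀ a ∈ s.2, 0 < mink a x)
    {y : Hyp n} (h : HasModel D S y) (hc : codimAt (arrangement S) y.val ≤ 2) :
    (y ∉ D ∨ y ∈ regularPoints D) ∨ y ∈ bindingPoints D := by
  classical
  by_cases hc1 : codimAt (arrangement S) y.val ≤ 1
  · exact Or.inl (h.not_mem_or_regular hS hc1)
  by_cases hy : y ∈ D ∧ y ∉ regularPoints D
  swap
  · left; tauto
  obtain ⟨hyD, hyr⟩ := hy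
  right
  have hE : finrank ℝ (conormals S y.val) = 2 := by rw [finrank_conormals]; omega
  refine ⟨hyr, conormals S y.val, hE, fun u hu => mink_eq_zero_of_mem_conormals hu, ?_⟩
  have hex : ∀ s : Vec n × Finset (Vec n), s ∈ S ∧ InPiece s y.val →
      ∃ T : Finset (Vec n × Vec n), T.Nonempty ∧
      (∀ t ∈ T, t.1 ∈ conormals S y.val ∧ t.2 ∈ conormals S y.val ∧
        LinearIndependent ℝ ![t.1, t.2]) ∧
      ∀ z : Vec n, (mink s.1 z = 0 ∧ ∀ a ∈ s.2, mink a y.val = 0 → 0 ≤ mink a z) ↔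
        ∃ t ∈ T, mink t.1 z = 0 ∧ 0 ≤ mink t.2 z := fun s hs =>
    exists_half_hyperplanes hE (hS s hs.1).1 (mem_conormals_fst hs.1 hs.2.1)
      (fun a ha hay => mem_conormals_snd hs.1 ha hay) (hint s hs.1)
  choose! T hTne hT hTiff using hex
  refine ⟨(S.filter fun s => InPiece s y.val).biUnion T, ?_, ?_, ?_⟩
  · obtain ⟨s, hs, hsy⟩ := h.mem_iff.mp hyD
    obtain ⟨t, ht⟩ := hTne s ⟨hs, hsy⟩
    exact ⟨t, Finset.mem_biUnion.mpr ⟨s, Finset.mem_filter.mpr ⟨hs, hsy⟩, ht⟩⟩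
  · intro t ht
    obtain ⟨s, hs, hts⟩ := Finset.mem_biUnion.mp ht
    exact hT s (Finset.mem_filter.mp hs) t hts
  · filter_upwards [h.reduce] with z hz
    rw [hz]
    constructor
    · rintro ⟨s, hs, hsy, hsz⟩
      obtain ⟨t, ht, htz⟩ := (hTiff s ⟨hs, hsy⟩ z.val).mp hsz
      exact ⟨t, Finset.mem_biUnion.mpr ⟨s, Finset.mem_filter.mpr ⟨hs, hsy⟩, ht⟩, htz⟩
    · rintro ⟨t, ht, htz⟩
      obtain ⟨s, hs, hts⟩ := Finset.mem_biUnion.mp ht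
      obtain ⟨hs, hsy⟩ := Finset.mem_filter.mp hs
      exact ⟨s, hs, hsy, (hTiff s ⟨hs, hsy⟩ z.val).mpr ⟨t, hts, htz⟩⟩

/-- A piecewise geodesic complex has a model near every point. -/
lemma IsPiecewiseGeodesic.exists_hasModel {D : Set (Hyp n)} (hD : IsPiecewiseGeodesic D)
    (x : Hyp n) : ∃ S : Finset (Vec n × Finset (Vec n)), Nondegenerate S ∧
      (∀ s ∈ S, ∃ x : Vec n, mink s.1 x = 0 ∧ ∀ a ∈ s.2, 0 < mink a x) ∧ HasModel D S x := by
  classical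
  obtain ⟨C, hC, hP, hx⟩ := hD x
  have hex : ∀ P ∈ C, ∃ s : Vec n × Finset (Vec n), s.1 ≠ 0 ∧
      (∃ x : Vec n, mink s.1 x = 0 ∧ ∀ a ∈ s.2, 0 < mink a x) ∧
      ∀ y : Hyp n, y ∈ P ↔ InPiece s y.val := by
    intro P hPC
    obtain ⟨v, A, hv, ⟨p, hp, hpA⟩, rfl⟩ := hP P hPC
    exact ⟨(v, A), hv, ⟨p.val, hp, hpA⟩, fun y => Iff.rfl⟩
  choose! s hs0 hsint hs using hex
  have hmem : ∀ t, t ∈ hC.toFinset.image s ↔ ∃ P ∈ C, s P = t := by simp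
  refine ⟨hC.toFinset.image s, ?_, ?_, ?_⟩
  · intro t ht
    obtain ⟨P, hPC, rfl⟩ := (hmem t).mp ht
    refine ⟨hs0 P hPC, ?_⟩
    obtain ⟨p, _, hp⟩ := hsint P hPC
    -- The interior point is strictly positive on each bounding vector, which excludes zero.
    rintro a ha rfl
    have := hp 0 ha
    simp [mink] at this
  · intro t ht
    obtain ⟨P, hPC, rfl⟩ := (hmem t).mp ht
    exact hsint P hPC
  · filter_upwards [hx] with y hy
    rw [hy]
    constructor
    · rintro ⟨P, hPC, hyP⟩
      exact ⟨s P, (hmem _).mpr ⟨P, hPC, rfl⟩, (hs P hPC y).mp hyP⟩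
    · rintro ⟨t, ht, hyt⟩
      obtain ⟨P, hPC, rfl⟩ := (hmem t).mp ht
      exact ⟨P, hPC, (hs P hPC y).mpr hyt⟩

lemma IsPiecewiseGeodesic.eventually_not_mem {D : Set (Hyp n)} (hD : IsPiecewiseGeodesic D)
    {x : Hyp n} (hx : x ∉ D) : ∀ᶠ y in 𝓝 x, y ∉ D := by
  obtain ⟨S, _, _, hS⟩ := hD.exists_hasModel x
  exact hS.eventually_not_mem hx

end Models

/-! ### Jumps along a branched hypersurface -/

section Jumps

open Module

variable {n : ℕ}

/-- A continuous unit conormal field along the regular part of `D`. -/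
def IsConormalField (D : Set (Hyp n)) (N : Hyp n → Vec n) : Prop :=
  ContinuousOn N (regularPoints D) ∧
    ∀ x ∈ regularPoints D, mink (N x) (N x) = 1 ∧ IsTangentAt D x (N x)

/-- A function is locally constant along the regular part of `D`. -/
def LocConstAlong (D : Set (Hyp n)) {β : Type*} (r : Hyp n → β) : Prop :=
  ∀ x ∈ regularPoints D, ∀ᶠ y in 𝓝 x, y ∈ D → r y = r x

lemma eventually_mem_regularPoints {D : Set (Hyp n)} {x : Hyp n} (hx : x ∈ regularPoints D) :
    ∀ᶠ y in 𝓝 x, y ∈ D → y ∈ regularPoints D := by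
  obtain ⟨v, hv⟩ := hx
  filter_upwards [hv.eventually] with y hy hyD using ⟨v, hy hyD⟩

/-- Nearby conormals are multiples `c • N x` with `c ^ 2 = 1`, and continuity makes `c` positive. -/
lemma IsConormalField.locConstAlong {D : Set (Hyp n)} {N : Hyp n → Vec n}
    (hN : IsConormalField D N) : LocConstAlong D N := by
  intro x hx
  have hcont : Tendsto (fun y => mink (N x) (N y)) (𝓝[regularPoints D] x) (𝓝 1) := by
    rw [← (hN.2 x hx).1]
    exact ((continuous_mink_right (N x)).tendsto _).comp (hN.1 x hx)
  have hpos := eventually_nhdsWithin_iff.mp (hcont.eventually (lt_mem_nhds one_pos))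
  filter_upwards [hpos, eventually_mem_regularPoints hx, (hN.2 x hx).2.eventually]
    with y h1 h2 h3 hyD
  have hy := h2 hyD
  obtain ⟨c, hc⟩ := (h3 hyD).exists_smul (hN.2 y hy).2
  have hpos := h1 hy
  have hsq := (hN.2 y hy).1
  rw [hc, mink_smul_right, (hN.2 x hx).1] at hpos
  rw [hc, mink_smul_left, mink_smul_right, (hN.2 x hx).1] at hsq
  have : c = 1 := by nlinarith
  rw [hc, this, one_smul]

lemma LocConstAlong.eq_of_isPreconnected {D : Set (Hyp n)} {β : Type*} {r : Hyp n → β}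
    (hr : LocConstAlong D r) {P : Set (Vec n)} (hP : IsPreconnected P) (hPc : P ⊆ cone n)
    (hPr : ∀ p ∈ P, toHyp p ∈ regularPoints D) {p q : Vec n} (hp : p ∈ P) (hq : q ∈ P) :
    r (toHyp p) = r (toHyp q) := by
  refine hP.induction₂ (fun p q => r (toHyp p) = r (toHyp q)) (fun p hp => ?_)
    (fun _ _ _ _ _ _ h1 h2 => h1.trans h2) (fun _ _ _ _ h => h.symm) hp hq
  filter_upwards [((tendsto_toHyp (hPc hp)).eventually (hr _ (hPr p hp))).filter_mono
    nhdsWithin_le_nhds, self_mem_nhdsWithin] with q hq hqP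
  exact (hq (mem_of_mem_regularPoints (hPr q hqP))).symm

variable {A : Type*} [AddCommGroup A] [Module ℝ A]

open Classical in
/-- The model of a function with jump `r • β N` across `D`, in the direction of the conormal `N`. -/
def jumpModel (D : Set (Hyp n)) (N : Hyp n → Vec n) (β : Vec n → A) (r : Hyp n → ℝ)
    (z w : Vec n) : A :=
  if toHyp z ∈ regularPoints D ∧ 0 < mink (N (toHyp z)) w then r (toHyp z) • β (N (toHyp z)) else 0

/-- The points of the cone near which `D` is empty or a hyperplane. -/
def tame (D : Set (Hyp n)) : Set (Vec n) :=
  {z | z ∈ cone n ∧ (toHyp z ∉ D ∨ toHyp z ∈ regularPoints D)}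

variable {D : Set (Hyp n)} {N : Hyp n → Vec n} {β : Vec n → A} {r : Hyp n → ℝ}

lemma jumpModel_add (r r' : Hyp n → ℝ) :
    jumpModel D N β (r + r') = jumpModel D N β r + jumpModel D N β r' := by
  funext z w
  simp only [jumpModel, Pi.add_apply]
  split_ifs
  · exact add_smul _ _ _
  · exact (add_zero _).symm

lemma jumpModel_smul (c : ℝ) (r : Hyp n → ℝ) :
    jumpModel D N β (c • r) = c • jumpModel D N β r := by
  funext z w
  simp only [jumpModel, Pi.smul_apply, smul_eq_mul]
  split_ifs
  · exact mul_smul _ _ _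
  · exact (smul_zero _).symm

lemma jumpModel_of_not_mem {z : Vec n} (h : toHyp z ∉ D) : jumpModel D N β r z = 0 := by
  funext w
  rw [jumpModel, if_neg fun h' => h (mem_of_mem_regularPoints h'.1)]
  rfl

lemma isSolAt_zero_of_not_mem {z : Vec n} (h : toHyp z ∉ D) :
    IsSolAt (jumpModel D N β r) 0 z :=
  ⟨0, Eventually.of_forall fun w => by rw [jumpModel_of_not_mem h]; simp⟩

/-- The models fit together: along a wall `N` and `r` are locally constant, so the model is the
same, and off `D` the step function is locally constant. -/
lemma isSolAt_jumpModel (hD : IsPiecewiseGeodesic D) (hN : IsConormalField D N)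
    (hr : LocConstAlong D r) : ∀ y ∈ tame D, ∀ᶠ y' in 𝓝 y, y' ∈ tame D →
      IsSolAt (jumpModel D N β r) (jumpModel D N β r y) y' := by
  rintro y ⟨hyc, hy | hy⟩
  · filter_upwards [(tendsto_toHyp hyc).eventually (hD.eventually_not_mem hy)] with y' hy' _
    rw [jumpModel_of_not_mem hy]
    exact isSolAt_zero_of_not_mem hy'
  · filter_upwards [(tendsto_toHyp hyc).eventually (eventually_mem_regularPoints hy),
      (tendsto_toHyp hyc).eventually (hN.locConstAlong _ hy),
      (tendsto_toHyp hyc).eventually (hr _ hy),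
      (tendsto_toHyp hyc).eventually (hN.2 _ hy).2.2.2] with y' h1 h2 h3 h4 hy'
    by_cases hD' : toHyp y' ∈ D
    · refine ⟨0, Eventually.of_forall fun z => ?_⟩
      simp only [jumpModel, hy, h1 hD', h2 hD', h3 hD', true_and, add_zero]
    · have hne : mink (N (toHyp y)) y' ≠ 0 := by
        rw [Ne, ← mink_toHyp_eq_zero hy'.1]
        exact fun h => hD' (h4.mpr h)
      refine ⟨jumpModel D N β r y y', ?_⟩
      rw [jumpModel_of_not_mem hD']
      refine eventually_genNhds_of_nhds ?_
      have hcont := continuous_mink_right (N (toHyp y))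
      rcases lt_or_gt_of_ne hne with h | h
      · filter_upwards [hcont.continuousAt.eventually (gt_mem_nhds h)] with z hz
        simp [jumpModel, h.not_gt, hz.not_gt]
      · filter_upwards [hcont.continuousAt.eventually (lt_mem_nhds h)] with z hz
        rw [jumpModel, jumpModel, if_pos ⟨hy, hz⟩, if_pos ⟨hy, h⟩]
        simp

lemma locSolvable_of_mem_tame (hD : IsPiecewiseGeodesic D) (hN : IsConormalField D N)
    (hr : LocConstAlong D r) {y : Vec n} (hy : y ∈ tame D) :
    LocSolvable (jumpModel D N β r) (tame D) y :=
  ⟨_, isSolAt_jumpModel hD hN hr y hy⟩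

lemma codimAt_toHyp (𝓕 : Set (Dual ℝ (Vec n))) {z : Vec n} (hz : z ∈ cone n) :
    codimAt 𝓕 (toHyp z).val = codimAt 𝓕 z := by
  obtain ⟨c, hc, h⟩ := exists_toHyp_eq_smul hz
  have hiff : ∀ f : Dual ℝ (Vec n), f (toHyp z).val = 0 ↔ f z = 0 := fun f => by
    rw [h, map_smul, smul_eq_mul, mul_eq_zero, or_iff_right hc.ne']
  exact le_antisymm (codimAt_mono fun f hf h => ⟨hf, (hiff f).mp h⟩)
    (codimAt_mono fun f hf h => ⟨hf, (hiff f).mpr h⟩)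

lemma mem_tame_of_hasModel {S : Finset (Vec n × Finset (Vec n))} (hS : Nondegenerate S)
    {z : Vec n} (hz : z ∈ cone n) (h : HasModel D S (toHyp z))
    (hc : codimAt (arrangement S) z ≤ 1) : z ∈ tame D :=
  ⟨hz, h.not_mem_or_regular hS (by rwa [codimAt_toHyp _ hz])⟩

lemma adapted_of_hasModel {S : Finset (Vec n × Finset (Vec n))} (hS : Nondegenerate S)
    {U : Set (Vec n)} (hU : U ⊆ cone n) (hmodel : ∀ z ∈ U, HasModel D S (toHyp z))
    (hloc : ∀ z ∈ U, codimAt (arrangement S) z ≤ 2 →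
      LocSolvable (jumpModel D N β r) (tame D) z) :
    Adapted (jumpModel D N β r) (tame D) (arrangement S) U := by
  refine ⟨finite_arrangement S, arrangement_ne_zero hS,
    fun z hz hc => mem_tame_of_hasModel hS (hU hz) (hmodel z hz) hc, hloc, fun z hz hf => ?_⟩
  refine isSolAt_zero_of_not_mem ((hmodel z hz).not_mem fun f hf' => ?_)
  obtain ⟨c, hc, h⟩ := exists_toHyp_eq_smul (hU hz)
  rw [h, map_smul, smul_eq_mul]
  exact mul_ne_zero hc.ne' (hf f hf')

/-- Up to codimension two every point of the cone is tame or a binding, and tame points carry their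
own models; only bindings need a hypothesis. -/
lemma exists_adapted (hD : IsPiecewiseGeodesic D) (hN : IsConormalField D N)
    (hr : LocConstAlong D r)
    (hb : ∀ z ∈ cone n, toHyp z ∈ bindingPoints D → LocSolvable (jumpModel D N β r) (tame D) z) :
    ∀ z ∈ cone n, ∃ W ∈ 𝓝 z, ∃ 𝓕, Adapted (jumpModel D N β r) (tame D) 𝓕 W := by
  intro z hz
  obtain ⟨S, hS, hint, hmodel⟩ := hD.exists_hasModel (toHyp z)
  have hev := ((tendsto_toHyp hz).eventually hmodel.eventually).and (eventually_mem_cone hz)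
  refine ⟨_, hev, arrangement S, adapted_of_hasModel hS (fun w hw => hw.2) (fun w hw => hw.1)
    fun w hw hc => ?_⟩
  rcases hw.1.not_mem_or_regular_or_binding hS hint (by rwa [codimAt_toHyp _ hw.2]) with h | h
  · exact locSolvable_of_mem_tame hD hN hr ⟨hw.2, h⟩
  · exact hb w hw.2 h

/-! ### Linearity of the jump problem -/

lemma IsSolAt.zero {V : Type*} [TopologicalSpace V] {A : Type*} [AddCommGroup A] (y : V) :
    IsSolAt (0 : V → V → A) 0 y := ⟨0, Eventually.of_forall fun _ => by simp⟩

lemma IsSolAt.add {V : Type*} [TopologicalSpace V] {A : Type*} [AddCommGroup A]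
    {Ψ Ψ' : V → V → A} {Φ Φ' : V → A} {y : V} (h : IsSolAt Ψ Φ y) (h' : IsSolAt Ψ' Φ' y) :
    IsSolAt (Ψ + Ψ') (Φ + Φ') y := by
  obtain ⟨c, hc⟩ := h
  obtain ⟨c', hc'⟩ := h'
  refine ⟨c + c', ?_⟩
  filter_upwards [hc, hc'] with z h1 h2
  simp only [Pi.add_apply, h1, h2]
  abel

lemma IsSolAt.smul {V : Type*} [TopologicalSpace V] {A : Type*} [AddCommGroup A] [Module ℝ A]
    {Ψ : V → V → A} {Φ : V → A} {y : V} (a : ℝ) (h : IsSolAt Ψ Φ y) :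
    IsSolAt (a • Ψ) (a • Φ) y := by
  obtain ⟨c, hc⟩ := h
  refine ⟨a • c, ?_⟩
  filter_upwards [hc] with z h1
  simp only [Pi.smul_apply, h1, smul_add]

variable {T : Type*} [AddCommGroup T] [Module ℝ T]

/-- The weights for which the jump problem is locally solvable at `z`. -/
def solvableWeights (D : Set (Hyp n)) (N : Hyp n → Vec n) (β : Vec n → A)
    (wt : T →ₗ[ℝ] Hyp n → ℝ) (z : Vec n) : Submodule ℝ T where
  carrier := {t | LocSolvable (jumpModel D N β (wt t)) (tame D) z}
  zero_mem' := by
    refine ⟨0, Eventually.of_forall fun y _ => ?_⟩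
    have : jumpModel D N β (wt 0) = 0 := by
      rw [map_zero, ← zero_smul ℝ (0 : Hyp n → ℝ), jumpModel_smul, zero_smul]
    rw [this]
    exact IsSolAt.zero y
  add_mem' := by
    rintro t t' ⟨Φ, h⟩ ⟨Φ', h'⟩
    refine ⟨Φ + Φ', ?_⟩
    rw [map_add, jumpModel_add]
    filter_upwards [h, h'] with y h1 h2 hy using (h1 hy).add (h2 hy)
  smul_mem' := by
    rintro a t ⟨Φ, h⟩
    refine ⟨a • Φ, ?_⟩
    rw [map_smul, jumpModel_smul]
    filter_upwards [h] with y h1 hy using (h1 hy).smul a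

end Jumps

/-- Comparison of dimensions along a linear correspondence. -/
lemma rank_le_of_ker_le {S T H : Type} [AddCommGroup S] [Module ℝ S] [AddCommGroup T]
    [Module ℝ T] [AddCommGroup H] [Module ℝ H] (f : S →ₗ[ℝ] T) (g : S →ₗ[ℝ] H)
    (hf : Function.Surjective f) (h : LinearMap.ker g ≤ LinearMap.ker f) :
    Module.rank ℝ T ≤ Module.rank ℝ H := by
  have h1 : Function.Surjective ((LinearMap.ker g).liftQ f h) := by
    rw [← LinearMap.range_eq_top, Submodule.range_liftQ, LinearMap.range_eq_top]
    exact hf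
  calc Module.rank ℝ T ≤ Module.rank ℝ (S ⧸ LinearMap.ker g) := LinearMap.rank_le_of_surjective _ h1
    _ = Module.rank ℝ (LinearMap.range g) := g.quotKerEquivRange.rank_eq
    _ ≤ Module.rank ℝ H := Submodule.rank_le _

/-! ### The bending direction of a hyperplane -/

section Bend

variable {n : ℕ}

/-- The trace-free part of `u ⊗ u`, as a self-adjoint matrix for the Lorentzian form. -/
def bend (u : Vec n) : nu n :=
  ⟨Matrix.vecMulVec u ((J n).mulVec u) - (mink u u / (n + 1)) • (1 : Mat n), by
    refine ⟨?_, ?_⟩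
    · rw [Matrix.trace_sub, Matrix.trace_smul, Matrix.trace_vecMulVec, Matrix.trace_one]
      have : (n : ℝ) + 1 ≠ 0 := by positivity
      simp only [Fintype.card_fin, Nat.cast_add, Nat.cast_one, smul_eq_mul, mink]
      field_simp
      ring
    · rw [Matrix.transpose_sub, Matrix.transpose_smul, Matrix.transpose_one, Matrix.sub_mul,
        Matrix.mul_sub, Matrix.transpose_vecMulVec, Matrix.smul_mul, Matrix.mul_smul,
        Matrix.one_mul, Matrix.mul_one, Matrix.vecMulVec_mul, Matrix.mul_vecMulVec]
      congr 2
      rw [← Matrix.mulVec_transpose, J_transpose]⟩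

lemma bend_val (u : Vec n) : (bend u).val =
    Matrix.vecMulVec u ((J n).mulVec u) - (mink u u / (n + 1)) • (1 : Mat n) := rfl

lemma bend_mulVec (u z : Vec n) :
    (bend u).val.mulVec z = mink u z • u - (mink u u / (n + 1)) • z := by
  rw [bend_val, Matrix.sub_mulVec, Matrix.smul_mulVec, Matrix.one_mulVec]
  congr 1
  ext i
  simp only [Matrix.mulVec, Matrix.vecMulVec_apply, dotProduct, Pi.smul_apply, smul_eq_mul]
  rw [mink_comm, mink, dotProduct, Finset.sum_mul]
  exact Finset.sum_congr rfl fun j _ => by simp only [Matrix.mulVec, dotProduct]; ring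

/-- Polarization of the quadratic map `bend`: the mixed term is `bend (v + b) - bend v - bend b`.
This is the origin of the factor three. -/
lemma bend_comb (v b : Vec n) (α β : ℝ) : bend (α • v + β • b) =
    (α ^ 2 - α * β) • bend v + (β ^ 2 - α * β) • bend b + (α * β) • bend (v + b) := by
  apply Subtype.ext
  refine Matrix.ext_of_mulVec_single fun i => ?_
  simp only [Submodule.coe_add, Submodule.coe_smul, Matrix.add_mulVec, Matrix.smul_mulVec,
    bend_mulVec, mink_add_left, mink_add_right, mink_smul_left, mink_smul_right, mink_comm b v]
  module

/-- On a vector orthogonal to `u` the matrix acts as the scalar `-1 / (n + 1)`. -/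
lemma bend_ne_zero {u z : Vec n} (hu : mink u u = 1) (hz : mink u z = 0) (hz0 : z ≠ 0) :
    bend u ≠ 0 := by
  intro h
  have h1 := bend_mulVec u z
  rw [h, hz, hu] at h1
  simp only [ZeroMemClass.coe_zero, Matrix.zero_mulVec, zero_smul, zero_sub] at h1
  have h2 := smul_eq_zero.mp (neg_eq_zero.mp h1.symm)
  have : (1 : ℝ) / (n + 1) ≠ 0 := by positivity
  exact h2.elim this hz0

lemma adNu_bend (g : OPlus n) (u : Vec n) : adNu n g (bend u) = bend (g.val.val.mulVec u) := by
  apply Subtype.ext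
  refine Matrix.ext_of_mulVec_single fun i => ?_
  change (g.val.val * (bend u).val * (g⁻¹).val.val).mulVec _ = _
  rw [← Matrix.mulVec_mulVec, ← Matrix.mulVec_mulVec, bend_mulVec, bend_mulVec,
    Matrix.mulVec_sub, Matrix.mulVec_smul, Matrix.mulVec_smul, mulVec_mulVec_inv,
    mink_mulVec_mulVec, ← mink_mulVec_mulVec g u, mulVec_mulVec_inv]

/-- The span of the bending directions of the hyperplanes conormal to a plane. -/
def bendPlane (v b : Vec n) : Submodule ℝ (nu n) :=
  Submodule.span ℝ {bend v, bend b, bend (v + b)}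

lemma rank_bendPlane_le (v b : Vec n) : Module.rank ℝ (bendPlane v b) ≤ 3 := by
  classical
  refine (rank_span_le _).trans ?_
  have : ({bend v, bend b, bend (v + b)} : Set (nu n)) =
      (({bend v, bend b, bend (v + b)} : Finset (nu n)) : Set (nu n)) := by simp
  rw [this]
  refine (Cardinal.mk_coe_finset (s := {bend v, bend b, bend (v + b)})).le.trans ?_
  exact_mod_cast Finset.card_le_three

lemma bend_mem_bendPlane (v b : Vec n) (α β : ℝ) : bend (α • v + β • b) ∈ bendPlane v b := by
  rw [bend_comb]
  refine add_mem (add_mem ?_ ?_) ?_ <;>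
    exact Submodule.smul_mem _ _ (Submodule.subset_span (by simp))

end Bend

/-! ### The neighborhood of a binding -/

section Binding

open Module

variable {n : ℕ}

/-- In the convex open set `B`, the complex `D` is given by pieces with conormals in `E`. -/
structure BindingChart (D : Set (Hyp n)) (E : Submodule ℝ (Vec n))
    (S : Finset (Vec n × Finset (Vec n))) (B : Set (Vec n)) : Prop where
  finrank_eq : finrank ℝ E = 2
  isOpen : IsOpen B
  convex : Convex ℝ B
  subset_cone : B ⊆ cone n
  nondegenerate : Nondegenerate S
  hasModel : ∀ z ∈ B, HasModel D S (toHyp z)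
  mem_plane : ∀ s ∈ S, s.1 ∈ E ∧ ∀ a ∈ s.2, a ∈ E
  exists_pair : ∃ s ∈ S, ∃ a ∈ s.2, LinearIndependent ℝ ![s.1, a]

/-- A half-hyperplane is a piece with a single bounding half-space. -/
lemma exists_bindingChart {D : Set (Hyp n)} {x : Hyp n} (hx : x ∈ bindingPoints D) :
    ∃ E S B, BindingChart D E S B ∧ x.val ∈ B ∧ ∀ u ∈ E, mink u x.val = 0 := by
  classical
  obtain ⟨_, E, hE, hEx, S, ⟨s₀, hs₀⟩, hS, hev⟩ := hx
  have hmodel : HasModel D (S.image fun s => (s.1, {s.2})) x := by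
    filter_upwards [hev] with y hy
    rw [hy]
    simp [InPiece]
  have hxc := hyp_mem_cone x
  have h1 := (tendsto_toHyp hxc).eventually
    (show ∀ᶠ y in 𝓝 (toHyp x.val), HasModel D (S.image fun s => (s.1, {s.2})) y by
      rw [toHyp_coe]; exact hmodel.eventually)
  obtain ⟨ε, hε, hball⟩ := Metric.eventually_nhds_iff_ball.mp (h1.and (eventually_mem_cone hxc))
  refine ⟨E, _, Metric.ball x.val ε, ⟨hE, Metric.isOpen_ball, convex_ball _ _,
    fun z hz => (hball z hz).2, ?_, fun z hz => (hball z hz).1, ?_, ?_⟩,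
    Metric.mem_ball_self hε, hEx⟩
  · intro t ht
    obtain ⟨s, hs, rfl⟩ := Finset.mem_image.mp ht
    have hli := (hS s hs).2.2
    refine ⟨hli.ne_zero 0, ?_⟩
    simpa using hli.ne_zero 1
  · intro t ht
    obtain ⟨s, hs, rfl⟩ := Finset.mem_image.mp ht
    exact ⟨(hS s hs).1, by simpa using (hS s hs).2.1⟩
  · exact ⟨_, Finset.mem_image_of_mem _ hs₀, s₀.2, by simp, (hS s₀ hs₀).2.2⟩

namespace BindingChart

variable {D : Set (Hyp n)} {E : Submodule ℝ (Vec n)} {S : Finset (Vec n × Finset (Vec n))}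
  {B : Set (Vec n)}

lemma conormals_le (h : BindingChart D E S B) (z : Vec n) : conormals S z ≤ E := by
  rw [conormals, Submodule.span_le]
  rintro v ⟨⟨s, hs, rfl | hv⟩, _⟩
  exacts [(h.mem_plane s hs).1, (h.mem_plane s hs).2 v hv]

/-- The conormals of the chart lie in `E` and contain a basis of it, so the only stratum of
codimension two is the orthogonal of `E`. -/
lemma codimAt_le_one_iff (h : BindingChart D E S B) (z : Vec n) :
    codimAt (arrangement S) z ≤ 1 ↔ ∃ u ∈ E, mink u z ≠ 0 := by
  constructor
  · intro hc
    by_contra! hz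
    obtain ⟨s, hs, a, ha, hli⟩ := h.exists_pair
    have := two_le_codimAt (𝓕 := arrangement S) (x := z) (f := minkForm n s.1) (g := minkForm n a)
      ⟨_, ⟨s, hs, Or.inl rfl⟩, rfl⟩ ⟨_, ⟨s, hs, Or.inr ha⟩, rfl⟩ (hz _ (h.mem_plane s hs).1)
      (hz _ ((h.mem_plane s hs).2 a ha)) (by
        have := hli.map' (minkForm n) (LinearMap.ker_eq_bot.mpr (minkForm_injective n))
        have e : minkForm n ∘ ![s.1, a] = ![minkForm n s.1, minkForm n a] := by
          funext i
          fin_cases i <;> rfl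
        rw [e] at this
        exact this)
    omega
  · rintro ⟨u, hu, huz⟩
    by_contra hc
    rw [← finrank_conormals] at hc
    have := Submodule.eq_of_le_of_finrank_le (h.conormals_le z) (by rw [h.finrank_eq]; omega)
    exact huz (mink_eq_zero_of_mem_conormals (this ▸ hu))

lemma mem_tame (h : BindingChart D E S B) {z : Vec n} (hz : z ∈ B)
    (hc : codimAt (arrangement S) z ≤ 1) : z ∈ tame D :=
  mem_tame_of_hasModel h.nondegenerate (h.subset_cone hz) (h.hasModel z hz) hc

lemma mink_eq_zero_of_not_mem_tame (h : BindingChart D E S B) {z : Vec n} (hz : z ∈ B)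
    (hzt : z ∉ tame D) : ∀ u ∈ E, mink u z = 0 := by
  by_contra! hc
  exact hzt (h.mem_tame hz ((h.codimAt_le_one_iff z).mpr hc))

/-- Conormals in `E` are what confines the jumps to `bendPlane`. -/
lemma conormal_mem (h : BindingChart D E S B) {N : Hyp n → Vec n} (hN : IsConormalField D N)
    {z : Vec n} (hz : z ∈ B) (hc : codimAt (arrangement S) z ≤ 1)
    (hr : toHyp z ∈ regularPoints D) : N (toHyp z) ∈ E := by
  rcases (h.hasModel z hz).not_mem_or_tangent h.nondegenerate
    (by rwa [codimAt_toHyp _ (h.subset_cone hz)]) with h' | ⟨v, hv, hvt⟩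
  · exact absurd (mem_of_mem_regularPoints hr) h'
  · obtain ⟨c, hc⟩ := hvt.exists_smul (hN.2 _ hr).2
    rw [hc]
    exact E.smul_mem _ (h.conormals_le _ hv)

lemma toHyp_mem_iff (h : BindingChart D E S B) {z : Vec n} (hz : z ∈ B) :
    toHyp z ∈ D ↔ ∃ s ∈ S, InPiece s z := by
  rw [(h.hasModel z hz).mem_iff]
  simp only [InPiece, mink_toHyp_eq_zero (h.subset_cone hz), mink_toHyp_nonneg (h.subset_cone hz)]

/-- Translation along the binding does not change the jumps. -/
lemma jumpModel_eq_of_translate (h : BindingChart D E S B) {N : Hyp n → Vec n}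
    (hN : IsConormalField D N) {A : Type*} [AddCommGroup A] [Module ℝ A] {β : Vec n → A}
    {r : Hyp n → ℝ} (hr : LocConstAlong D r) {e w : Vec n} (he : ∀ u ∈ E, mink u e = 0)
    (hw : w ∈ B) (hwe : w + e ∈ B) (hc : codimAt (arrangement S) w ≤ 1) (z : Vec n) :
    jumpModel D N β r w z = jumpModel D N β r (w + e) (z + e) := by
  -- Forms in `E` do not change along the segment. If it starts on `D`, it therefore stays on a
  -- single wall sheet, where `N` and `r` are constant.
  have hseg : ∀ p ∈ segment ℝ w (w + e), p ∈ B ∧ ∀ u ∈ E, mink u p = mink u w := by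
    intro p hp
    refine ⟨h.convex.segment_subset hw hwe hp, fun u hu => ?_⟩
    obtain ⟨a, b, _, _, hab, rfl⟩ := hp
    rw [mink_add_right, mink_smul_right, mink_smul_right, mink_add_right, he u hu, add_zero,
      ← add_mul, hab, one_mul]
  have hmem : ∀ p ∈ segment ℝ w (w + e), toHyp p ∈ D ↔ toHyp w ∈ D := by
    intro p hp
    rw [h.toHyp_mem_iff (hseg p hp).1, h.toHyp_mem_iff hw]
    refine exists_congr fun s => and_congr_right fun hs => ?_
    rw [InPiece, InPiece, (hseg p hp).2 _ (h.mem_plane s hs).1]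
    refine and_congr_right fun _ => forall₂_congr fun a ha => ?_
    rw [(hseg p hp).2 _ ((h.mem_plane s hs).2 a ha)]
  have hleft := left_mem_segment ℝ w (w + e)
  have hright := right_mem_segment ℝ w (w + e)
  by_cases hD : toHyp w ∈ D
  · have hreg : ∀ p ∈ segment ℝ w (w + e), toHyp p ∈ regularPoints D := by
      intro p hp
      have hcp : codimAt (arrangement S) p ≤ 1 := by
        rw [h.codimAt_le_one_iff] at hc ⊢
        obtain ⟨u, hu, hne⟩ := hc
        exact ⟨u, hu, by rwa [(hseg p hp).2 u hu]⟩
      exact (h.mem_tame (hseg p hp).1 hcp).2.resolve_left fun h' => h' ((hmem p hp).mpr hD)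
    have hpre := (convex_segment (𝕜 := ℝ) w (w + e)).isPreconnected
    have hN' := hN.locConstAlong.eq_of_isPreconnected hpre
      (fun p hp => h.subset_cone (hseg p hp).1) hreg hleft hright
    have hr' := hr.eq_of_isPreconnected hpre (fun p hp => h.subset_cone (hseg p hp).1) hreg
      hleft hright
    have hNE := h.conormal_mem hN hw hc (hreg w hleft)
    have hz : mink (N (toHyp w)) (z + e) = mink (N (toHyp w)) z := by
      rw [mink_add_right, he _ hNE, add_zero]
    simp only [jumpModel, ← hN', ← hr', hz, hreg w hleft, hreg _ hright]
  · have hD' : toHyp (w + e) ∉ D := fun h' => hD ((hmem _ hright).mp h')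
    rw [jumpModel_of_not_mem hD, jumpModel_of_not_mem hD']
    rfl

variable {T : Type*} [AddCommGroup T] [Module ℝ T] {N : Hyp n → Vec n}
  {wt : T →ₗ[ℝ] Hyp n → ℝ}

/-- A solution near `z` is carried to `z'` by the translation by `z - z'`, which is parallel to the
binding. -/
lemma solvableWeights_le (h : BindingChart D E S B) (hD : IsPiecewiseGeodesic D)
    (hN : IsConormalField D N) (hwt : ∀ t, LocConstAlong D (wt t)) {A : Type*} [AddCommGroup A]
    [Module ℝ A] {β : Vec n → A} {z z' : Vec n} (hz : z ∈ B) (hz' : z' ∈ B)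
    (hzE : ∀ u ∈ E, mink u z = 0) (hzE' : ∀ u ∈ E, mink u z' = 0) :
    solvableWeights D N β wt z ≤ solvableWeights D N β wt z' := by
  rintro t ⟨Φ, hΦ⟩
  have he : ∀ u ∈ E, mink u (z - z') = 0 := fun u hu => by
    rw [sub_eq_add_neg, ← neg_one_smul ℝ z', mink_add_right, mink_smul_right, hzE u hu,
      hzE' u hu]
    ring
  set τ : Vec n ≃ₜ Vec n := Homeomorph.addRight (z - z') with hτ
  have hτz : τ z' = z := by simp [hτ]
  have htend : Tendsto τ (𝓝 z') (𝓝 z) := by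
    have := τ.continuous.tendsto z'
    rwa [hτz] at this
  have hsol : ∀ᶠ w in 𝓝 z', codimAt (arrangement S) w ≤ 1 →
      IsSolAt (jumpModel D N β (wt t)) (fun v => Φ (τ v)) w := by
    filter_upwards [htend.eventually hΦ, htend.eventually (h.isOpen.mem_nhds hz),
      h.isOpen.mem_nhds hz'] with w h1 h2 h3 hc
    have hc' : codimAt (arrangement S) (τ w) ≤ 1 := by
      rw [h.codimAt_le_one_iff] at hc ⊢
      obtain ⟨u, hu, hne⟩ := hc
      refine ⟨u, hu, ?_⟩
      change mink u (w + (z - z')) ≠ 0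
      rwa [mink_add_right, he u hu, add_zero]
    exact IsSolAt.comp τ.continuous τ.isOpenMap (AddMonoidHom.id A)
      (Eventually.of_forall fun v => h.jumpModel_eq_of_translate hN (hwt t) he h3 h2 hc v)
      (h1 (h.mem_tame h2 hc'))
  obtain ⟨ε, hε, hball⟩ := Metric.eventually_nhds_iff_ball.mp (hsol.and (h.isOpen.mem_nhds hz'))
  refine ⟨fun v => Φ (τ v), ?_⟩
  filter_upwards [Metric.ball_mem_nhds z' hε] with w hw hwt'
  exact isSolAt_of_codimAt_le_one (isSolAt_jumpModel hD hN (hwt t)) (finite_arrangement S)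
    (arrangement_ne_zero h.nondegenerate) (fun v hv hc => h.mem_tame (hball v hv).2 hc)
    Metric.isOpen_ball (fun v hv hc => (hball v hv).1 hc) hw hwt'

end BindingChart

end Binding

/-! ### The three linear conditions at a binding -/

section Codimension

open Module

variable {n : ℕ}

/-- `R` relates a weight to its possible defects and need not be the graph of a map. It is enough
that every weight has a defect and that defect zero forces membership in `K`. -/
lemma rank_quotient_le_of_relation {T A : Type} [AddCommGroup T] [Module ℝ T] [AddCommGroup A]
    [Module ℝ A] (R : Submodule ℝ (T × A)) (K : Submodule ℝ T) (htot : ∀ t, ∃ d, (t, d) ∈ R)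
    (hK : ∀ t, (t, 0) ∈ R → t ∈ K) : Module.rank ℝ (T ⧸ K) ≤ Module.rank ℝ A := by
  refine rank_le_of_ker_le (K.mkQ ∘ₗ LinearMap.fst ℝ T A ∘ₗ R.subtype)
    (LinearMap.snd ℝ T A ∘ₗ R.subtype) ?_ ?_
  · intro q
    obtain ⟨t, rfl⟩ := K.mkQ_surjective q
    obtain ⟨d, hd⟩ := htot t
    exact ⟨⟨(t, d), hd⟩, rfl⟩
  · rintro ⟨⟨t, d⟩, htd⟩ hd
    have hd0 : d = 0 := hd
    subst hd0
    rw [LinearMap.mem_ker]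
    exact (Submodule.Quotient.mk_eq_zero _).mpr (hK t htd)

lemma halfIndicator_add {V A : Type*} [NormedAddCommGroup V] [NormedSpace ℝ V] [AddCommGroup A]
    (f : Dual ℝ V) (d d' : A) :
    halfIndicator f (d + d') = halfIndicator f d + halfIndicator f d' := by
  funext z
  simp only [halfIndicator, Pi.add_apply]
  split_ifs <;> simp

lemma halfIndicator_smul {V A : Type*} [NormedAddCommGroup V] [NormedSpace ℝ V] [AddCommGroup A]
    [Module ℝ A] (f : Dual ℝ V) (c : ℝ) (d : A) :
    halfIndicator f (c • d) = c • halfIndicator f d := by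
  funext z
  simp only [halfIndicator, Pi.smul_apply]
  split_ifs <;> simp

lemma halfIndicator_zero {V A : Type*} [NormedAddCommGroup V] [NormedSpace ℝ V] [AddCommGroup A]
    (f : Dual ℝ V) : halfIndicator f (0 : A) = 0 := by
  funext z
  simp [halfIndicator]

/-- The weights and the defects along the half-plane `f = 0`, `g < 0` of the solutions of the jump
problem off that half-plane. -/
def defectRelation {T A : Type*} [AddCommGroup T] [Module ℝ T] [AddCommGroup A] [Module ℝ A]
    (D : Set (Hyp n)) (N : Hyp n → Vec n) (β : Vec n → A) (wt : T →ₗ[ℝ] Hyp n → ℝ)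
    (f g : Dual ℝ (Vec n)) (B : Set (Vec n)) : Submodule ℝ (T × A) where
  carrier := {p | ∃ Φ : Vec n → A,
    (∀ y ∈ B, ¬ (f y = 0 ∧ g y ≤ 0) → IsSolAt (jumpModel D N β (wt p.1)) Φ y) ∧
    ∀ y ∈ B, f y = 0 ∧ g y < 0 →
      IsSolAt (jumpModel D N β (wt p.1)) (Φ + halfIndicator f p.2) y}
  zero_mem' := by
    have h : jumpModel D N β (wt (0 : T × A).1) = 0 := by
      rw [Prod.fst_zero, map_zero, ← zero_smul ℝ (0 : Hyp n → ℝ), jumpModel_smul, zero_smul]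
    refine ⟨0, fun y _ _ => ?_, fun y _ _ => ?_⟩
    · rw [h]; exact IsSolAt.zero y
    · rw [h, Prod.snd_zero, halfIndicator_zero, add_zero]; exact IsSolAt.zero y
  add_mem' := by
    rintro ⟨t, d⟩ ⟨t', d'⟩ ⟨Φ, h1, h2⟩ ⟨Φ', h1', h2'⟩
    refine ⟨Φ + Φ', fun y hy hf => ?_, fun y hy hf => ?_⟩
    · rw [Prod.mk_add_mk, map_add, jumpModel_add]
      exact (h1 y hy hf).add (h1' y hy hf)
    · rw [Prod.mk_add_mk, map_add, jumpModel_add, halfIndicator_add, add_add_add_comm]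
      exact (h2 y hy hf).add (h2' y hy hf)
  smul_mem' := by
    rintro c ⟨t, d⟩ ⟨Φ, h1, h2⟩
    refine ⟨c • Φ, fun y hy hf => ?_, fun y hy hf => ?_⟩
    · rw [Prod.smul_mk, map_smul, jumpModel_smul]
      exact (h1 y hy hf).smul c
    · rw [Prod.smul_mk, map_smul, jumpModel_smul, halfIndicator_smul, ← smul_add]
      exact (h2 y hy hf).smul c

namespace BindingChart

variable {D : Set (Hyp n)} {E : Submodule ℝ (Vec n)} {S : Finset (Vec n × Finset (Vec n))}
  {B : Set (Vec n)} {T : Type} [AddCommGroup T] [Module ℝ T] {N : Hyp n → Vec n}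
  {wt : T →ₗ[ℝ] Hyp n → ℝ}

lemma codimAt_le_one_of_ne (h : BindingChart D E S B) {v b z : Vec n} (hv : v ∈ E) (hb : b ∈ E)
    (hz : ¬ (mink v z = 0 ∧ mink b z = 0)) : codimAt (arrangement S) z ≤ 1 := by
  rw [h.codimAt_le_one_iff]
  by_cases hvz : mink v z = 0
  · exact ⟨b, hb, fun hbz => hz ⟨hvz, hbz⟩⟩
  · exact ⟨v, hv, hvz⟩

/-- Off the binding the jump problem can be solved up to a defect along a half-plane. -/
lemma exists_defect (h : BindingChart D E S B) (hD : IsPiecewiseGeodesic D)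
    (hN : IsConormalField D N) (hwt : ∀ t, LocConstAlong D (wt t)) {A : Type*} [AddCommGroup A]
    [Module ℝ A] (β : Vec n → A) {v b : Vec n} (hv : v ∈ E) (hb : b ∈ E) (hv0 : v ≠ 0) (t : T) :
    ∃ d, (t, d) ∈ defectRelation D N β wt (minkForm n v) (minkForm n b) B := by
  have hcons := isSolAt_jumpModel (β := β) hD hN (hwt t)
  set Ψ := jumpModel D N β (wt t) with hΨ
  have hhalf : ∀ f : Dual ℝ (Vec n), (∀ z, 0 < f z → mink v z ≠ 0) →
      ∃ Φ : Vec n → A, ∀ y ∈ B ∩ {x | 0 < f x}, y ∈ tame D → IsSolAt Ψ Φ y := by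
    intro f hf
    refine Adapted.exists_isSolAt (𝓕 := arrangement S) hcons ?_ (h.isOpen.inter (isOpen_pos f))
      (h.convex.inter (convex_pos f))
    refine adapted_of_hasModel h.nondegenerate (fun z hz => h.subset_cone hz.1)
      (fun z hz => h.hasModel z hz.1) fun z hz _ => ?_
    exact locSolvable_of_mem_tame hD hN (hwt t) (h.mem_tame hz.1
      (h.codimAt_le_one_of_ne hv hv fun h' => hf z hz.2 h'.1))
  obtain ⟨Φ, hΦ⟩ := exists_isSolAt_off_hyperplane (Ψ := Ψ) (U := B) (P := (· ∈ tame D))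
    (minkForm n v) (hhalf _ fun z hz => ne_of_gt hz) (hhalf _ fun z hz h' => by
      simp only [LinearMap.neg_apply, minkForm_apply, h', neg_zero, lt_irrefl] at hz)
  have hf0 := minkForm_ne_zero hv0
  have hlin : ∀ z ∈ B, codimAt (arrangement S) z ≤ 1 → z ∈ tame D := fun z hz hc =>
    h.mem_tame hz hc
  have hplane : Convex ℝ {x : Vec n | minkForm n v x = 0} :=
    convex_hyperplane (minkForm n v).isLinear 0
  -- The hyperplane of `v` minus the binding consists of two convex halves, given by the sign of
  -- `b`. The first gluing, with `d₁`, repairs the half `b > 0` and uses up the freedom in the two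
  -- sides; the constant `d₂` still required on the half `b < 0` is the defect.
  have hglue : ∀ (Φ : Vec n → A) (g : Dual ℝ (Vec n)), (∀ z, 0 < g z → mink b z ≠ 0) →
      (∀ y ∈ B, codimAt (arrangement S) y ≤ 1 → minkForm n v y ≠ 0 → IsSolAt Ψ Φ y) →
      ∃ d, ∀ x ∈ B, minkForm n v x = 0 → 0 < g x →
        IsSolAt Ψ (Φ + halfIndicator (minkForm n v) d) x := by
    intro Φ g hg hΦ
    have hKc : ∀ x ∈ B ∩ {x | minkForm n v x = 0} ∩ {x | 0 < g x},
        codimAt (arrangement S) x ≤ 1 := fun x hx =>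
      h.codimAt_le_one_of_ne hv hb fun h' => hg x hx.2 h'.2
    obtain ⟨d, hd⟩ := exists_glue (Ψ := Ψ) (finite_arrangement S)
      (arrangement_ne_zero h.nondegenerate) hlin h.isOpen hf0 hΦ
      (K := B ∩ {x | minkForm n v x = 0} ∩ {x | 0 < g x})
      ((h.convex.inter hplane).inter (convex_pos g)).isPreconnected
      (fun x hx => hx.1) (fun x hx => locSolvable_of_mem_tame hD hN (hwt t)
        (h.mem_tame hx.1.1 (hKc x hx)))
    exact ⟨d, fun x hx hfx hgx =>
      (hd x ⟨⟨hx, hfx⟩, hgx⟩).self_of_nhds (hKc x ⟨⟨hx, hfx⟩, hgx⟩)⟩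
  obtain ⟨d₁, hd₁⟩ := hglue Φ (minkForm n b) (fun z hz => ne_of_gt hz)
    (fun y hy hc => hΦ y hy (hlin y hy hc))
  have hoff : ∀ y ∈ B, minkForm n v y ≠ 0 →
      IsSolAt Ψ (Φ + halfIndicator (minkForm n v) d₁) y := fun y hy hfy =>
    halfIndicator_congr_of_ne hfy (hΦ y hy (hlin y hy
      (h.codimAt_le_one_of_ne hv hv fun h' => hfy h'.1)) hfy)
  obtain ⟨d₂, hd₂⟩ := hglue (Φ + halfIndicator (minkForm n v) d₁) (-minkForm n b)
    (fun z hz h' => by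
      simp only [LinearMap.neg_apply, minkForm_apply, h', neg_zero, lt_irrefl] at hz)
    (fun y hy _ hfy => hoff y hy hfy)
  refine ⟨d₂, Φ + halfIndicator (minkForm n v) d₁, fun y hy hy' => ?_, fun y hy hy' => ?_⟩
  · by_cases hfy : minkForm n v y = 0
    · exact hd₁ y hy hfy (not_le.mp fun hle => hy' ⟨hfy, hle⟩)
    · exact hoff y hy hfy
  · exact hd₂ y hy hy'.1 (by simpa using hy'.2)

/-- Without defect, the jump problem is solved near the binding. -/
lemma mem_solvableWeights_of_defect_zero (h : BindingChart D E S B) (hD : IsPiecewiseGeodesic D)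
    (hN : IsConormalField D N) (hwt : ∀ t, LocConstAlong D (wt t)) {A A' : Type*}
    [AddCommGroup A] [Module ℝ A] [AddCommGroup A'] [Module ℝ A'] {β : Vec n → A}
    {β' : Vec n → A'} (α : A →ₗ[ℝ] A') (hα : ∀ u ∈ E, α (β u) = β' u) {v b : Vec n} (hv : v ∈ E)
    (hb : b ∈ E) (hvb : LinearIndependent ℝ ![v, b]) {t : T}
    (ht : (t, 0) ∈ defectRelation D N β wt (minkForm n v) (minkForm n b) B) {z : Vec n}
    (hz : z ∈ B) : t ∈ solvableWeights D N β' wt z := by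
  obtain ⟨Φ, h1, h2⟩ := ht
  simp only [halfIndicator_zero, add_zero] at h2
  have hsol : ∀ y ∈ B, codimAt (arrangement S) y ≤ 1 →
      IsSolAt (jumpModel D N β (wt t)) Φ y := by
    intro y hy hc
    rw [h.codimAt_le_one_iff] at hc
    obtain ⟨u, hu, hne⟩ := hc
    obtain ⟨p, q, rfl⟩ := exists_coords h.finrank_eq hv hb hvb hu
    by_cases hf : minkForm n v y = 0
    · rcases lt_trichotomy (minkForm n b y) 0 with hg | hg | hg
      · exact h2 y hy ⟨hf, hg⟩
      · refine absurd ?_ hne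
        rw [minkForm_apply] at hf hg
        rw [mink_add_left, mink_smul_left, mink_smul_left, hf, hg]
        ring
      · exact h1 y hy fun h' => h'.2.not_gt hg
    · exact h1 y hy fun h' => hf h'.1
  refine ⟨fun w => α (Φ w), ?_⟩
  filter_upwards [h.isOpen.mem_nhds hz] with y hy hyt
  refine isSolAt_of_codimAt_le_one (isSolAt_jumpModel hD hN (hwt t)) (finite_arrangement S)
    (arrangement_ne_zero h.nondegenerate) (fun v hv hc => h.mem_tame hv hc) h.isOpen
    (fun y hy hc => ?_) hy hyt
  -- The solution found with values in the small space `A` is pushed into `A'`; the models match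
  -- because the conormals lie in `E`.
  refine IsSolAt.comp (h := id) continuous_id IsOpenMap.id α.toAddMonoidHom
    (Eventually.of_forall fun w => ?_) (hsol y hy hc)
  simp only [jumpModel, id]
  split_ifs with hr
  · simp [hα _ (h.conormal_mem hN hy hc hr.1)]
  · simp

/-- The jump problem imposes at most three conditions at a binding. -/
lemma rank_quotient_le (h : BindingChart D E S B) (hD : IsPiecewiseGeodesic D)
    (hN : IsConormalField D N) (hwt : ∀ t, LocConstAlong D (wt t)) {z : Vec n} (hz : z ∈ B) :
    Module.rank ℝ (T ⧸ solvableWeights D N bend wt z) ≤ 3 := by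
  classical
  obtain ⟨s, hs, b, hbs, hvb⟩ := h.exists_pair
  set v := s.1
  have hv : v ∈ E := (h.mem_plane s hs).1
  have hb : b ∈ E := (h.mem_plane s hs).2 b hbs
  -- The problem is solved with values in `bendPlane` itself, so the defect is automatically in a
  -- space of dimension at most three. The default value zero is never met for `u ∈ E`.
  set β : Vec n → bendPlane v b := fun u =>
    if hu : bend u ∈ bendPlane v b then ⟨bend u, hu⟩ else 0 with hβ
  have hα : ∀ u ∈ E, (bendPlane v b).subtype (β u) = bend u := by
    intro u hu
    obtain ⟨p, q, rfl⟩ := exists_coords h.finrank_eq hv hb hvb hu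
    simp only [hβ, dif_pos (bend_mem_bendPlane v b p q)]
    rfl
  set R := defectRelation D N β wt (minkForm n v) (minkForm n b) B with hR
  refine le_trans ?_ (rank_bendPlane_le v b)
  refine rank_quotient_le_of_relation R _ (fun t => h.exists_defect hD hN hwt β hv hb
    (hvb.ne_zero 0) t) fun t ht => ?_
  exact h.mem_solvableWeights_of_defect_zero hD hN hwt (bendPlane v b).subtype hα hv hb hvb ht hz

end BindingChart

end Codimension

/-! ### Walls and bindings of a branched hypersurface -/

section Manifold

open Module

variable {n : ℕ} {Γ : Subgroup (OPlus n)}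

lemma proj_smul {γ : OPlus n} (hγ : γ ∈ Γ) (x : Hyp n) : proj Γ (γ • x) = proj Γ x :=
  Quotient.sound ⟨⟨γ, hγ⟩, rfl⟩

lemma exists_smul_eq_of_proj_eq {x y : Hyp n} (h : proj Γ x = proj Γ y) :
    ∃ γ ∈ Γ, γ • y = x := by
  obtain ⟨γ, hγ⟩ := Quotient.exact h
  exact ⟨γ.1, γ.2, hγ⟩

instance : ContinuousConstSMul Γ (Hyp n) where
  continuous_const_smul γ := continuous_const_smul (γ : OPlus n)

lemma continuous_proj : Continuous (proj Γ) := continuous_quotient_mk'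

lemma isOpenMap_proj : IsOpenMap (proj Γ) := isOpenMap_quotient_mk'_mul

variable {Δ : Set (Mfd Γ)}

lemma smul_mem_lift_iff {γ : OPlus n} (hγ : γ ∈ Γ) {x : Hyp n} :
    γ • x ∈ lift Δ ↔ x ∈ lift Δ := by
  change proj Γ (γ • x) ∈ Δ ↔ proj Γ x ∈ Δ
  rw [proj_smul hγ]

lemma mink_mulVec_left (g : OPlus n) (x y : Vec n) :
    mink (g.val.val.mulVec x) y = mink x ((g⁻¹).val.val.mulVec y) := by
  rw [← mink_mulVec_mulVec g x, mulVec_mulVec_inv]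

lemma smul_mem_regularPoints {γ : OPlus n} (hγ : γ ∈ Γ) {x : Hyp n}
    (hx : x ∈ regularPoints (lift Δ)) : γ • x ∈ regularPoints (lift Δ) := by
  obtain ⟨v, hv0, hvx, hv⟩ := hx
  refine ⟨γ.val.val.mulVec v, fun h => hv0 ?_, ?_, ?_⟩
  · rw [← mulVec_inv_mulVec γ v, h, Matrix.mulVec_zero]
  · rw [smul_val, mink_mulVec_mulVec, hvx]
  · have hc : Tendsto (fun y => γ⁻¹ • y) (𝓝 (γ • x)) (𝓝 x) := by
      have := (continuous_const_smul (γ⁻¹) : Continuous fun y : Hyp n => γ⁻¹ • y).tendsto (γ • x)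
      rwa [inv_smul_smul] at this
    filter_upwards [hc.eventually hv] with y hy
    rw [← smul_mem_lift_iff (Γ.inv_mem hγ), hy, smul_val, mink_mulVec_left]

lemma smul_mem_regularPoints_iff {γ : OPlus n} (hγ : γ ∈ Γ) {x : Hyp n} :
    γ • x ∈ regularPoints (lift Δ) ↔ x ∈ regularPoints (lift Δ) := by
  refine ⟨fun h => ?_, smul_mem_regularPoints hγ⟩
  have := smul_mem_regularPoints (Γ.inv_mem hγ) h
  rwa [inv_smul_smul] at this

/-- Regularity is `Γ`-invariant, so it can be tested on any lift. -/
lemma proj_mem_iff {x : Hyp n} :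
    proj Γ x ∈ Δ \ branchLocus Δ ↔ x ∈ regularPoints (lift Δ) := by
  constructor
  · rintro ⟨h1, h2⟩
    by_contra hx
    exact h2 ⟨x, ⟨h1, hx⟩, rfl⟩
  · intro hx
    refine ⟨mem_of_mem_regularPoints hx, ?_⟩
    rintro ⟨y, ⟨_, hy⟩, hyx⟩
    obtain ⟨γ, hγ, rfl⟩ := exists_smul_eq_of_proj_eq hyx
    exact hy (smul_mem_regularPoints hγ hx)

lemma mulVec_mem_tame {γ : OPlus n} (hγ : γ ∈ Γ) {z : Vec n} (hz : z ∈ tame (lift Δ)) :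
    γ.val.val.mulVec z ∈ tame (lift Δ) := by
  refine ⟨mulVec_mem_cone γ hz.1, ?_⟩
  rw [toHyp_mulVec γ hz.1, smul_mem_lift_iff hγ, smul_mem_regularPoints_iff hγ]
  exact hz.2

open Classical in
/-- The wall that contains a point of `M`, if any. -/
def wallAt (Δ : Set (Mfd Γ)) (m : Mfd Γ) : Option (Walls Δ) :=
  if h : m ∈ Δ \ branchLocus Δ then some (ConnectedComponents.mk ⟨m, h⟩) else none

lemma connectedComponents_mk_eq {X : Type*} [TopologicalSpace X] {Y C : Set X}
    (hC : IsPreconnected C) (hCY : C ⊆ Y) {a b : X} (ha : a ∈ C) (hb : b ∈ C) :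
    ConnectedComponents.mk (⟨a, hCY ha⟩ : Y) = ConnectedComponents.mk ⟨b, hCY hb⟩ := by
  rw [ConnectedComponents.coe_eq_coe']
  have hpre : IsPreconnected ((Subtype.val : Y → X) ⁻¹' C) := by
    rw [← Topology.IsInducing.subtypeVal.isPreconnected_image, Subtype.image_preimage_coe,
      Set.inter_eq_right.mpr hCY]
    exact hC
  have ha' : (⟨a, hCY ha⟩ : Y) ∈ (Subtype.val : Y → X) ⁻¹' C := ha
  have hb' : (⟨b, hCY hb⟩ : Y) ∈ (Subtype.val : Y → X) ⁻¹' C := hb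
  exact hpre.subset_connectedComponent hb' ha'

lemma locConstAlong_wallAt : LocConstAlong (lift Δ) fun x => wallAt Δ (proj Γ x) := by
  intro x hx
  obtain ⟨v, hv⟩ := id hx
  have hxc := hyp_mem_cone x
  have hev := (tendsto_toHyp hxc).eventually
    (show ∀ᶠ y in 𝓝 (toHyp x.val), (y ∈ lift Δ ↔ mink v y.val = 0) ∧
        (y ∈ lift Δ → y ∈ regularPoints (lift Δ)) by
      rw [toHyp_coe]; exact hv.2.2.and (eventually_mem_regularPoints hx))
  obtain ⟨ε, hε, hball⟩ := Metric.eventually_nhds_iff_ball.mp (hev.and (eventually_mem_cone hxc))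
  -- Near `x` the preimage of `Δ` is a convex slice of a hyperplane, and its projection is a
  -- connected set of regular points, hence inside one wall.
  set P := Metric.ball x.val ε ∩ {z | minkForm n v z = 0} with hP
  have hPc : IsPreconnected P :=
    ((convex_ball _ _).inter (convex_hyperplane (minkForm n v).isLinear 0)).isPreconnected
  have hPcone : P ⊆ cone n := fun z hz => (hball z hz.1).2
  have hC : IsPreconnected ((fun z => proj Γ (toHyp z)) '' P) :=
    hPc.image _ (continuous_proj.comp_continuousOn (continuousOn_toHyp.mono hPcone))
  have hCY : (fun z => proj Γ (toHyp z)) '' P ⊆ Δ \ branchLocus Δ := by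
    rintro _ ⟨z, hz, rfl⟩
    refine proj_mem_iff.mpr ((hball z hz.1).1.2 ?_)
    rw [(hball z hz.1).1.1, mink_toHyp_eq_zero (hPcone hz)]
    exact hz.2
  filter_upwards [continuous_subtype_val.continuousAt.eventually (Metric.ball_mem_nhds x.val hε)]
    with y hy hyD
  have hmem : ∀ y : Hyp n, y.val ∈ Metric.ball x.val ε → y ∈ lift Δ →
      proj Γ y ∈ (fun z => proj Γ (toHyp z)) '' P := by
    intro y hy hyD
    refine ⟨y.val, ⟨hy, ?_⟩, by simp only [toHyp_coe]⟩
    have := (hball y.val hy).1.1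
    rw [toHyp_coe] at this
    exact this.mp hyD
  have hy' := hmem y hy hyD
  have hx' := hmem x (Metric.mem_ball_self hε) (mem_of_mem_regularPoints hx)
  simp only [wallAt, dif_pos (hCY hy'), dif_pos (hCY hx')]
  exact congrArg some (connectedComponents_mk_eq hC hCY hy' hx')

lemma exists_wallAt_eq (w : Walls Δ) :
    ∃ x ∈ regularPoints (lift Δ), wallAt Δ (proj Γ x) = some w := by
  obtain ⟨⟨m, hm⟩, rfl⟩ := ConnectedComponents.surjective_coe w
  obtain ⟨x, rfl⟩ := Quotient.exists_rep m
  exact ⟨x, proj_mem_iff.mp hm, dif_pos hm⟩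

/-- Lindelöf: the wall through a regular point is locally constant, and countably many neighborhoods
cover the regular points. -/
lemma countable_walls : Countable (Walls Δ) := by
  obtain ⟨t, -, htc, hcov⟩ := TopologicalSpace.countable_cover_nhdsWithin
    (f := fun x : Hyp n => {y | y ∈ lift Δ → wallAt Δ (proj Γ y) = wallAt Δ (proj Γ x)})
    (s := regularPoints (lift Δ))
    fun x hx => mem_nhdsWithin_of_mem_nhds (locConstAlong_wallAt x hx)
  have hsurj : (Set.univ : Set (Walls Δ)) ⊆
      some ⁻¹' ((fun x => wallAt Δ (proj Γ x)) '' t) := by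
    intro w _
    obtain ⟨x, hx, hxw⟩ := exists_wallAt_eq w
    obtain ⟨y, hy, hyx⟩ := Set.mem_iUnion₂.mp (hcov hx)
    exact ⟨y, hy, (hyx (mem_of_mem_regularPoints hx)).symm.trans hxw⟩
  exact Set.countable_univ_iff.mp
    (((htc.image _).preimage (Option.some_injective _)).mono hsurj)

/-- The weight of the wall through a point. -/
def wallWeight (Δ : Set (Mfd Γ)) : (Walls Δ →₀ ℝ) →ₗ[ℝ] Hyp n → ℝ where
  toFun t x := (wallAt Δ (proj Γ x)).elim 0 t
  map_add' t t' := by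
    funext x
    simp only [Pi.add_apply]
    cases wallAt Δ (proj Γ x) <;> simp
  map_smul' c t := by
    funext x
    simp only [Pi.smul_apply]
    cases wallAt Δ (proj Γ x) <;> simp

lemma wallWeight_apply (t : Walls Δ →₀ ℝ) (x : Hyp n) :
    wallWeight Δ t x = (wallAt Δ (proj Γ x)).elim 0 t := rfl

lemma locConstAlong_wallWeight (t : Walls Δ →₀ ℝ) : LocConstAlong (lift Δ) (wallWeight Δ t) := by
  intro x hx
  filter_upwards [locConstAlong_wallAt x hx] with y hy hyD
  rw [wallWeight_apply, wallWeight_apply, hy hyD]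

variable {N : Hyp n → Vec n}

/-- The conormal field is invariant under the group. -/
def IsEquivariantField (Δ : Set (Mfd Γ)) (N : Hyp n → Vec n) : Prop :=
  ∀ x ∈ regularPoints (lift Δ), ∀ γ ∈ Γ, N (γ • x) = γ.val.val.mulVec (N x)

lemma jumpModel_mulVec (hNΓ : IsEquivariantField Δ N) (t : Walls Δ →₀ ℝ) {γ : OPlus n}
    (hγ : γ ∈ Γ) {z : Vec n} (hz : z ∈ cone n) (w : Vec n) :
    jumpModel (lift Δ) N bend (wallWeight Δ t) (γ.val.val.mulVec z) (γ.val.val.mulVec w) =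
      adNu n γ (jumpModel (lift Δ) N bend (wallWeight Δ t) z w) := by
  have hr : toHyp (γ.val.val.mulVec z) ∈ regularPoints (lift Δ) ↔
      toHyp z ∈ regularPoints (lift Δ) := by
    rw [toHyp_mulVec γ hz, smul_mem_regularPoints_iff hγ]
  by_cases h : toHyp z ∈ regularPoints (lift Δ) ∧ 0 < mink (N (toHyp z)) w
  · have hN := hNΓ _ h.1 γ hγ
    rw [jumpModel, jumpModel, if_pos h, if_pos, map_smul, adNu_bend, toHyp_mulVec γ hz, hN,
      wallWeight_apply, wallWeight_apply, proj_smul hγ]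
    exact ⟨hr.mpr h.1, by rw [toHyp_mulVec γ hz, hN, mink_mulVec_mulVec]; exact h.2⟩
  · rw [jumpModel, jumpModel, if_neg h, if_neg, map_zero]
    rintro ⟨h1, h2⟩
    rw [toHyp_mulVec γ hz, hNΓ _ (hr.mp h1) γ hγ, mink_mulVec_mulVec] at h2
    exact h ⟨hr.mp h1, h2⟩

/-- Solutions are transported by the group. -/
lemma isSolAt_transport (hNΓ : IsEquivariantField Δ N) {t : Walls Δ →₀ ℝ} {γ : OPlus n}
    (hγ : γ ∈ Γ) {Φ : Vec n → nu n} {z : Vec n} (hz : z ∈ cone n)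
    (h : IsSolAt (jumpModel (lift Δ) N bend (wallWeight Δ t)) Φ ((γ⁻¹).val.val.mulVec z)) :
    IsSolAt (jumpModel (lift Δ) N bend (wallWeight Δ t))
      (fun w => adNu n γ (Φ ((γ⁻¹).val.val.mulVec w))) z := by
  refine IsSolAt.comp (h := isometryHomeo γ⁻¹) (isometryHomeo γ⁻¹).continuous
    (isometryHomeo γ⁻¹).isOpenMap (adNu n γ).toAddMonoidHom (Eventually.of_forall fun w => ?_) h
  have := jumpModel_mulVec hNΓ t hγ (mulVec_mem_cone γ⁻¹ hz) ((γ⁻¹).val.val.mulVec w)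
  rw [mulVec_mulVec_inv, mulVec_mulVec_inv] at this
  exact this

lemma solvableWeights_le_mulVec (hNΓ : IsEquivariantField Δ N) {γ : OPlus n} (hγ : γ ∈ Γ)
    (z : Vec n) : solvableWeights (lift Δ) N bend (wallWeight Δ) z ≤
      solvableWeights (lift Δ) N bend (wallWeight Δ) (γ.val.val.mulVec z) := by
  rintro t ⟨Φ, hΦ⟩
  refine ⟨fun w => adNu n γ (Φ ((γ⁻¹).val.val.mulVec w)), ?_⟩
  have htend : Tendsto (isometryHomeo γ⁻¹) (𝓝 (γ.val.val.mulVec z)) (𝓝 z) := by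
    have := (isometryHomeo γ⁻¹).continuous.tendsto (γ.val.val.mulVec z)
    rwa [isometryHomeo_apply, mulVec_inv_mulVec] at this
  filter_upwards [htend.eventually hΦ] with y hy hyt
  exact isSolAt_transport hNΓ hγ hyt.1 (hy (mulVec_mem_tame (Γ.inv_mem hγ) hyt))

/-- The solvable weights at a point of hyperbolic space. -/
def weightsAt (Δ : Set (Mfd Γ)) (N : Hyp n → Vec n) (x : Hyp n) : Submodule ℝ (Walls Δ →₀ ℝ) :=
  solvableWeights (lift Δ) N bend (wallWeight Δ) x.val

lemma weightsAt_smul (hNΓ : IsEquivariantField Δ N) {γ : OPlus n} (hγ : γ ∈ Γ) (x : Hyp n) :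
    weightsAt Δ N (γ • x) = weightsAt Δ N x := by
  refine le_antisymm ?_ (solvableWeights_le_mulVec hNΓ hγ x.val)
  have := solvableWeights_le_mulVec hNΓ (Γ.inv_mem hγ) (γ • x).val
  rwa [smul_val, mulVec_inv_mulVec] at this

lemma weightsAt_eq_of_proj_eq (hNΓ : IsEquivariantField Δ N) {x y : Hyp n}
    (h : proj Γ x = proj Γ y) : weightsAt Δ N x = weightsAt Δ N y := by
  obtain ⟨γ, hγ, rfl⟩ := exists_smul_eq_of_proj_eq h
  exact weightsAt_smul hNΓ hγ y

lemma not_mem_tame_of_mem_bindingPoints {D : Set (Hyp n)} {x : Hyp n}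
    (hx : x ∈ bindingPoints D) : x.val ∉ tame D := by
  rintro ⟨_, h | h⟩
  · rw [toHyp_coe] at h
    obtain ⟨hreg, E, hE, hEx, S, ⟨s, hs⟩, hS, hev⟩ := hx
    exact h (hev.self_of_nhds.mpr ⟨s, hs, hEx _ (hS s hs).1, (hEx _ (hS s hs).2.1).ge⟩)
  · rw [toHyp_coe] at h
    exact hx.1 h

/-- The solvable weights are constant along a binding. -/
lemma weightsAt_eq_of_mk_eq (hD : IsPiecewiseGeodesic (lift Δ)) (hN : IsConormalField (lift Δ) N)
    (hNΓ : IsEquivariantField Δ N) {x y : Hyp n} (hx : x ∈ bindingPoints (lift Δ))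
    (hy : y ∈ bindingPoints (lift Δ))
    (h : (ConnectedComponents.mk ⟨proj Γ x, x, hx, rfl⟩ : Bindings Δ) =
      ConnectedComponents.mk ⟨proj Γ y, y, hy, rfl⟩) : weightsAt Δ N x = weightsAt Δ N y := by
  -- The solvable weights descend to `M`, since any two lifts of a point have the same ones. A
  -- locally constant function is then constant on connected components.
  set κ : bindingLocus Δ → Submodule ℝ (Walls Δ →₀ ℝ) := fun m => weightsAt Δ N m.2.choose with hκ
  have hκx : ∀ x (hx : x ∈ bindingPoints (lift Δ)),
      κ ⟨proj Γ x, x, hx, rfl⟩ = weightsAt Δ N x := fun x hx =>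
    weightsAt_eq_of_proj_eq hNΓ
      (show ∃ y, y ∈ bindingPoints (lift Δ) ∧ proj Γ y = proj Γ x from ⟨x, hx, rfl⟩).choose_spec.2
  have hloc : IsLocallyConstant κ := by
    rw [IsLocallyConstant.iff_eventually_eq]
    rintro ⟨_, x, hx, rfl⟩
    obtain ⟨E, S, B, hB, hxB, hxE⟩ := exists_bindingChart hx
    have hO : IsOpen (proj Γ '' {y : Hyp n | y.val ∈ B}) :=
      isOpenMap_proj _ (hB.isOpen.preimage continuous_subtype_val)
    have hev : ∀ᶠ m : bindingLocus Δ in 𝓝 ⟨proj Γ x, x, hx, rfl⟩,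
        m.val ∈ proj Γ '' {y : Hyp n | y.val ∈ B} :=
      (hO.preimage continuous_subtype_val).mem_nhds ⟨x, hxB, rfl⟩
    filter_upwards [hev]
    rintro ⟨_, y', hy', rfl⟩ ⟨y, hyB, hyy'⟩
    rw [hκx x hx, hκx y' hy', ← weightsAt_eq_of_proj_eq hNΓ hyy']
    -- The lift `y` in the chart is a `Γ`-translate of a binding point, so it is not tame and lies
    -- on the codimension-two stratum of the chart.
    have hyt : y.val ∉ tame (lift Δ) := by
      intro hyt
      obtain ⟨γ, hγ, hγy⟩ := exists_smul_eq_of_proj_eq hyy'.symm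
      refine not_mem_tame_of_mem_bindingPoints hy' ?_
      rw [← hγy]
      exact mulVec_mem_tame hγ hyt
    have hyE := hB.mink_eq_zero_of_not_mem_tame hyB hyt
    exact le_antisymm
      (hB.solvableWeights_le hD hN locConstAlong_wallWeight hyB hxB hyE hxE)
      (hB.solvableWeights_le hD hN locConstAlong_wallWeight hxB hyB hxE hyE)
  rw [← hκx x hx, ← hκx y hy]
  rw [ConnectedComponents.coe_eq_coe'] at h
  exact hloc.apply_eq_of_isPreconnected isPreconnected_connectedComponent h mem_connectedComponent

/-- The weights for which the jump problem is solvable along all bindings. -/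
def globalWeights (Δ : Set (Mfd Γ)) (N : Hyp n → Vec n) : Submodule ℝ (Walls Δ →₀ ℝ) :=
  ⨅ x ∈ bindingPoints (lift Δ), weightsAt Δ N x

lemma rank_quotient_weightsAt_le (hD : IsPiecewiseGeodesic (lift Δ))
    (hN : IsConormalField (lift Δ) N) {x : Hyp n} (hx : x ∈ bindingPoints (lift Δ)) :
    Module.rank ℝ ((Walls Δ →₀ ℝ) ⧸ weightsAt Δ N x) ≤ 3 := by
  obtain ⟨E, S, B, hB, hxB, _⟩ := exists_bindingChart hx
  exact hB.rank_quotient_le hD hN locConstAlong_wallWeight hxB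

/-- Rank–nullity for the product of the maps `f i`. -/
lemma rank_le_rank_iInf_ker_add {T ι : Type} [Fintype ι] [AddCommGroup T] [Module ℝ T]
    {M : ι → Type} [∀ i, AddCommGroup (M i)] [∀ i, Module ℝ (M i)] (f : ∀ i, T →ₗ[ℝ] M i)
    (h : ∀ i, Module.rank ℝ (M i) ≤ 3) :
    Module.rank ℝ T ≤ Module.rank ℝ (⨅ i, LinearMap.ker (f i) : Submodule ℝ T) +
      3 * Cardinal.mk ι := by
  have hrange : Module.rank ℝ (LinearMap.range (LinearMap.pi f)) ≤ 3 * Cardinal.mk ι := by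
    refine (Submodule.rank_le _).trans ?_
    rw [rank_pi]
    refine (Cardinal.sum_le_sum _ (fun _ => 3) h).trans ?_
    rw [Cardinal.sum_const']
    exact (mul_comm _ _).le
  rw [← LinearMap.rank_range_add_rank_ker (LinearMap.pi f), LinearMap.ker_pi, add_comm]
  exact add_le_add_right hrange _

/-- Three conditions for each binding. -/
lemma mk_walls_le (hD : IsPiecewiseGeodesic (lift Δ)) (hN : IsConormalField (lift Δ) N)
    (hNΓ : IsEquivariantField Δ N) :
    Cardinal.mk (Walls Δ) ≤
      Module.rank ℝ (globalWeights Δ N) + 3 * Cardinal.mk (Bindings Δ) := by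
  rcases finite_or_infinite (Bindings Δ) with hfin | hinf
  · have := Fintype.ofFinite (Bindings Δ)
    have hrep : ∀ b : Bindings Δ, ∃ x, ∃ hx : x ∈ bindingPoints (lift Δ),
        ConnectedComponents.mk ⟨proj Γ x, x, hx, rfl⟩ = b := by
      intro b
      obtain ⟨⟨_, x, hx, rfl⟩, rfl⟩ := ConnectedComponents.surjective_coe b
      exact ⟨x, hx, rfl⟩
    choose p hp hpb using hrep
    have hker : ⨅ b, LinearMap.ker (weightsAt Δ N (p b)).mkQ = globalWeights Δ N := by
      simp only [Submodule.ker_mkQ]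
      refine le_antisymm (le_iInf₂ fun x hx => ?_) (le_iInf fun b => iInf₂_le _ (hp b))
      refine (iInf_le _ (ConnectedComponents.mk ⟨proj Γ x, x, hx, rfl⟩)).trans ?_
      rw [weightsAt_eq_of_mk_eq hD hN hNΓ (hp _) hx (hpb _)]
    have := rank_le_rank_iInf_ker_add (T := Walls Δ →₀ ℝ)
      (M := fun b => (Walls Δ →₀ ℝ) ⧸ weightsAt Δ N (p b)) (fun b => (weightsAt Δ N (p b)).mkQ)
      fun b => rank_quotient_weightsAt_le hD hN (hp b)
    rwa [rank_finsupp_self', hker] at this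
  -- With infinitely many bindings the second summand alone dominates the countably many walls.
  · have h1 : Cardinal.mk (Walls Δ) ≤ Cardinal.aleph0 :=
      Cardinal.mk_le_aleph0_iff.mpr countable_walls
    refine h1.trans ((Cardinal.aleph0_le_mk (Bindings Δ)).trans ?_)
    refine le_add_left (Cardinal.le_mul_left ?_)
    norm_num

end Manifold

/-! ### Boosts and the invariants of `ν` -/

section Invariants

variable {n : ℕ}

/-- The boost with parameters `(c, s)` in the plane spanned by the time axis and a space axis. -/
def boostMat (c s : ℝ) (k : Fin n) : Mat n :=
  1 + Matrix.vecMulVec (Pi.single 0 1) ((c - 1) • Pi.single 0 1 + s • Pi.single k.succ 1) +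
    Matrix.vecMulVec (Pi.single k.succ 1) ((c - 1) • Pi.single k.succ 1 + s • Pi.single 0 1)

lemma vecMulVec_mulVec_eq (u w x : Vec n) : (Matrix.vecMulVec u w).mulVec x = (w ⬝ᵥ x) • u := by
  ext i
  simp only [Matrix.mulVec, Matrix.vecMulVec_apply, dotProduct, Pi.smul_apply, smul_eq_mul]
  rw [Finset.sum_mul]
  exact Finset.sum_congr rfl fun j _ => by ring

lemma boostMat_mulVec (c s : ℝ) (k : Fin n) (x : Vec n) : (boostMat c s k).mulVec x =
    x + ((c - 1) * x 0 + s * x k.succ) • Pi.single 0 1 +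
      ((c - 1) * x k.succ + s * x 0) • Pi.single k.succ 1 := by
  rw [boostMat, Matrix.add_mulVec, Matrix.add_mulVec, Matrix.one_mulVec, vecMulVec_mulVec_eq,
    vecMulVec_mulVec_eq]
  simp [add_dotProduct]

lemma boostMat_mulVec_zero (c s : ℝ) (k : Fin n) (x : Vec n) :
    (boostMat c s k).mulVec x 0 = c * x 0 + s * x k.succ := by
  rw [boostMat_mulVec]
  simp [(Fin.succ_ne_zero k).symm]
  ring

lemma boostMat_mulVec_succ (c s : ℝ) (k : Fin n) (x : Vec n) :
    (boostMat c s k).mulVec x k.succ = c * x k.succ + s * x 0 := by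
  rw [boostMat_mulVec]
  simp
  ring

lemma mink_single_zero (x : Vec n) : mink x (Pi.single 0 1) = -x 0 := by
  simp [mink_eq_sum]

lemma mink_single_succ (x : Vec n) (k : Fin n) : mink x (Pi.single k.succ 1) = x k.succ := by
  rw [mink_eq_sum, Finset.sum_eq_single k]
  · simp [(Fin.succ_ne_zero k).symm]
  · intro i _ hi
    simp [hi]
  · simp

lemma mink_boostMat {c s : ℝ} (h : c ^ 2 - s ^ 2 = 1) (k : Fin n) (x y : Vec n) :
    mink ((boostMat c s k).mulVec x) ((boostMat c s k).mulVec y) = mink x y := by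
  have h1 := mink_single_zero (boostMat c s k |>.mulVec x)
  have h2 := mink_single_succ (boostMat c s k |>.mulVec x) k
  rw [boostMat_mulVec_zero] at h1
  rw [boostMat_mulVec_succ] at h2
  rw [boostMat_mulVec c s k y, mink_add_right, mink_add_right, mink_smul_right, mink_smul_right,
    h1, h2, mink_comm _ y, boostMat_mulVec, mink_add_right, mink_add_right, mink_smul_right,
    mink_smul_right, mink_single_zero, mink_single_succ, mink_comm y x]
  linear_combination (x k.succ * y k.succ - x 0 * y 0) * h

lemma boostMat_mul (c s c' s' : ℝ) (k : Fin n) : boostMat c s k * boostMat c' s' k =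
    boostMat (c * c' + s * s') (c * s' + s * c') k := by
  refine Matrix.ext_of_mulVec_single fun i => ?_
  rw [← Matrix.mulVec_mulVec, boostMat_mulVec c s, boostMat_mulVec_zero, boostMat_mulVec_succ,
    boostMat_mulVec c' s', boostMat_mulVec]
  module

lemma boostMat_one (k : Fin n) : boostMat 1 0 k = 1 := by
  simp [boostMat]

/-- The boost as an element of `O⁺(n,1)`. -/
def boost (k : Fin n) : OPlus n :=
  -- A rational point of `c ^ 2 - s ^ 2 = 1`; changing the sign of `s` inverts the boost.
  ⟨⟨boostMat (5 / 4) (3 / 4) k, boostMat (5 / 4) (-(3 / 4)) k,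
    by rw [boostMat_mul, ← boostMat_one k]; norm_num,
    by rw [boostMat_mul, ← boostMat_one k]; norm_num⟩, by
    have hform : ∀ x y : Vec n, mink ((boostMat (5 / 4) (3 / 4) k).mulVec x)
        ((boostMat (5 / 4) (3 / 4) k).mulVec y) = mink x y := mink_boostMat (by norm_num) k
    refine ⟨?_, fun x hx => ⟨by rw [hform]; exact hx.1, ?_⟩⟩
    · refine Matrix.ext_of_mulVec_single fun i => ?_
      refine dotProduct_eq _ _ fun y => ?_
      rw [dotProduct_comm, ← Matrix.mulVec_mulVec, ← Matrix.mulVec_mulVec, Matrix.dotProduct_mulVec,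
        Matrix.vecMul_transpose, dotProduct_comm _ y]
      exact hform y _
    · have hlt : x k.succ ^ 2 < x 0 ^ 2 := by
        have h1 := hx.1
        rw [mink_eq_sum] at h1
        have h2 := Finset.single_le_sum (f := fun i : Fin n => x i.succ * x i.succ)
          (fun i _ => mul_self_nonneg _) (Finset.mem_univ k)
        have h3 : x k.succ * x k.succ ≤ ∑ i : Fin n, x i.succ * x i.succ := h2
        nlinarith
      rw [boostMat_mulVec_zero]
      linarith [(abs_lt.mp (abs_lt_of_sq_lt_sq hlt hx.2.le)).1, hx.2]⟩

lemma det_sq_eq_one (g : OPlus n) : g.val.val.det * g.val.val.det = 1 := by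
  have h := congrArg Matrix.det g.prop.1
  rw [Matrix.det_mul, Matrix.det_mul, Matrix.det_transpose] at h
  have hJ : (J n).det * (J n).det = 1 := by rw [← Matrix.det_mul, J_mul_J, Matrix.det_one]
  have hJ0 : (J n).det ≠ 0 := left_ne_zero_of_mul_eq_one hJ
  exact mul_left_cancel₀ hJ0 (by linear_combination h)

/-- Passing to the square gives determinant one without computing the determinant of a boost. -/
lemma boost_sq_mem (k : Fin n) : boost k * boost k ∈ SOPlus n := by
  change ((boost k).val.val * (boost k).val.val).det = 1
  rw [Matrix.det_mul, det_sq_eq_one]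

lemma boost_sq_val (k : Fin n) :
    (boost k * boost k).val.val = boostMat (17 / 8) (15 / 8) k := by
  change boostMat (5 / 4) (3 / 4) k * boostMat (5 / 4) (3 / 4) k = _
  rw [boostMat_mul]
  norm_num

/-- An element of `ν` that commutes with the boosts is zero. -/
lemma nu_eq_zero_of_commute {a : nu n}
    (h : ∀ k : Fin n, boostMat (17 / 8) (15 / 8) k * a.val = a.val * boostMat (17 / 8) (15 / 8) k) :
    a = 0 := by
  obtain ⟨a, htr, hsa⟩ := a
  have hv : ∀ (k : Fin n) (x : Vec n), (boostMat (17 / 8) (15 / 8) k).mulVec (a.mulVec x) =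
      a.mulVec ((boostMat (17 / 8) (15 / 8) k).mulVec x) := fun k x => by
    rw [Matrix.mulVec_mulVec, Matrix.mulVec_mulVec, h k]
  have hentry : ∀ i j, a.mulVec (Pi.single j 1) i = a i j := fun i j => by simp
  have hself : ∀ k : Fin n, a k.succ 0 = -a 0 k.succ := by
    intro k
    have := congrFun (congrFun hsa 0) k.succ
    simpa [J, Fin.succ_ne_zero] using this
  -- Commutation makes the time-space entries symmetric and the diagonal constant. Self-adjointness
  -- makes the same entries antisymmetric, so they vanish, and the trace condition kills the
  -- diagonal.
  have htime : ∀ k : Fin n, a 0 k.succ = a k.succ 0 ∧ a k.succ k.succ = a 0 0 := by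
    intro k
    have h1 := hv k (Pi.single 0 1)
    rw [boostMat_mulVec _ _ _ (Pi.single 0 1)] at h1
    have h2 := congrFun h1 0
    have h3 := congrFun h1 k.succ
    rw [boostMat_mulVec_zero] at h2
    rw [boostMat_mulVec_succ] at h3
    simp only [Matrix.mulVec_add, Matrix.mulVec_smul, Pi.add_apply, Pi.smul_apply, hentry,
      Pi.single_eq_same, Pi.single_eq_of_ne (Fin.succ_ne_zero k), smul_eq_mul] at h2 h3
    constructor <;> linarith
  -- The boost fixes the basis vector of index `j.succ`, hence its image under `a`; but it has no
  -- nonzero fixed vector in the plane of the coordinates `0` and `k.succ`.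
  have hspace : ∀ k j : Fin n, j ≠ k → a k.succ j.succ = 0 := by
    intro k j hjk
    have h1 := hv k (Pi.single j.succ 1)
    have hne : (k.succ : Fin (n + 1)) ≠ j.succ := fun h => hjk (Fin.succ_injective _ h).symm
    have hfix : (boostMat (17 / 8) (15 / 8) k).mulVec (Pi.single j.succ 1) =
        (Pi.single j.succ 1 : Vec n) := by
      rw [boostMat_mulVec]
      simp [Pi.single_eq_of_ne hne]
    rw [hfix] at h1
    have h2 := congrFun h1 0
    have h3 := congrFun h1 k.succ
    rw [boostMat_mulVec_zero, hentry, hentry] at h2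
    rw [boostMat_mulVec_succ, hentry, hentry] at h3
    linarith
  have hoff : ∀ k : Fin n, a 0 k.succ = 0 ∧ a k.succ 0 = 0 := fun k => by
    have h1 := hself k
    have h2 := (htime k).1
    constructor <;> linarith
  have h00 : a 0 0 = 0 := by
    have h1 : a.trace = (n + 1) * a 0 0 := by
      rw [Matrix.trace, Fin.sum_univ_succ]
      simp only [Matrix.diag_apply, (htime _).2, Finset.sum_const, Finset.card_univ,
        Fintype.card_fin, nsmul_eq_mul]
      ring
    rw [htr] at h1
    have : (n : ℝ) + 1 ≠ 0 := by positivity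
    exact (mul_eq_zero.mp h1.symm).resolve_left this
  apply Subtype.ext
  ext i j
  change a i j = 0
  refine Fin.cases ?_ (fun k => ?_) i <;> refine Fin.cases ?_ (fun l => ?_) j
  · exact h00
  · exact (hoff l).1
  · exact (hoff k).2
  · by_cases hkl : l = k
    · rw [hkl, (htime k).2, h00]
    · exact hspace k l hkl

/-- A Zariski-dense set of isometries has no invariants in `ν`. -/
lemma eq_zero_of_zariskiDense {S : Set (OPlus n)} (hS : ZariskiDense S) {a : nu n}
    (ha : ∀ g ∈ S, adNu n g a = a) : a = 0 := by
  refine nu_eq_zero_of_commute fun k => ?_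
  ext i j
  -- The `(i, j)` entry of `g a - a g`, a linear polynomial in the entries of `g`.
  set p : MvPolynomial (Fin (n + 1) × Fin (n + 1)) ℝ :=
    ∑ l, (MvPolynomial.X (i, l) * MvPolynomial.C (a.val l j) -
      MvPolynomial.C (a.val i l) * MvPolynomial.X (l, j)) with hp
  have heval : ∀ g : OPlus n, MvPolynomial.eval (fun ij => g.val.val ij.1 ij.2) p =
      (g.val.val * a.val) i j - (a.val * g.val.val) i j := by
    intro g
    simp only [hp, map_sum, map_sub, map_mul, MvPolynomial.eval_X, MvPolynomial.eval_C,
      Finset.sum_sub_distrib, Matrix.mul_apply]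
  have h1 := hS p (fun g hg => by
    have h2 : g.val.val * a.val * (g⁻¹).val.val = a.val := congrArg Subtype.val (ha g hg)
    have h3 : g.val.val * a.val = a.val * g.val.val := by
      conv_rhs => rw [← h2]
      rw [Matrix.mul_assoc, val_inv_mul, Matrix.mul_one]
    rw [heval, h3, sub_self]) (boost k * boost k) (boost_sq_mem k)
  rw [heval, boost_sq_val] at h1
  exact sub_eq_zero.mp h1

end Invariants

/-- A linear correspondence with cocycles that detects coboundaries bounds the dimension of the
first cohomology from below. -/
lemma rank_le_rank_H1 {G V T : Type} [Group G] [AddCommGroup V] [Module ℝ V]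
    (ρ : Representation ℝ G V) [AddCommGroup T] [Module ℝ T] (R : Submodule ℝ (T × (G → V)))
    (hcoc : ∀ p ∈ R, ∀ g h, p.2 (g * h) = ρ g (p.2 h) + p.2 g) (htot : ∀ t, ∃ c, (t, c) ∈ R)
    (hinj : ∀ t v, (t, fun g => ρ g v - v) ∈ R → t = 0) :
    Module.rank ℝ T ≤ Module.rank ℝ (groupCohomology.H1 (Rep.of ρ)) := by
  let c : R →ₗ[ℝ] groupCohomology.cocycles₁ (Rep.of ρ) :=
    { toFun := fun p => ⟨p.1.2, (groupCohomology.mem_cocycles₁_iff _).mpr (hcoc p.1 p.2)⟩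
      map_add' := fun p q => rfl
      map_smul' := fun a p => rfl }
  refine rank_le_of_ker_le (LinearMap.fst ℝ T (G → V) ∘ₗ R.subtype)
    ((groupCohomology.H1π (Rep.of ρ)).hom ∘ₗ c) (fun t => ?_) ?_
  · obtain ⟨d, hd⟩ := htot t
    exact ⟨⟨(t, d), hd⟩, rfl⟩
  · rintro ⟨⟨t, d⟩, htd⟩ hp
    have h1 := (groupCohomology.H1π_eq_zero_iff (c ⟨(t, d), htd⟩)).mp hp
    obtain ⟨v, hv⟩ := h1
    have hv' : d = fun g => ρ g v - v := hv.symm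
    subst hv'
    exact hinj t v htd

/-! ### Bending cocycles -/

section Cocycles

open Module

variable {n : ℕ} {Γ : Subgroup (OPlus n)} {Δ : Set (Mfd Γ)} {N : Hyp n → Vec n}

/-- The jumps of a weight on the walls. -/
def wallJump (Δ : Set (Mfd Γ)) (N : Hyp n → Vec n) (t : Walls Δ →₀ ℝ) : Vec n → Vec n → nu n :=
  jumpModel (lift Δ) N bend (wallWeight Δ t)

lemma jumpModel_smul_smul {D : Set (Hyp n)} {A : Type*} [AddCommGroup A] [Module ℝ A]
    (β : Vec n → A) (r : Hyp n → ℝ) {s : ℝ} (hs : 0 < s) {z : Vec n} (hz : z ∈ cone n)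
    (w : Vec n) : jumpModel D N β r (s • z) (s • w) = jumpModel D N β r z w := by
  have hiff : 0 < mink (N (toHyp z)) (s • w) ↔ 0 < mink (N (toHyp z)) w := by
    rw [mink_smul_right, mul_pos_iff_of_pos_left hs]
  rw [jumpModel, jumpModel, toHyp_smul hs hz]
  by_cases h : toHyp z ∈ regularPoints D ∧ 0 < mink (N (toHyp z)) w
  · rw [if_pos h, if_pos ⟨h.1, hiff.mpr h.2⟩]
  · rw [if_neg h, if_neg fun h' => h ⟨h'.1, hiff.mp h'.2⟩]

lemma smul_mem_tame {D : Set (Hyp n)} {s : ℝ} (hs : 0 < s) {z : Vec n} (hz : z ∈ tame D) :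
    s • z ∈ tame D :=
  ⟨smul_mem_cone hs hz.1, by rw [toHyp_smul hs hz.1]; exact hz.2⟩

lemma locSolvable_smul {D : Set (Hyp n)} {A : Type*} [AddCommGroup A] [Module ℝ A]
    {β : Vec n → A} {r : Hyp n → ℝ} {s : ℝ} (hs : 0 < s) {z : Vec n}
    (h : LocSolvable (jumpModel D N β r) (tame D) z) :
    LocSolvable (jumpModel D N β r) (tame D) (s • z) := by
  obtain ⟨Φ, hΦ⟩ := h
  have hs' := inv_pos.mpr hs
  have hcont : Continuous fun w : Vec n => s⁻¹ • w := continuous_const_smul _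
  have htend : Tendsto (fun w : Vec n => s⁻¹ • w) (𝓝 (s • z)) (𝓝 z) := by
    have := hcont.tendsto (s • z)
    rwa [inv_smul_smul₀ hs.ne'] at this
  refine ⟨fun w => Φ (s⁻¹ • w), ?_⟩
  filter_upwards [htend.eventually hΦ] with y hy hyt
  refine IsSolAt.comp (h := fun w : Vec n => s⁻¹ • w) hcont (isOpenMap_smul₀ hs'.ne')
    (AddMonoidHom.id A) (Eventually.of_forall fun w => ?_) (hy (smul_mem_tame hs' hyt))
  exact (jumpModel_smul_smul β r hs' hyt.1 w).symm

/-- Membership in `globalWeights` gives solvability at binding points of the hyperboloid;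
homogeneity spreads it along rays of the cone. -/
lemma exists_adapted_wallJump (hD : IsPiecewiseGeodesic (lift Δ)) (hN : IsConormalField (lift Δ) N)
    {t : Walls Δ →₀ ℝ} (ht : t ∈ globalWeights Δ N) :
    ∀ z ∈ cone n, ∃ W ∈ 𝓝 z, ∃ 𝓕, Adapted (wallJump Δ N t) (tame (lift Δ)) 𝓕 W := by
  refine exists_adapted hD hN (locConstAlong_wallWeight t) fun z hz hzb => ?_
  obtain ⟨r, hr, h⟩ := exists_hyp_smul hz
  rw [h]
  refine locSolvable_smul hr ?_
  rw [globalWeights, Submodule.mem_iInf] at ht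
  have := ht (toHyp z)
  rw [Submodule.mem_iInf] at this
  exact this hzb

/-- A solution of the jump problem that is equivariant up to the constants `c`. -/
structure IsBendingSolution (N : Hyp n → Vec n) (t : Walls Δ →₀ ℝ) (c : Γ → nu n)
    (Φ : Vec n → nu n) : Prop where
  isSolAt : ∀ y ∈ cone n, y ∈ tame (lift Δ) → IsSolAt (wallJump Δ N t) Φ y
  equivariant : ∀ γ : Γ, ∀ x ∈ cone n, ∀ᶠ z in genNhds x,
    adNu n γ (Φ ((γ⁻¹ : Γ).val.val.val.mulVec z)) = Φ z + c γ

/-- The transport of a solution by `γ` solves the same problem, so it differs from the solution by a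
constant, which is `c γ`. -/
lemma exists_isBendingSolution (hD : IsPiecewiseGeodesic (lift Δ))
    (hN : IsConormalField (lift Δ) N) (hNΓ : IsEquivariantField Δ N) {t : Walls Δ →₀ ℝ}
    (ht : t ∈ globalWeights Δ N) : ∃ c Φ, IsBendingSolution N t c Φ := by
  have hloc := exists_adapted_wallJump hD hN ht
  obtain ⟨Φ, hΦ⟩ := exists_isSolAt_of_locally_adapted
    (isSolAt_jumpModel hD hN (locConstAlong_wallWeight t)) (isOpen_cone n) (convex_cone n) hloc
  have hc : ∀ γ : Γ, ∃ c, ∀ x ∈ cone n, ∀ᶠ z in genNhds x,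
      adNu n γ (Φ ((γ⁻¹ : Γ).val.val.val.mulVec z)) = Φ z + c := fun γ =>
    exists_const_of_locally_adapted (isOpen_cone n) (convex_cone n) hloc
      (fun y hy hyt => isSolAt_transport hNΓ γ.2 hy
        (hΦ _ (mulVec_mem_cone _ hy) (mulVec_mem_tame (Γ.inv_mem γ.2) hyt))) hΦ
  choose c hc using hc
  exact ⟨c, Φ, hΦ, hc⟩

lemma tendsto_mulVec_genNhds (g : OPlus n) (x : Vec n) :
    Tendsto g.val.val.mulVec (genNhds x) (genNhds (g.val.val.mulVec x)) :=
  tendsto_genNhds (isometryHomeo g).continuous (isometryHomeo g).isOpenMap x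

/-- The cocycle rule is read off at one generic point where the relations for `g * k`, `g` and `k`
all hold. -/
lemma IsBendingSolution.mul {t : Walls Δ →₀ ℝ} {c : Γ → nu n} {Φ : Vec n → nu n}
    (h : IsBendingSolution N t c Φ) (g k : Γ) : c (g * k) = adNu n g (c k) + c g := by
  have ho := hyp_mem_cone (origin n)
  obtain ⟨z, ⟨h1, h2⟩, h3⟩ := (((h.equivariant (g * k) _ ho).and (h.equivariant g _ ho)).and
    ((tendsto_mulVec_genNhds (g⁻¹ : Γ).val _).eventually
      (h.equivariant k _ (mulVec_mem_cone (g⁻¹ : Γ).val ho)))).exists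
  have h4 : ((g * k)⁻¹ : Γ).val.val.val.mulVec z =
      (k⁻¹ : Γ).val.val.val.mulVec ((g⁻¹ : Γ).val.val.val.mulVec z) := by
    rw [mul_inv_rev, Matrix.mulVec_mulVec]
    rfl
  have h5 : ∀ X, adNu n (g * k : Γ) X = adNu n g (adNu n k X) := fun X => by
    rw [Subgroup.coe_mul, map_mul]
    rfl
  rw [h4, h5, h3, map_add, h2] at h1
  exact (add_left_cancel (h1.symm.trans (by abel : _ = Φ z + (adNu n g (c k) + c g))))

/-- The weights together with the cocycles of their equivariant solutions. -/
def bendingCocycles (Δ : Set (Mfd Γ)) (N : Hyp n → Vec n) :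
    Submodule ℝ (globalWeights Δ N × (Γ → nu n)) where
  carrier := {p | ∃ Φ, IsBendingSolution N p.1.val p.2 Φ}
  zero_mem' := by
    refine ⟨0, fun y _ _ => ?_, fun γ x _ => Eventually.of_forall fun z => ?_⟩
    · have : wallJump Δ N 0 = 0 := by
        rw [wallJump, map_zero, ← zero_smul ℝ (0 : Hyp n → ℝ), jumpModel_smul, zero_smul]
      change IsSolAt (wallJump Δ N 0) 0 y
      rw [this]
      exact IsSolAt.zero y
    · simp
  add_mem' := by
    rintro p q ⟨Φ, h⟩ ⟨Φ', h'⟩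
    refine ⟨Φ + Φ', fun y hy hyt => ?_, fun γ x hx => ?_⟩
    · have : wallJump Δ N (p.1.val + q.1.val) = wallJump Δ N p.1.val + wallJump Δ N q.1.val := by
        rw [wallJump, map_add, jumpModel_add]
        rfl
      change IsSolAt (wallJump Δ N (p.1.val + q.1.val)) _ y
      rw [this]
      exact (h.isSolAt y hy hyt).add (h'.isSolAt y hy hyt)
    · filter_upwards [h.equivariant γ x hx, h'.equivariant γ x hx] with z h1 h2
      simp only [Pi.add_apply, map_add, h1, h2, Prod.snd_add]
      abel
  smul_mem' := by
    rintro a p ⟨Φ, h⟩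
    refine ⟨a • Φ, fun y hy hyt => ?_, fun γ x hx => ?_⟩
    · have : wallJump Δ N (a • p.1.val) = a • wallJump Δ N p.1.val := by
        rw [wallJump, map_smul, jumpModel_smul]
        rfl
      change IsSolAt (wallJump Δ N (a • p.1.val)) _ y
      rw [this]
      exact (h.isSolAt y hy hyt).smul a
    · filter_upwards [h.equivariant γ x hx] with z h1
      simp only [Pi.smul_apply, map_smul, h1, Prod.smul_snd, smul_add]

/-- A generically invariant function that is locally constant on the cells vanishes there. -/
lemma eventually_eq_zero_of_invariant (hcells : CellsZariskiDense Δ) {Φ : Vec n → nu n}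
    (hΦ : ∀ y ∈ cone n, toHyp y ∉ lift Δ → ∃ c, ∀ᶠ z in genNhds y, Φ z = c)
    (hinv : ∀ γ ∈ Γ, ∀ x ∈ cone n, ∀ᶠ z in genNhds x,
      adNu n γ (Φ ((γ⁻¹).val.val.mulVec z)) = Φ z) {y : Vec n} (hy : y ∈ cone n)
    (hyD : toHyp y ∉ lift Δ) : ∀ᶠ z in genNhds y, Φ z = 0 := by
  obtain ⟨r, hr, hry⟩ := exists_hyp_smul hy
  set x := toHyp y
  set δ := connectedComponentIn (lift Δ)ᶜ x with hδ
  -- The cone over the cell is connected, so the function has one generic value `d` there. The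
  -- stabilizer of the cell maps this cone to itself and therefore fixes `d`.
  set K : Set (Vec n) := (fun p : Hyp n × ℝ => p.2 • p.1.val) '' (δ ×ˢ Set.Ioi 0) with hKdef
  have hK : IsPreconnected K := (isPreconnected_connectedComponentIn.prod isPreconnected_Ioi).image _
    (by fun_prop)
  have hKc : ∀ z ∈ K, z ∈ cone n ∧ toHyp z ∉ lift Δ := by
    rintro _ ⟨⟨p, s⟩, ⟨hp, hs⟩, rfl⟩
    refine ⟨smul_mem_cone hs (hyp_mem_cone p), ?_⟩
    rw [toHyp_smul hs (hyp_mem_cone p), toHyp_coe]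
    exact connectedComponentIn_subset _ _ hp
  obtain ⟨d, hd⟩ := exists_const_of_isPreconnected hK
    (fun z d => ∀ᶠ w in genNhds z, Φ w = d) (fun z hz => hΦ z (hKc z hz).1 (hKc z hz).2)
    (fun z _ d hd => (eventually_eventually_genNhds hd).filter_mono nhdsWithin_le_nhds)
    (fun z _ d e hd he => by
      obtain ⟨w, h1, h2⟩ := (hd.and he).exists
      exact h1.symm.trans h2)
  have hxδ : x ∈ δ := mem_connectedComponentIn hyD
  have hyK : y ∈ K := ⟨(x, r), ⟨hxδ, hr⟩, hry.symm⟩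
  have hd0 : d = 0 := by
    refine eq_zero_of_zariskiDense (hcells x hyD) fun γ hγ => ?_
    obtain ⟨x', hx', hxx'⟩ : x ∈ (fun p => γ • p) '' δ := by rw [hγ.2]; exact hxδ
    have hγy : (γ⁻¹).val.val.mulVec y ∈ K := by
      refine ⟨(x', r), ⟨hx', hr⟩, ?_⟩
      have hx'' : (γ • x').val = x.val := congrArg Subtype.val hxx'
      rw [smul_val] at hx''
      rw [hry, Matrix.mulVec_smul, ← hx'', mulVec_inv_mulVec]
    obtain ⟨z, ⟨h1, h2⟩, h3⟩ := (((hinv γ hγ.1 y hy).and (hd y hyK)).and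
      ((tendsto_mulVec_genNhds γ⁻¹ y).eventually (hd _ hγy))).exists
    rwa [h2, h3] at h1
  rw [← hd0]
  exact hd y hyK

/-- A weight that has a solution vanishing off `Δ` is zero. -/
lemma eq_zero_of_isSolAt_of_eventually_eq_zero (hN : IsConormalField (lift Δ) N)
    {t : Walls Δ →₀ ℝ} {Φ : Vec n → nu n}
    (hΦ : ∀ y ∈ cone n, y ∈ tame (lift Δ) → IsSolAt (wallJump Δ N t) Φ y)
    (h0 : ∀ y ∈ cone n, toHyp y ∉ lift Δ → ∀ᶠ z in genNhds y, Φ z = 0) : t = 0 := by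
  ext w
  obtain ⟨x, hx, hxw⟩ := exists_wallAt_eq w
  have hxc := hyp_mem_cone x
  obtain ⟨c, hc⟩ := hΦ x.val hxc ⟨hxc, Or.inr (by rwa [toHyp_coe])⟩
  obtain ⟨hNx, hN0, hNx0, hNev⟩ := hN.2 x hx
  have hf0 := minkForm_ne_zero hN0
  have hzero : ∀ᶠ z in genNhds x.val, Φ z = 0 := by
    refine eventually_genNhds_of_dense (dense_ne_zero hf0) ?_
    have hev := (tendsto_toHyp hxc).eventually (by rw [toHyp_coe]; exact hNev)
    filter_upwards [hev, eventually_mem_cone hxc] with z hz hzc hz0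
    refine h0 z hzc fun hzD => hz0 ?_
    exact (mink_toHyp_eq_zero hzc _).mp (hz.mp hzD)
  have hmodel : ∀ z, wallJump Δ N t x.val z = if 0 < mink (N x) z then t w • bend (N x) else 0 := by
    intro z
    rw [wallJump, jumpModel, toHyp_coe, wallWeight_apply, hxw]
    by_cases h : 0 < mink (N x) z
    · rw [if_pos ⟨hx, h⟩, if_pos h]
      rfl
    · rw [if_neg fun h' => h h'.2, if_neg h]
  have hopen_neg : IsOpen {z : Vec n | minkForm n (N x) z < 0} :=
    isOpen_lt (continuous_mink_right _) continuous_const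
  -- The negative side of the wall gives `c = 0`; the positive side then gives `t w • bend (N x) =
  -- 0`.
  obtain ⟨z, hz, h1, h2⟩ := ((frequently_genNhds_of_mem_closure hopen_neg
    (mem_closure_neg hf0 hNx0)).and_eventually (hc.and hzero)).exists
  obtain ⟨z', hz', h1', h2'⟩ := ((frequently_genNhds_of_mem_closure (isOpen_pos _)
    (mem_closure_pos hf0 hNx0)).and_eventually (hc.and hzero)).exists
  rw [hmodel, if_neg (not_lt.mpr (le_of_lt hz)), h2, zero_add] at h1
  rw [hmodel, if_pos (show 0 < mink (N x) z' from hz'), h2', ← h1, add_zero] at h1'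
  have hx0 : x.val ≠ 0 := fun h => by
    have := x.2.2
    rw [h] at this
    exact lt_irrefl _ this
  exact (smul_eq_zero.mp h1'.symm).resolve_right (bend_ne_zero hNx hNx0 hx0)

/-- A weight whose cocycle is a coboundary is zero. -/
lemma IsBendingSolution.eq_zero (hcells : CellsZariskiDense Δ) (hN : IsConormalField (lift Δ) N)
    {t : Walls Δ →₀ ℝ} {v : nu n} {Φ : Vec n → nu n}
    (h : IsBendingSolution N t (fun γ => adNu n γ v - v) Φ) : t = 0 := by
  -- Subtracting `v` keeps the jumps and turns equivariance up to a coboundary into invariance.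
  have hsol : ∀ y ∈ cone n, y ∈ tame (lift Δ) →
      IsSolAt (wallJump Δ N t) (fun z => Φ z - v) y := fun y hy hyt =>
    (h.isSolAt y hy hyt).congr (c := -v) (Eventually.of_forall fun z => sub_eq_add_neg _ _)
  refine eq_zero_of_isSolAt_of_eventually_eq_zero hN hsol fun y hy hyD => ?_
  refine eventually_eq_zero_of_invariant hcells (fun y hy hyD => ?_) (fun γ hγ x hx => ?_) hy hyD
  · exact (hsol y hy ⟨hy, Or.inl hyD⟩).const_of_zero (isSolAt_zero_of_not_mem hyD)
  · filter_upwards [h.equivariant ⟨γ, hγ⟩ x hx] with z hz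
    have hz' : adNu n γ (Φ ((γ⁻¹).val.val.mulVec z)) = Φ z + (adNu n γ v - v) := hz
    rw [map_sub, hz']
    abel

/-- Bending along the walls injects the weights that are solvable along the bindings into the
first cohomology. -/
lemma rank_globalWeights_le (hD : IsPiecewiseGeodesic (lift Δ)) (hN : IsConormalField (lift Δ) N)
    (hNΓ : IsEquivariantField Δ N) (hcells : CellsZariskiDense Δ) :
    Module.rank ℝ (globalWeights Δ N) ≤ Module.rank ℝ (H1nu Γ) := by
  refine rank_le_rank_H1 (T := globalWeights Δ N) (V := nu n) ((adNu n).comp Γ.subtype)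
    (bendingCocycles Δ N) ?_ (fun t => ?_) ?_
  · rintro p ⟨Φ, h⟩ g k
    exact h.mul g k
  · obtain ⟨c, Φ, h⟩ := exists_isBendingSolution hD hN hNΓ t.2
    exact ⟨c, Φ, h⟩
  · rintro t v ⟨Φ, h⟩
    exact Subtype.ext (h.eq_zero hcells hN)

end Cocycles

end BranchedBending

end

theorem theorem1p2 (n : ℕ) (hn : 2 ≤ n) (Γ : Subgroup (BranchedBending.OPlus n))
    (hΓ : BranchedBending.IsManifoldGroup Γ) (Δ : Set (BranchedBending.Mfd Γ))
    (hΔ : BranchedBending.IsBranchedHypersurface Δ)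
    (hor : BranchedBending.TransverselyOrientable Δ)
    (hcells : BranchedBending.CellsZariskiDense Δ) :
    Cardinal.mk (BranchedBending.Walls Δ) ≤
      Module.rank ℝ (BranchedBending.H1nu Γ) + 3 * Cardinal.mk (BranchedBending.Bindings Δ) := by
  obtain ⟨N, hcont, hN⟩ := hor
  have hN' : BranchedBending.IsConormalField (BranchedBending.lift Δ) N :=
    ⟨hcont, fun x hx => ⟨(hN x hx).1, (hN x hx).2.1⟩⟩
  have hNΓ : BranchedBending.IsEquivariantField Δ N := fun x hx => (hN x hx).2.2
  exact (BranchedBending.mk_walls_le hΔ hN' hNΓ).trans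
    (add_le_add_left (BranchedBending.rank_globalWeights_le hΔ hN' hNΓ hcells) _)
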